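/- **Theorem 4.1.** Let $m\ge 1$, $T_0,\dots,T_m>0$, $a\in\mathbb R\setminus\{0\}$, and let $\mathbf q=\{q_j\}_{j=0}^m$, $\tilde{\mathbf q}=\{\tilde q_j\}_{j=0}^m$ be real-valued potentials with $q_j,\tilde q_j\in L_2(0,T_j)$ and $\int_0^{T_j}q_j=\int_0^{T_j}\tilde q_j=0$ for $j=0,\dots,m$. Let $\mathcal L=\mathcal L(\mathbf q)$ be the eigenvalue problem $$-y_j''+q_jy_j=\lambda y_j \ \text{ on } (0,T_j),\quad j=0,\dots,m,\qquad y_j(0)=0,\quad j=1,\dots,m,$$ $$y_0(0)=a\,y_0(T_0)=y_j(T_j),\quad j=1,\dots,m,\qquad y_0'(0)=a^{-1}y_0'(T_0)+\sum_{j=1}^m y_j'(T_j)$$ (on a graph with loop $e_0$ and boundary edges $e_1,\dots,e_m$), and $\tilde{\mathcal L}=\mathcal L(\tilde{\mathbf q})$; a tilde marks the objects built from $\tilde{\mathbf q}$. Let $S_j(x,\lambda)$, $C_j(x,\lambda)$ be the solutions of the $j$-th equation with $S_j(0,\lambda)=C_j'(0,\lambda)=0$, $S_j'(0,\lambda)=C_j(0,\lambda)=1$.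 Put $d(\lambda)=aC_0(T_0,\lambda)+a^{-1}S_0'(T_0,\lambda)$, $h(\lambda)=S_0(T_0,\lambda)$ and, with all functions of the edges $1,\dots,m$ evaluated at $(T_j,\lambda)$ and all indices running over $1,\dots,m$, $$\Delta(\lambda)=(d(\lambda)-2)\prod_{j}S_j+a\,h(\lambda)\sum_{r}S_r'\prod_{j\ne r}S_j,$$ $$\Delta_k(\lambda)=(d(\lambda)-2)\,C_k\prod_{j\ne k}S_j+a\,h(\lambda)\Bigl(C_k'\prod_{j\ne k}S_j+C_k\sum_{r\ne k}S_r'\prod_{j\ne r,k}S_j\Bigr),\qquad k=1,\dots,m.$$ Fix $k\in\{1,\dots,m\}$, write $S=S_k$, $\tilde S=\tilde S_k$, $T=T_k$, and put $M=-\Delta_k/\Delta$, $\tilde M=-\tilde\Delta_k/\tilde\Delta$, $\hat M=M-\tilde M$. For $\tau>0$ let $\Gamma=\{\mu=\theta^2:\theta=\sigma+i\tau,\ \sigma\in\mathbb R\}$, traversed in the direction of increasing $\sigma$. Then: 1. For all sufficiently large $\tau>0$, all the eigenvalues of $\mathcal L$ and $\tilde{\mathcal L}$ lie inside $\Gamma$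 (that is, in $\{\rho^2:|\operatorname{Im}\rho|<\tau\}$). 2. There exists a transformation operator: a function $K(x,t)$, continuous for $0\le t\le x\le T$, such that for all $x\in[0,T]$, $\lambda\in\mathbb C$ $$\tilde S(x,\lambda)=S(x,\lambda)+\int_0^xK(x,t)S(t,\lambda)\,dt.$$ 3. For every such kernel $K$ and every $\tau>0$ such that all the eigenvalues of $\mathcal L$ and $\tilde{\mathcal L}$ lie inside $\Gamma$, the integral $$F(x,t)=-\frac1{2\pi i}\int_\Gamma\hat M(\mu)S(x,\mu)S(t,\mu)\,d\mu,\qquad x,t\in[0,T],$$ converges absolutely, and for each $x\in[0,T]$ and all $t\in[0,x]$ $$K(x,t)+F(x,t)+\int_0^xK(x,s)F(s,t)\,ds=0,$$ where the integrand of the last integral is integrable. -/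

import Mathlib

open MeasureTheory Set Filter Topology

/-- `y` is a (Carathéodory) solution on `[0, T]` of the equation `-y'' + q y = lam y`, with
derivative `z = y'`: `y` is continuously differentiable, `y'` is absolutely continuous, and the
equation `y'' = (q - lam) y` holds almost everywhere. This is written in integrated form. -/
structure IsSLSolution (q : ℝ → ℝ) (T : ℝ) (lam : ℂ) (y z : ℝ → ℂ) : Prop where
  continuousOn_y : ContinuousOn y (Icc 0 T)
  continuousOn_z : ContinuousOn z (Icc 0 T)
  y_eq : ∀ x ∈ Icc 0 T, y x = y 0 + ∫ t in (0 : ℝ)..x, z t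
  z_eq : ∀ x ∈ Icc 0 T, z x = z 0 + ∫ t in (0 : ℝ)..x, ((q t : ℂ) - lam) * y t

theorem sl_integral_pow {T : ℝ} {g : ℝ → ℝ} (hg : IntervalIntegrable g volume 0 T) (n : ℕ)
    {x : ℝ} (hx : x ∈ Icc 0 T) :
    IntervalIntegrable (fun t => g t * (∫ s in (0 : ℝ)..t, g s) ^ n) volume 0 x ∧
    ∫ t in (0 : ℝ)..x, g t * (∫ s in (0 : ℝ)..t, g s) ^ n
      = (∫ s in (0 : ℝ)..x, g s) ^ (n + 1) / (n + 1) := by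
  have hgx : IntervalIntegrable g volume 0 x := hg.mono_set (by
    rw [uIcc_of_le hx.1, uIcc_of_le (hx.1.trans hx.2)]; exact Icc_subset_Icc_right hx.2)
  set G : ℝ → ℝ := fun t => ∫ s in (0 : ℝ)..t, g s with hG
  have hac : AbsolutelyContinuousOnInterval G 0 x :=
    hgx.absolutelyContinuousOnInterval_intervalIntegral (by simp)
  have hpow : ∀ k : ℕ, AbsolutelyContinuousOnInterval (fun t => G t ^ (k + 1)) 0 x := by
    intro k
    induction k with
    | zero => simpa using hac
    | succ k ih =>
      have := ih.fun_mul hac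
      simpa [pow_succ] using this
  refine ⟨hgx.mul_continuousOn (hac.continuousOn.pow n), ?_⟩
  have h1 := (hpow n).integral_deriv_eq_sub
  have h2 : ∫ t in (0 : ℝ)..x, deriv (fun t => G t ^ (n + 1)) t
      = ∫ t in (0 : ℝ)..x, ((n : ℝ) + 1) * (g t * G t ^ n) := by
    apply intervalIntegral.integral_congr_ae
    filter_upwards [hgx.ae_hasDerivAt_integral] with t ht htm
    have h3 := ht (uIoc_subset_uIcc htm) 0 (by simp)
    have h4 := (h3.pow (n + 1)).deriv
    rw [show (fun t => G t ^ (n + 1)) = (fun x => ∫ (t : ℝ) in (0:ℝ)..x, g t) ^ (n + 1) from rfl, h4]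
    simp [hG]; ring
  rw [h2, intervalIntegral.integral_const_mul] at h1
  have h0 : G 0 = 0 := by simp [hG]
  rw [h0] at h1
  have : (0 : ℝ) < (n : ℝ) + 1 := by positivity
  rw [eq_div_iff this.ne', mul_comm]
  simpa using h1

/-- One Picard step for the integrated system. -/
theorem sl_step {q : ℝ → ℝ} {T : ℝ} (hq : IntervalIntegrable q volume 0 T) (lam : ℂ)
    {y z : ℝ → ℂ} {A : ℝ} (n : ℕ)
    (hy : ∀ x ∈ Icc 0 T, ‖y x‖ ≤ A * ((∫ s in (0 : ℝ)..x, (1 + ‖(q s : ℂ) - lam‖)) ^ n / n.factorial))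
    (hz : ∀ x ∈ Icc 0 T, ‖z x‖ ≤ A * ((∫ s in (0 : ℝ)..x, (1 + ‖(q s : ℂ) - lam‖)) ^ n / n.factorial)) :
    ∀ x ∈ Icc 0 T,
      ‖∫ t in (0 : ℝ)..x, z t‖ ≤
        A * ((∫ s in (0 : ℝ)..x, (1 + ‖(q s : ℂ) - lam‖)) ^ (n + 1) / (n + 1).factorial) ∧
      ‖∫ t in (0 : ℝ)..x, ((q t : ℂ) - lam) * y t‖ ≤
        A * ((∫ s in (0 : ℝ)..x, (1 + ‖(q s : ℂ) - lam‖)) ^ (n + 1) / (n + 1).factorial) := by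
  intro x hx
  have hq' : IntervalIntegrable (fun s => (q s : ℂ) - lam) volume 0 T :=
    IntervalIntegrable.sub ⟨hq.1.ofReal, hq.2.ofReal⟩ intervalIntegrable_const
  have hg : IntervalIntegrable (fun s => 1 + ‖(q s : ℂ) - lam‖) volume 0 T :=
    intervalIntegrable_const.add hq'.norm
  obtain ⟨hi, he⟩ := sl_integral_pow hg n hx
  set G : ℝ → ℝ := fun x => ∫ s in (0 : ℝ)..x, (1 + ‖(q s : ℂ) - lam‖) with hG
  have hG0 : ∀ t ∈ Icc 0 T, 0 ≤ G t := fun t ht =>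
    intervalIntegral.integral_nonneg ht.1 (fun s _ => by positivity)
  have key : ∫ t in (0 : ℝ)..x, (A / n.factorial) * ((1 + ‖(q t : ℂ) - lam‖) * G t ^ n)
      = A * (G x ^ (n + 1) / (n + 1).factorial) := by
    rw [intervalIntegral.integral_const_mul, he, Nat.factorial_succ]
    push_cast
    simp only [hG]
    field_simp
  have hi' := hi.const_mul (A / n.factorial)
  rw [← key]
  constructor
  · apply intervalIntegral.norm_integral_le_of_norm_le hx.1 _ hi'
    refine Eventually.of_forall fun t ht => ?_
    have htm : t ∈ Icc 0 T := ⟨ht.1.le, ht.2.trans hx.2⟩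
    have h1 := hz t htm
    have h2 : (0 : ℝ) ≤ A * (G t ^ n / n.factorial) := (norm_nonneg _).trans h1
    calc ‖z t‖ ≤ A * (G t ^ n / n.factorial) := h1
      _ ≤ (1 + ‖(q t : ℂ) - lam‖) * (A * (G t ^ n / n.factorial)) :=
        le_mul_of_one_le_left h2 (by linarith [norm_nonneg ((q t : ℂ) - lam)])
      _ = _ := by ring
  · apply intervalIntegral.norm_integral_le_of_norm_le hx.1 _ hi'
    refine Eventually.of_forall fun t ht => ?_
    have htm : t ∈ Icc 0 T := ⟨ht.1.le, ht.2.trans hx.2⟩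
    have h1 := hy t htm
    rw [norm_mul]
    calc ‖(q t : ℂ) - lam‖ * ‖y t‖ ≤ (1 + ‖(q t : ℂ) - lam‖) * (A * (G t ^ n / n.factorial)) :=
          mul_le_mul (by linarith) h1 (norm_nonneg _) (by positivity)
      _ = _ := by ring

theorem sl_intervalIntegrable {q : ℝ → ℝ} {T : ℝ} (hq : IntervalIntegrable q volume 0 T) (lam : ℂ)
    {y : ℝ → ℂ} (hy : ContinuousOn y (Icc 0 T)) {x : ℝ} (hx : x ∈ Icc 0 T) :
    IntervalIntegrable (fun t => ((q t : ℂ) - lam) * y t) volume 0 x := by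
  have hq' : IntervalIntegrable (fun s => (q s : ℂ) - lam) volume 0 T :=
    IntervalIntegrable.sub ⟨hq.1.ofReal, hq.2.ofReal⟩ intervalIntegrable_const
  have hsub : uIcc 0 x ⊆ uIcc 0 T := by
    rw [uIcc_of_le hx.1, uIcc_of_le (hx.1.trans hx.2)]; exact Icc_subset_Icc_right hx.2
  have := hq'.mul_continuousOn (by rwa [uIcc_of_le (hx.1.trans hx.2)])
  exact this.mono_set hsub

theorem IsSLSolution.ext_of_initial {q : ℝ → ℝ} {T : ℝ} (hq : IntervalIntegrable q volume 0 T)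
    {lam : ℂ} {y z y₁ z₁ : ℝ → ℂ} (h : IsSLSolution q T lam y z) (h₁ : IsSLSolution q T lam y₁ z₁)
    (hy : y 0 = y₁ 0) (hz : z 0 = z₁ 0) : ∀ x ∈ Icc 0 T, y x = y₁ x ∧ z x = z₁ x := by
  have cy := h.continuousOn_y.sub h₁.continuousOn_y
  have cz := h.continuousOn_z.sub h₁.continuousOn_z
  obtain ⟨A, hA⟩ := isCompact_Icc.exists_bound_of_continuousOn cy
  obtain ⟨B, hB⟩ := isCompact_Icc.exists_bound_of_continuousOn cz
  have hint : ∀ {w : ℝ → ℂ}, ContinuousOn w (Icc 0 T) → ∀ x ∈ Icc 0 T,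
      IntervalIntegrable w volume 0 x := fun {w} hw x hx =>
    ContinuousOn.intervalIntegrable (by
      rw [uIcc_of_le hx.1]; exact hw.mono (Icc_subset_Icc_right hx.2))
  have ey : ∀ x ∈ Icc 0 T, y x - y₁ x = ∫ t in (0 : ℝ)..x, (z t - z₁ t) := fun x hx => by
    rw [intervalIntegral.integral_sub (hint h.continuousOn_z x hx) (hint h₁.continuousOn_z x hx),
      h.y_eq x hx, h₁.y_eq x hx, hy]; ring
  have ez : ∀ x ∈ Icc 0 T, z x - z₁ x
      = ∫ t in (0 : ℝ)..x, ((q t : ℂ) - lam) * (y t - y₁ t) := fun x hx => by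
    simp_rw [mul_sub]
    rw [intervalIntegral.integral_sub (sl_intervalIntegrable hq lam h.continuousOn_y hx)
      (sl_intervalIntegrable hq lam h₁.continuousOn_y hx), h.z_eq x hx, h₁.z_eq x hx, hz]; ring
  have key : ∀ n : ℕ, ∀ x ∈ Icc 0 T,
      ‖y x - y₁ x‖ ≤ max A B *
        ((∫ s in (0 : ℝ)..x, (1 + ‖(q s : ℂ) - lam‖)) ^ n / n.factorial) ∧
      ‖z x - z₁ x‖ ≤ max A B *
        ((∫ s in (0 : ℝ)..x, (1 + ‖(q s : ℂ) - lam‖)) ^ n / n.factorial) := by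
    intro n
    induction n with
    | zero =>
      intro x hx
      simp only [pow_zero, Nat.factorial_zero, Nat.cast_one, div_one, mul_one]
      exact ⟨(hA x hx).trans (le_max_left A B), (hB x hx).trans (le_max_right A B)⟩
    | succ n ih =>
      intro x hx
      have := sl_step hq lam (y := fun t => y t - y₁ t) (z := fun t => z t - z₁ t) n
        (fun t ht => (ih t ht).1) (fun t ht => (ih t ht).2) x hx
      rw [ey x hx, ez x hx]
      exact this
  intro x hx
  have lim := (FloorSemiring.tendsto_pow_div_factorial_atTop
    (∫ s in (0 : ℝ)..x, (1 + ‖(q s : ℂ) - lam‖))).const_mul (max A B)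
  rw [mul_zero] at lim
  have e1 : ‖y x - y₁ x‖ ≤ 0 := ge_of_tendsto' lim fun n => (key n x hx).1
  have e2 : ‖z x - z₁ x‖ ≤ 0 := ge_of_tendsto' lim fun n => (key n x hx).2
  exact ⟨sub_eq_zero.1 (norm_le_zero_iff.1 e1), sub_eq_zero.1 (norm_le_zero_iff.1 e2)⟩

/-- Terms of the Picard series. -/
noncomputable def slPicard (q : ℝ → ℝ) (lam α β : ℂ) : ℕ → (ℝ → ℂ) × (ℝ → ℂ)
  | 0 => (fun _ => α, fun _ => β)
  | n + 1 => (fun x => ∫ t in (0 : ℝ)..x, (slPicard q lam α β n).2 t,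
      fun x => ∫ t in (0 : ℝ)..x, ((q t : ℂ) - lam) * (slPicard q lam α β n).1 t)

theorem slPicard_bound {q : ℝ → ℝ} {T : ℝ} (hq : IntervalIntegrable q volume 0 T)
    (lam α β : ℂ) (n : ℕ) : ∀ x ∈ Icc 0 T,
      ‖(slPicard q lam α β n).1 x‖ ≤ max ‖α‖ ‖β‖ *
        ((∫ s in (0 : ℝ)..x, (1 + ‖(q s : ℂ) - lam‖)) ^ n / n.factorial) ∧
      ‖(slPicard q lam α β n).2 x‖ ≤ max ‖α‖ ‖β‖ *
        ((∫ s in (0 : ℝ)..x, (1 + ‖(q s : ℂ) - lam‖)) ^ n / n.factorial) := by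
  induction n with
  | zero => intro x hx; simp [slPicard]
  | succ n ih =>
    exact sl_step hq lam n (fun t ht => (ih t ht).1) (fun t ht => (ih t ht).2)

theorem slPicard_continuousOn {q : ℝ → ℝ} {T : ℝ} (hT : 0 ≤ T)
    (hq : IntervalIntegrable q volume 0 T) (lam α β : ℂ) (n : ℕ) :
    ContinuousOn (slPicard q lam α β n).1 (Icc 0 T) ∧
    ContinuousOn (slPicard q lam α β n).2 (Icc 0 T) := by
  induction n with
  | zero => exact ⟨continuousOn_const, continuousOn_const⟩
  | succ n ih =>
    have hTm : T ∈ Icc 0 T := ⟨hT, le_rfl⟩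
    have h1 : IntervalIntegrable (slPicard q lam α β n).2 volume 0 T :=
      ContinuousOn.intervalIntegrable (by rw [uIcc_of_le hT]; exact ih.2)
    have h2 := sl_intervalIntegrable hq lam ih.1 hTm
    have c1 := intervalIntegral.continuousOn_primitive_interval' h1 (left_mem_uIcc)
    have c2 := intervalIntegral.continuousOn_primitive_interval' h2 (left_mem_uIcc)
    rw [uIcc_of_le hT] at c1 c2
    exact ⟨c1, c2⟩

/-- Existence for the initial value problem. -/
theorem IsSLSolution.exists_of_initial {q : ℝ → ℝ} {T : ℝ} (hT : 0 ≤ T)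
    (hq : IntervalIntegrable q volume 0 T) (lam α β : ℂ) :
    ∃ p : (ℝ → ℂ) × (ℝ → ℂ), IsSLSolution q T lam p.1 p.2 ∧ p.1 0 = α ∧ p.2 0 = β := by
  set P := slPicard q lam α β with hP
  set L : ℝ := ∫ s in (0 : ℝ)..T, (1 + ‖(q s : ℂ) - lam‖) with hL
  set b : ℕ → ℝ := fun n => max ‖α‖ ‖β‖ * (L ^ n / n.factorial) with hb
  have hbs : Summable b := (Real.summable_pow_div_factorial L).mul_left _
  have hq' : IntervalIntegrable (fun s => (q s : ℂ) - lam) volume 0 T :=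
    IntervalIntegrable.sub ⟨hq.1.ofReal, hq.2.ofReal⟩ intervalIntegrable_const
  have hg : IntervalIntegrable (fun s => 1 + ‖(q s : ℂ) - lam‖) volume 0 T :=
    intervalIntegrable_const.add hq'.norm
  have hbd : ∀ n, ∀ x ∈ Icc 0 T, ‖(P n).1 x‖ ≤ b n ∧ ‖(P n).2 x‖ ≤ b n := by
    intro n x hx
    have h0 : 0 ≤ ∫ s in (0 : ℝ)..x, (1 + ‖(q s : ℂ) - lam‖) :=
      intervalIntegral.integral_nonneg hx.1 (fun s _ => by positivity)
    have h1 : ∫ s in (0 : ℝ)..x, (1 + ‖(q s : ℂ) - lam‖) ≤ L :=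
      intervalIntegral.integral_mono_interval le_rfl hx.1 hx.2
        (Eventually.of_forall fun s => by positivity) hg
    have h2 : max ‖α‖ ‖β‖ * ((∫ s in (0 : ℝ)..x, (1 + ‖(q s : ℂ) - lam‖)) ^ n / n.factorial)
        ≤ b n := by
      simp only [hb]; gcongr
    exact ⟨((slPicard_bound hq lam α β n x hx).1).trans h2,
      ((slPicard_bound hq lam α β n x hx).2).trans h2⟩
  have hsy : ∀ x ∈ Icc 0 T, Summable fun n => (P n).1 x := fun x hx =>
    Summable.of_norm_bounded hbs fun n => (hbd n x hx).1
  have hsz : ∀ x ∈ Icc 0 T, Summable fun n => (P n).2 x := fun x hx =>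
    Summable.of_norm_bounded hbs fun n => (hbd n x hx).2
  have h0m : (0 : ℝ) ∈ Icc 0 T := ⟨le_rfl, hT⟩
  have hy0 : ∑' n, (P n).1 0 = α := by
    rw [(hsy 0 h0m).tsum_eq_zero_add]; simp [hP, slPicard]
  have hz0 : ∑' n, (P n).2 0 = β := by
    rw [(hsz 0 h0m).tsum_eq_zero_add]; simp [hP, slPicard]
  refine ⟨(fun x => ∑' n, (P n).1 x, fun x => ∑' n, (P n).2 x), ⟨?_, ?_, ?_, ?_⟩, hy0, hz0⟩
  · exact continuousOn_tsum (fun n => (slPicard_continuousOn hT hq lam α β n).1) hbs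
      fun n x hx => (hbd n x hx).1
  · exact continuousOn_tsum (fun n => (slPicard_continuousOn hT hq lam α β n).2) hbs
      fun n x hx => (hbd n x hx).2
  · intro x hx
    have hsub : Icc 0 x ⊆ Icc 0 T := Icc_subset_Icc_right hx.2
    have := intervalIntegral.hasSum_integral_of_dominated_convergence (μ := volume)
      (a := 0) (b := x) (F := fun n t => (P n).2 t) (f := fun t => ∑' n, (P n).2 t)
      (fun n _ => b n)
      (fun n => ((ContinuousOn.intervalIntegrable (by
        rw [uIcc_of_le hx.1]
        exact (slPicard_continuousOn hT hq lam α β n).2.mono hsub)).aestronglyMeasurable_restrict_uIoc))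
      (fun n => Eventually.of_forall fun t ht => (hbd n t (hsub (by
        rw [uIoc_of_le hx.1] at ht; exact Ioc_subset_Icc_self ht))).2)
      (Eventually.of_forall fun t _ => hbs)
      intervalIntegrable_const
      (Eventually.of_forall fun t ht => (hsz t (hsub (by
        rw [uIoc_of_le hx.1] at ht; exact Ioc_subset_Icc_self ht))).hasSum)
    simp only
    rw [(hsy x hx).tsum_eq_zero_add, hy0, ← this.tsum_eq]
    simp [hP, slPicard]
  · intro x hx
    have hsub : Icc 0 x ⊆ Icc 0 T := Icc_subset_Icc_right hx.2
    have hqx : IntervalIntegrable (fun s => (q s : ℂ) - lam) volume 0 x := hq'.mono_set (by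
      rw [uIcc_of_le hx.1, uIcc_of_le hT]; exact hsub)
    have := intervalIntegral.hasSum_integral_of_dominated_convergence (μ := volume)
      (a := 0) (b := x) (F := fun n t => ((q t : ℂ) - lam) * (P n).1 t)
      (f := fun t => ((q t : ℂ) - lam) * ∑' n, (P n).1 t)
      (fun n t => ‖(q t : ℂ) - lam‖ * b n)
      (fun n => ((sl_intervalIntegrable hq lam
        (slPicard_continuousOn hT hq lam α β n).1 hx).aestronglyMeasurable_restrict_uIoc))
      (fun n => Eventually.of_forall fun t ht => by
        rw [norm_mul]
        exact mul_le_mul_of_nonneg_left (hbd n t (hsub (by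
          rw [uIoc_of_le hx.1] at ht; exact Ioc_subset_Icc_self ht))).1 (norm_nonneg _))
      (Eventually.of_forall fun t _ => hbs.mul_left _)
      (by simp_rw [tsum_mul_left]; exact hqx.norm.mul_const _)
      (Eventually.of_forall fun t ht => ((hsy t (hsub (by
        rw [uIoc_of_le hx.1] at ht; exact Ioc_subset_Icc_self ht))).hasSum).mul_left _)
    simp only
    rw [(hsz x hx).tsum_eq_zero_add, hz0, ← this.tsum_eq]
    simp [hP, slPicard]

/-- The solution of `-y'' + q y = lam y` on `[0, T]` with `y(0) = α`, `y'(0) = β`, as the pair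
`(y, y')`. For `q` integrable on `[0, T]` it exists (`slSol_spec`) and is unique on `[0, T]`
(`IsSLSolution.ext_of_initial`). -/
noncomputable def slSol (q : ℝ → ℝ) (T : ℝ) (lam α β : ℂ) : (ℝ → ℂ) × (ℝ → ℂ) :=
  Classical.epsilon fun p : (ℝ → ℂ) × (ℝ → ℂ) =>
    IsSLSolution q T lam p.1 p.2 ∧ p.1 0 = α ∧ p.2 0 = β

theorem slSol_spec {q : ℝ → ℝ} {T : ℝ} (hT : 0 ≤ T) (hq : IntervalIntegrable q volume 0 T)
    (lam α β : ℂ) :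
    IsSLSolution q T lam (slSol q T lam α β).1 (slSol q T lam α β).2 ∧
      (slSol q T lam α β).1 0 = α ∧ (slSol q T lam α β).2 0 = β :=
  Classical.epsilon_spec (IsSLSolution.exists_of_initial hT hq lam α β)

/-- `S(x, lam)`: the solution with `S(0) = 0`, `S'(0) = 1`. -/
noncomputable def slS (q : ℝ → ℝ) (T x : ℝ) (lam : ℂ) : ℂ := (slSol q T lam 0 1).1 x

/-- `S'(x, lam)`. -/
noncomputable def slS' (q : ℝ → ℝ) (T x : ℝ) (lam : ℂ) : ℂ := (slSol q T lam 0 1).2 x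

/-- `C(x, lam)`: the solution with `C(0) = 1`, `C'(0) = 0`. -/
noncomputable def slC (q : ℝ → ℝ) (T x : ℝ) (lam : ℂ) : ℂ := (slSol q T lam 1 0).1 x

/-- `C'(x, lam)`. -/
noncomputable def slC' (q : ℝ → ℝ) (T x : ℝ) (lam : ℂ) : ℂ := (slSol q T lam 1 0).2 x

/-! The graph has a loop, which is edge `0 : Fin (m + 1)`, and `m` boundary edges, which are
`j.succ : Fin (m + 1)` for `j : Fin m`. Edge `i` has length `T i` and carries the potential `q i`. -/

/-- Real-valued square-integrable potentials with zero mean value on every edge. -/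
def IsZeroMeanL2 {m : ℕ} (T : Fin (m + 1) → ℝ) (q : Fin (m + 1) → ℝ → ℝ) : Prop :=
  ∀ i, MemLp (q i) 2 (volume.restrict (Ioo 0 (T i))) ∧ ∫ x in (0 : ℝ)..T i, q i x = 0

/-- `lam` is an eigenvalue of the boundary value problem on the graph: there is a nontrivial
solution of the Sturm-Liouville system with Dirichlet conditions at the boundary vertices and
the matching conditions at the internal vertex. Here `z i` is the derivative of `y i`. -/
def IsGraphEigenvalue {m : ℕ} (T : Fin (m + 1) → ℝ) (a : ℝ) (q : Fin (m + 1) → ℝ → ℝ)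
    (lam : ℂ) : Prop :=
  ∃ y z : Fin (m + 1) → ℝ → ℂ,
    (∀ i, IsSLSolution (q i) (T i) lam (y i) (z i)) ∧
    (∀ j : Fin m, y j.succ 0 = 0) ∧
    y 0 0 = a * y 0 (T 0) ∧
    (∀ j : Fin m, a * y 0 (T 0) = y j.succ (T j.succ)) ∧
    z 0 0 = (a : ℂ)⁻¹ * z 0 (T 0) + ∑ j : Fin m, z j.succ (T j.succ) ∧
    ∃ i, ∃ x ∈ Icc 0 (T i), y i x ≠ 0

section Characteristic

variable {m : ℕ} (T : Fin (m + 1) → ℝ) (a : ℝ) (q : Fin (m + 1) → ℝ → ℝ)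

/-- The Hill-type discriminant `d(lam)` of the loop. -/
noncomputable def hillD (lam : ℂ) : ℂ :=
  a * slC (q 0) (T 0) (T 0) lam + (a : ℂ)⁻¹ * slS' (q 0) (T 0) (T 0) lam

/-- `h(lam) = S_0(T_0, lam)`. -/
noncomputable def loopH (lam : ℂ) : ℂ := slS (q 0) (T 0) (T 0) lam

/-- `S_j(T_j, lam)` on the boundary edge `j`. -/
noncomputable def endS (j : Fin m) (lam : ℂ) : ℂ := slS (q j.succ) (T j.succ) (T j.succ) lam

/-- `S_j'(T_j, lam)` on the boundary edge `j`. -/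
noncomputable def endS' (j : Fin m) (lam : ℂ) : ℂ := slS' (q j.succ) (T j.succ) (T j.succ) lam

/-- `C_j(T_j, lam)` on the boundary edge `j`. -/
noncomputable def endC (j : Fin m) (lam : ℂ) : ℂ := slC (q j.succ) (T j.succ) (T j.succ) lam

/-- `C_j'(T_j, lam)` on the boundary edge `j`. -/
noncomputable def endC' (j : Fin m) (lam : ℂ) : ℂ := slC' (q j.succ) (T j.succ) (T j.succ) lam

/-- The characteristic function `Δ(lam)` of the problem on the graph. -/
noncomputable def charDelta (lam : ℂ) : ℂ :=
  (hillD T a q lam - 2) * ∏ j : Fin m, endS T q j lam +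
    a * loopH T q lam *
      ∑ r : Fin m, endS' T q r lam * ∏ j ∈ Finset.univ.erase r, endS T q j lam

/-- The characteristic function `Δ_k(lam)` of the problem on the graph with the Dirichlet
condition at the `k`-th boundary vertex replaced by the Neumann one. -/
noncomputable def charDeltaK (k : Fin m) (lam : ℂ) : ℂ :=
  (hillD T a q lam - 2) *
      (endC T q k lam * ∏ j ∈ Finset.univ.erase k, endS T q j lam) +
    a * loopH T q lam *
      (endC' T q k lam * ∏ j ∈ Finset.univ.erase k, endS T q j lam +
        endC T q k lam * ∑ r ∈ Finset.univ.erase k,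
          endS' T q r lam * ∏ j ∈ (Finset.univ.erase k).erase r, endS T q j lam)

/-- The Weyl function `M_k(lam) = -Δ_k(lam) / Δ(lam)`. -/
noncomputable def weylM (k : Fin m) (lam : ℂ) : ℂ :=
  -(charDeltaK T a q k lam / charDelta T a q lam)

/-- All eigenvalues of the problem lie strictly inside the parabola
`Γ = {ρ² : Im ρ = τ}`, that is, in the component `{ρ² : |Im ρ| < τ}` of its complement. -/
def SpectrumInside (τ : ℝ) : Prop :=
  ∀ lam : ℂ, IsGraphEigenvalue T a q lam → ∃ ρ : ℂ, lam = ρ ^ 2 ∧ |ρ.im| < τ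

variable (q' : Fin (m + 1) → ℝ → ℝ) (k : Fin m)

/-- The integrand of the contour integral defining `F(x, t)`, after the substitution
`μ = θ²`, `dμ = 2 θ dθ`, `θ = σ + i τ`; the unperturbed potential is `q`, the perturbed
one is `q'`. -/
noncomputable def contourIntegrand (τ x t σ : ℝ) : ℂ :=
  let θ : ℂ := σ + τ * Complex.I
  (weylM T a q k (θ ^ 2) - weylM T a q' k (θ ^ 2)) *
    slS (q k.succ) (T k.succ) x (θ ^ 2) * slS (q k.succ) (T k.succ) t (θ ^ 2) * (2 * θ)

/-- `F(x, t) = -(1 / 2πi) ∫_Γ (M - M̃)(μ) S(x, μ) S(t, μ) dμ`, where `Γ` is the parabola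
`μ = (σ + i τ)²` traversed in the direction of increasing `σ`. -/
noncomputable def contourF (τ x t : ℝ) : ℂ :=
  -(1 / (2 * Real.pi * Complex.I)) * ∫ σ : ℝ, contourIntegrand T a q q' k τ x t σ

end Characteristic

/-- `K` is the kernel of the transformation operator taking `S(x, lam)` (potential `q`) to
`S̃(x, lam)` (potential `q'`): it is continuous on `0 ≤ t ≤ x ≤ T`, and
`S̃(x, lam) = S(x, lam) + ∫_0^x K(x, t) S(t, lam) dt`. -/
def IsTransformationKernel (T : ℝ) (q q' : ℝ → ℝ) (K : ℝ → ℝ → ℂ) : Prop :=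
  ContinuousOn (fun p : ℝ × ℝ => K p.1 p.2) {p : ℝ × ℝ | 0 ≤ p.2 ∧ p.2 ≤ p.1 ∧ p.1 ≤ T} ∧
  ∀ x ∈ Icc 0 T, ∀ lam : ℂ,
    slS q' T x lam = slS q T x lam + ∫ t in (0 : ℝ)..x, K x t * slS q T t lam

/-! On the edge `k` let Φ = C + M S be the Weyl solution for q and Φ̃ = C̃ + M̃ S̃ the one for q̃;
write μ = θ². The transformation kernel can be written down: H(x,t) = (1/2πi) ∫_Γ M̂(μ) S̃(x,μ)
S(t,μ) dμ (`contourKernel`) is a transformation kernel, and there is no other. Once K = H is known,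
replacing S̃ under the contour integral by S + ∫ K S and exchanging the integrals gives K = -F - ∫ K
F, which is the equation (`IsTransformationKernel.gelfandLevitan`).

Why H works (`slS_eq_add_integral_of_norm_lt`): integrate H(x,t) S(t,λ) over [0,x]. Lagrange's
identity turns ∫ S(t,λ) S(t,μ) dt into a Wronskian over λ - μ. Substituting M S = Φ - C and M̃ S̃ =
Φ̃ - C̃, and likewise for derivatives, leaves mixed Wronskians of Φ with S̃ and of Φ̃ with S, minus
expressions entire in μ. The mixed Wronskians are 0 or -1 up to O(1/θ) on Im θ ≥ τ, so their
variable part disappears when the line is pushed to infinity. The entire expressions give an odd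
entire function of θ, whose symmetric integrals tend to zero, and a multiple of 2θ/(λ - θ²), which
produces exactly S̃(x,λ) - S(x,λ). This holds for small λ, and then for all λ by analyticity.
Uniqueness is the completeness of the functions S(·,λ) on [0,x]
(`eq_zero_of_integral_mul_slS_eq_zero`): Green's operator applied to an orthogonal function is
entire in λ and tends to zero, so Liouville's theorem kills it.

The analytic input comes from the graph. Φ is the restriction to edge `k` of a solution on the whole
graph. The energy identity on the rest of the graph shows that at the vertex the amplitude of
exp(iθx) in Φ dominates that of exp(-iθx), so Φ decays like exp(-x Im θ)
(`exists_isWeylGraphSolution`); no asymptotics of Δ are needed. Lagrange's identity gives M̂ = Σ ∫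
(q̃_i - q_i) y_i ỹ_i. The non-oscillating part of y_i ỹ_i is removed by the zero mean, and
Plancherel's theorem handles the oscillating part, so M̂/θ is integrable along the line
(`integrable_weylM_sub_div`); this makes the contour integrals converge absolutely. The same energy
identity bounds the real spectrum from below. -/

/-! ### Calculus of absolutely continuous functions. -/

/-- `F` is a primitive of the integrable function `f` on `[0, T]`. -/
structure IsPrimitiveOn (T : ℝ) (F f : ℝ → ℂ) : Prop where
  integrable : IntervalIntegrable f volume 0 T
  eq : ∀ x ∈ Icc 0 T, F x = F 0 + ∫ t in (0 : ℝ)..x, f t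

/-- Increments of the primitive of `f` are dominated by increments of the primitive of `‖f‖`, which
is real-valued and absolutely continuous. -/
theorem IntervalIntegrable.absolutelyContinuousOnInterval_integral_complex {f : ℝ → ℂ} {a b c : ℝ}
    (h : IntervalIntegrable f volume a b) (hc : c ∈ uIcc a b) :
    AbsolutelyContinuousOnInterval (fun x => ∫ t in c..x, f t) a b := by
  have hn := h.norm.absolutelyContinuousOnInterval_intervalIntegral hc
  unfold AbsolutelyContinuousOnInterval at hn ⊢
  refine squeeze_zero' (Eventually.of_forall fun _ => Finset.sum_nonneg fun _ _ => dist_nonneg)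
    ?_ hn
  rw [eventually_inf_principal]
  filter_upwards with E hE
  refine Finset.sum_le_sum fun i hi => ?_
  have hm := hE.1 i hi
  have hi1 : IntervalIntegrable f volume c (E.2 i).1 :=
    h.mono_set (by rw [uIcc_subset_uIcc_iff_mem]; exact ⟨hc, hm.1⟩)
  have hi2 : IntervalIntegrable f volume c (E.2 i).2 :=
    h.mono_set (by rw [uIcc_subset_uIcc_iff_mem]; exact ⟨hc, hm.2⟩)
  rw [dist_eq_norm, dist_eq_norm, intervalIntegral.integral_interval_sub_left hi1 hi2,
    intervalIntegral.integral_interval_sub_left hi1.norm hi2.norm, Real.norm_eq_abs]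
  exact intervalIntegral.norm_integral_le_abs_integral_norm

namespace IsPrimitiveOn

variable {T : ℝ} {F f G g : ℝ → ℂ}

theorem integrable_left (h : IsPrimitiveOn T F f) {x : ℝ} (hx : x ∈ Icc 0 T) :
    IntervalIntegrable f volume 0 x :=
  h.integrable.mono_set (by
    rw [uIcc_of_le hx.1, uIcc_of_le (hx.1.trans hx.2)]; exact Icc_subset_Icc_right hx.2)

theorem continuousOn (h : IsPrimitiveOn T F f) : ContinuousOn F (Icc 0 T) := by
  rcases lt_or_ge T 0 with hT | hT
  · simp [Icc_eq_empty_of_lt hT]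
  have c := intervalIntegral.continuousOn_primitive_interval' h.integrable left_mem_uIcc
  rw [uIcc_of_le hT] at c
  exact (continuousOn_const.add c).congr h.eq

theorem congr_left (h : IsPrimitiveOn T F f) (hFG : ∀ x ∈ Icc 0 T, F x = G x) :
    IsPrimitiveOn T G f := by
  refine ⟨h.integrable, fun x hx => ?_⟩
  rw [← hFG x hx, ← hFG 0 ⟨le_rfl, hx.1.trans hx.2⟩, h.eq x hx]

theorem congr_right (hT : 0 ≤ T) (h : IsPrimitiveOn T F f) (hfg : ∀ x ∈ Icc 0 T, f x = g x) :
    IsPrimitiveOn T F g := by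
  refine ⟨h.integrable.congr (fun x hx => ?_), fun x hx => ?_⟩
  · rw [uIoc_of_le hT] at hx
    exact hfg x (Ioc_subset_Icc_self hx)
  · rw [h.eq x hx]
    congr 1
    refine intervalIntegral.integral_congr fun t ht => hfg t ?_
    rw [uIcc_of_le hx.1] at ht
    exact ⟨ht.1, ht.2.trans hx.2⟩

theorem absolutelyContinuous (h : IsPrimitiveOn T F f) :
    AbsolutelyContinuousOnInterval (fun x => F 0 + ∫ t in (0 : ℝ)..x, f t) 0 T := by
  have h1 := h.integrable.absolutelyContinuousOnInterval_integral_complex left_mem_uIcc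
  have h2 : AbsolutelyContinuousOnInterval (fun _ : ℝ => F 0) 0 T := by
    simpa [AbsolutelyContinuousOnInterval] using tendsto_const_nhds
  exact h2.add h1

/-- The derivative of a solution's derivative exists only almost everywhere, so the product rule is
proved through absolute continuity: the product minus the primitive of the expected derivative has
zero derivative almost everywhere and is therefore constant. Every Wronskian and energy identity
rests on this. -/
theorem mul (hT : 0 ≤ T) (hF : IsPrimitiveOn T F f) (hG : IsPrimitiveOn T G g) :
    IsPrimitiveOn T (fun x => F x * G x) (fun x => f x * G x + F x * g x) := by
  have hFc := hF.continuousOn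
  have hGc := hG.continuousOn
  rw [← uIcc_of_le hT] at hFc hGc
  have hint : IntervalIntegrable (fun x => f x * G x + F x * g x) volume 0 T :=
    (hF.integrable.mul_continuousOn hGc).add (hG.integrable.continuousOn_mul hFc)
  refine ⟨hint, ?_⟩
  set F₁ : ℝ → ℂ := fun x => F 0 + ∫ t in (0 : ℝ)..x, f t with hF₁
  set G₁ : ℝ → ℂ := fun x => G 0 + ∫ t in (0 : ℝ)..x, g t with hG₁
  have ac : AbsolutelyContinuousOnInterval
      (fun x => F₁ x * G₁ x - ∫ t in (0 : ℝ)..x, (f t * G t + F t * g t)) 0 T :=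
    (hF.absolutelyContinuous.smul hG.absolutelyContinuous).sub
      (hint.absolutelyContinuousOnInterval_integral_complex left_mem_uIcc)
  obtain ⟨c, hc⟩ := ac.const_of_ae_hasDerivAt_zero (by
    filter_upwards [hF.integrable.ae_hasDerivAt_integral, hG.integrable.ae_hasDerivAt_integral,
      hint.ae_hasDerivAt_integral] with x h1 h2 h3 hx
    have d1 := ((h1 hx 0 left_mem_uIcc).const_add (F 0)).mul
      ((h2 hx 0 left_mem_uIcc).const_add (G 0))
    have d := d1.sub (h3 hx 0 left_mem_uIcc)
    rw [uIcc_of_le hT] at hx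
    rw [← hF.eq x hx, ← hG.eq x hx] at d
    simpa using! d)
  intro x hx
  have e0 := hc 0 left_mem_uIcc
  have e1 := hc x (by rwa [uIcc_of_le hT])
  simp only [hF₁, hG₁, ← hF.eq x hx, ← hG.eq x hx] at e1
  simp only [hF₁, hG₁, intervalIntegral.integral_same, add_zero, sub_zero] at e0
  rw [e0, ← e1]
  ring

theorem add (hF : IsPrimitiveOn T F f) (hG : IsPrimitiveOn T G g) :
    IsPrimitiveOn T (fun x => F x + G x) (fun x => f x + g x) := by
  refine ⟨hF.integrable.add hG.integrable, fun x hx => ?_⟩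
  rw [intervalIntegral.integral_add (hF.integrable_left hx) (hG.integrable_left hx),
    hF.eq x hx, hG.eq x hx]
  ring

theorem const_mul (c : ℂ) (hF : IsPrimitiveOn T F f) :
    IsPrimitiveOn T (fun x => c * F x) (fun x => c * f x) := by
  refine ⟨hF.integrable.const_mul c, fun x hx => ?_⟩
  rw [intervalIntegral.integral_const_mul, hF.eq x hx]
  ring

theorem sub (hF : IsPrimitiveOn T F f) (hG : IsPrimitiveOn T G g) :
    IsPrimitiveOn T (fun x => F x - G x) (fun x => f x - g x) := by
  refine ⟨hF.integrable.sub hG.integrable, fun x hx => ?_⟩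
  rw [intervalIntegral.integral_sub (hF.integrable_left hx) (hG.integrable_left hx),
    hF.eq x hx, hG.eq x hx]
  ring

theorem conj (hF : IsPrimitiveOn T F f) :
    IsPrimitiveOn T (fun x => starRingEnd ℂ (F x)) (fun x => starRingEnd ℂ (f x)) := by
  have hi : IntervalIntegrable (fun x => starRingEnd ℂ (f x)) volume 0 T :=
    ⟨(Complex.conjLIE.integrable_comp_iff (φ := f)).2 hF.integrable.1,
      (Complex.conjLIE.integrable_comp_iff (φ := f)).2 hF.integrable.2⟩
  refine ⟨hi, fun x hx => ?_⟩
  rw [hF.eq x hx, map_add]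
  congr 1
  rw [intervalIntegral.integral_of_le hx.1, intervalIntegral.integral_of_le hx.1, integral_conj]

theorem of_hasDerivAt (h : ∀ x, HasDerivAt F (f x) x) (hf : Continuous f) :
    IsPrimitiveOn T F f := by
  refine ⟨hf.intervalIntegrable _ _, fun x hx => ?_⟩
  rw [intervalIntegral.integral_eq_sub_of_hasDerivAt (fun y _ => h y) (hf.intervalIntegrable _ _)]
  ring

theorem reflect (hT : 0 ≤ T) (hF : IsPrimitiveOn T F f) :
    IsPrimitiveOn T (fun x => F (T - x)) (fun x => -f (T - x)) := by
  have hi : IntervalIntegrable (fun x => f (T - x)) volume 0 T := by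
    have := hF.integrable.comp_sub_left T
    simpa using this.symm
  refine ⟨hi.neg, fun x hx => ?_⟩
  have hx' : T - x ∈ Icc 0 T := ⟨by linarith [hx.2], by linarith [hx.1]⟩
  rw [intervalIntegral.integral_neg, intervalIntegral.integral_comp_sub_left f T, sub_zero,
    hF.eq _ hx', hF.eq T ⟨hT, le_rfl⟩,
    ← intervalIntegral.integral_add_adjacent_intervals (hF.integrable_left hx')
      (b := T - x) (c := T)]
  · ring
  · exact hF.integrable.mono_set (by
      rw [uIcc_of_le hx'.2, uIcc_of_le hT]; exact Icc_subset_Icc_left hx'.1)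

end IsPrimitiveOn

/-! ### Identities and high-frequency bounds for solutions on one interval. -/

namespace IsSLSolution

variable {q q' : ℝ → ℝ} {T : ℝ} {lam lam' : ℂ} {y z y' z' : ℝ → ℂ}

theorem primitive_y (hT : 0 ≤ T) (h : IsSLSolution q T lam y z) : IsPrimitiveOn T y z :=
  ⟨ContinuousOn.intervalIntegrable (by rw [uIcc_of_le hT]; exact h.continuousOn_z), h.y_eq⟩

theorem primitive_z (hT : 0 ≤ T) (hq : IntervalIntegrable q volume 0 T)
    (h : IsSLSolution q T lam y z) :
    IsPrimitiveOn T z (fun t => ((q t : ℂ) - lam) * y t) :=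
  ⟨sl_intervalIntegrable hq lam h.continuousOn_y ⟨hT, le_rfl⟩, h.z_eq⟩

theorem of_primitive (hy : IsPrimitiveOn T y z)
    (hz : IsPrimitiveOn T z (fun t => ((q t : ℂ) - lam) * y t)) : IsSLSolution q T lam y z :=
  ⟨hy.continuousOn, hz.continuousOn, hy.eq, hz.eq⟩

theorem add (hT : 0 ≤ T) (hq : IntervalIntegrable q volume 0 T) (h : IsSLSolution q T lam y z)
    (h' : IsSLSolution q T lam y' z') :
    IsSLSolution q T lam (fun x => y x + y' x) (fun x => z x + z' x) :=
  of_primitive ((h.primitive_y hT).add (h'.primitive_y hT))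
    (((h.primitive_z hT hq).add (h'.primitive_z hT hq)).congr_right hT fun x _ => by ring)

theorem const_mul (hT : 0 ≤ T) (hq : IntervalIntegrable q volume 0 T)
    (h : IsSLSolution q T lam y z) (c : ℂ) :
    IsSLSolution q T lam (fun x => c * y x) (fun x => c * z x) :=
  of_primitive ((h.primitive_y hT).const_mul c)
    (((h.primitive_z hT hq).const_mul c).congr_right hT fun x _ => by ring)

theorem mono {T' : ℝ} (h : IsSLSolution q T lam y z) (hT' : T' ∈ Icc 0 T) :
    IsSLSolution q T' lam y z :=
  ⟨h.continuousOn_y.mono (Icc_subset_Icc_right hT'.2),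
    h.continuousOn_z.mono (Icc_subset_Icc_right hT'.2),
    fun x hx => h.y_eq x ⟨hx.1, hx.2.trans hT'.2⟩, fun x hx => h.z_eq x ⟨hx.1, hx.2.trans hT'.2⟩⟩

/-- Reflection of the interval. -/
theorem reflect (hT : 0 ≤ T) (hq : IntervalIntegrable q volume 0 T)
    (h : IsSLSolution q T lam y z) :
    IsSLSolution (fun x => q (T - x)) T lam (fun x => y (T - x)) (fun x => -z (T - x)) := by
  refine of_primitive ((h.primitive_y hT).reflect hT) ?_
  have := ((h.primitive_z hT hq).reflect hT).const_mul (-1)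
  exact (this.congr_left fun x _ => by ring).congr_right hT fun x _ => by ring

/-- Lagrange's identity. -/
theorem lagrange (hT : 0 ≤ T) (hq : IntervalIntegrable q volume 0 T)
    (hq' : IntervalIntegrable q' volume 0 T)
    (h : IsSLSolution q T lam y z) (h' : IsSLSolution q' T lam' y' z') :
    IsPrimitiveOn T (fun x => y x * z' x - z x * y' x)
      (fun t => (((q' t : ℂ) - lam') - ((q t : ℂ) - lam)) * (y t * y' t)) :=
  (((h.primitive_y hT).mul hT (h'.primitive_z hT hq')).sub
    ((h.primitive_z hT hq).mul hT (h'.primitive_y hT))).congr_right hT fun x _ => by ring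

/-- The Wronskian of two solutions of the same equation is constant. -/
theorem wronskian (hT : 0 ≤ T) (hq : IntervalIntegrable q volume 0 T)
    (h : IsSLSolution q T lam y z) (h' : IsSLSolution q T lam y' z') {x : ℝ} (hx : x ∈ Icc 0 T) :
    y x * z' x - z x * y' x = y 0 * z' 0 - z 0 * y' 0 := by
  have := (h.lagrange hT hq hq h').eq x hx
  simpa using this

/-- Since `q` is real, the only non-real coefficient on the right is `lam`; this yields both the
reality of the spectrum and the sign condition at the vertex. -/
theorem energy (hT : 0 ≤ T) (hq : IntervalIntegrable q volume 0 T)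
    (h : IsSLSolution q T lam y z) :
    IsPrimitiveOn T (fun x => z x * starRingEnd ℂ (y x))
      (fun t => ((‖z t‖ ^ 2 + q t * ‖y t‖ ^ 2 : ℝ) : ℂ) - lam * ((‖y t‖ ^ 2 : ℝ) : ℂ)) :=
  ((h.primitive_z hT hq).mul hT (h.primitive_y hT).conj).congr_right hT fun x _ => by
    have e1 := Complex.mul_conj' (y x)
    have e2 := Complex.mul_conj' (z x)
    push_cast
    rw [← e1, ← e2]
    ring

variable {ρ : ℂ}

theorem primitive_exp (c : ℂ) {T : ℝ} :
    IsPrimitiveOn T (fun x => Complex.exp (c * x)) (fun x => c * Complex.exp (c * x)) := by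
  refine IsPrimitiveOn.of_hasDerivAt (fun x => ?_) (by fun_prop)
  have h1 : HasDerivAt (fun x : ℝ => c * (x : ℂ)) c x := by
    simpa using (Complex.ofRealCLM.hasDerivAt (x := x)).const_mul c
  simpa [mul_comm] using h1.cexp

/-- With `lam = -c ^ 2` the free operator factors into first order ones: `u = z + c * y` satisfies
u' = c u + q y, so multiplying by exp(-cx) leaves only the potential term. -/
theorem amplitude (hT : 0 ≤ T) (hq : IntervalIntegrable q volume 0 T) {c : ℂ}
    (h : IsSLSolution q T (-c ^ 2) y z) :
    IsPrimitiveOn T (fun x => Complex.exp (-c * x) * (z x + c * y x))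
      (fun x => Complex.exp (-c * x) * (q x * y x)) :=
  ((primitive_exp (-c)).mul hT ((h.primitive_z hT hq).add ((h.primitive_y hT).const_mul c))).congr_right
    hT fun x _ => by ring

theorem norm_exp_le {c : ℂ} {ω s : ℝ} (hc : |c.re| ≤ ω) (hs : 0 ≤ s) :
    ‖Complex.exp (c * s)‖ ≤ Real.exp (ω * s) := by
  rw [Complex.norm_exp]
  apply Real.exp_le_exp.2
  have : (c * s).re = c.re * s := by simp
  rw [this]
  exact mul_le_mul_of_nonneg_right ((le_abs_self _).trans hc) hs

/-- The transported amplitude stays close to its initial value. -/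
theorem amplitude_bound (hT : 0 ≤ T) (hq : IntervalIntegrable q volume 0 T) {c : ℂ} {ω U : ℝ}
    (hc : |c.re| ≤ ω) (h : IsSLSolution q T (-c ^ 2) y z)
    (hU : ∀ x ∈ Icc 0 T, ‖y x‖ ≤ U * Real.exp (ω * x)) {x : ℝ} (hx : x ∈ Icc 0 T) :
    ‖(z x + c * y x) - Complex.exp (c * x) * (z 0 + c * y 0)‖
      ≤ (∫ t in (0 : ℝ)..T, |q t|) * U * Real.exp (ω * x) := by
  have hp := h.amplitude hT hq
  have e := hp.eq x hx
  simp only [Complex.ofReal_zero, mul_zero, Complex.exp_zero, one_mul] at e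
  have e2 : (z x + c * y x) - Complex.exp (c * x) * (z 0 + c * y 0)
      = ∫ t in (0 : ℝ)..x, Complex.exp (c * (x - t : ℝ)) * (q t * y t) := by
    have : Complex.exp (c * x) * Complex.exp (-c * x) = 1 := by
      rw [← Complex.exp_add]; simp
    calc _ = Complex.exp (c * x) * (Complex.exp (-c * x) * (z x + c * y x) - (z 0 + c * y 0)) := by
          linear_combination (-(z x + c * y x)) * this
      _ = Complex.exp (c * x) * ∫ t in (0 : ℝ)..x, Complex.exp (-c * t) * (q t * y t) := by
          rw [e]; ring
      _ = _ := by
          rw [← intervalIntegral.integral_const_mul]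
          congr 1
          ext t
          rw [← mul_assoc, ← Complex.exp_add]
          congr 2
          push_cast; ring
  have hqx : IntervalIntegrable (fun t => |q t|) volume 0 T := hq.norm
  have hqx' : IntervalIntegrable (fun t => |q t|) volume 0 x := hqx.mono_set (by
    rw [uIcc_of_le hx.1, uIcc_of_le hT]; exact Icc_subset_Icc_right hx.2)
  have hU0 : 0 ≤ U := by
    have := (norm_nonneg _).trans (hU 0 ⟨le_rfl, hT⟩)
    simpa using this
  rw [e2]
  calc _ ≤ ∫ t in (0 : ℝ)..x, |q t| * (U * Real.exp (ω * x)) := by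
        refine intervalIntegral.norm_integral_le_of_norm_le hx.1 ?_ (hqx'.mul_const _)
        refine Eventually.of_forall fun t ht => ?_
        have htm : t ∈ Icc 0 T := ⟨ht.1.le, ht.2.trans hx.2⟩
        rw [norm_mul, norm_mul, Complex.norm_real, Real.norm_eq_abs]
        calc _ ≤ Real.exp (ω * (x - t)) * (|q t| * (U * Real.exp (ω * t))) := by
              gcongr
              · exact norm_exp_le hc (by linarith [ht.2])
              · exact hU t htm
          _ = |q t| * (U * (Real.exp (ω * (x - t)) * Real.exp (ω * t))) := by ring
          _ = _ := by rw [← Real.exp_add]; congr 3; ring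
    _ = (∫ t in (0 : ℝ)..x, |q t|) * (U * Real.exp (ω * x)) := by
        rw [intervalIntegral.integral_mul_const]
    _ ≤ (∫ t in (0 : ℝ)..T, |q t|) * (U * Real.exp (ω * x)) := by
        gcongr
        exact intervalIntegral.integral_mono_interval le_rfl hx.1 hx.2
          (Eventually.of_forall fun s => abs_nonneg _) hqx
    _ = _ := by ring

/-- Comparison with the free solution, given an a priori bound. -/
theorem free_approx_of_bound (hT : 0 ≤ T) (hq : IntervalIntegrable q volume 0 T) {U : ℝ}
    (hρ : ρ ≠ 0) (h : IsSLSolution q T (ρ ^ 2) y z)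
    (hU : ∀ x ∈ Icc 0 T, ‖y x‖ ≤ U * Real.exp (|ρ.im| * x)) {x : ℝ} (hx : x ∈ Icc 0 T) :
    ‖y x - (y 0 * Complex.cos (ρ * x) + z 0 * (Complex.sin (ρ * x) / ρ))‖
      ≤ (∫ t in (0 : ℝ)..T, |q t|) * U / ‖ρ‖ * Real.exp (|ρ.im| * x) ∧
    ‖z x - (z 0 * Complex.cos (ρ * x) - ρ * y 0 * Complex.sin (ρ * x))‖
      ≤ (∫ t in (0 : ℝ)..T, |q t|) * U * Real.exp (|ρ.im| * x) := by
  -- Both `c` and `-c` square to `-ρ ^ 2`. The half-difference of the two amplitudes recovers `y`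
  -- (with a gain of `1 / ‖ρ‖`), the half-sum recovers `z`.
  set c : ℂ := Complex.I * ρ with hc
  have hc2 : -c ^ 2 = ρ ^ 2 := by rw [hc, mul_pow, Complex.I_sq]; ring
  have hc2' : -(-c) ^ 2 = ρ ^ 2 := by rw [← hc2]; ring
  have hre : |c.re| ≤ |ρ.im| := by simp [hc]
  have hre' : |(-c).re| ≤ |ρ.im| := by simp [hc]
  have b1 := amplitude_bound hT hq hre (by rwa [hc2]) hU hx
  have b2 := amplitude_bound hT hq hre' (by rwa [hc2']) hU hx
  set E := (∫ t in (0 : ℝ)..T, |q t|) * U * Real.exp (|ρ.im| * x)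
  have hcos : Complex.cos (ρ * x) = (Complex.exp (c * x) + Complex.exp (-c * x)) / 2 := by
    rw [Complex.cos, hc]; congr 2 <;> congr 1 <;> ring
  have hsin : Complex.I * Complex.sin (ρ * x)
      = (Complex.exp (c * x) - Complex.exp (-c * x)) / 2 := by
    rw [Complex.sin, hc, show ρ * x * Complex.I = Complex.I * ρ * x by ring,
      show -(ρ * x) * Complex.I = -(Complex.I * ρ) * x by ring]
    linear_combination (Complex.exp (-(Complex.I * ρ) * x) - Complex.exp (Complex.I * ρ * x)) / 2 *
      Complex.I_sq
  set e1 := Complex.exp (c * x)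
  set e2 := Complex.exp (-c * x)
  have hsin' : Complex.sin (ρ * x) = -Complex.I * ((e1 - e2) / 2) := by
    rw [← hsin]; linear_combination (Complex.sin (ρ * x)) * Complex.I_sq
  have hcn : ‖c‖ = ‖ρ‖ := by simp [hc]
  have hρn : 0 < ‖ρ‖ := norm_pos_iff.2 hρ
  have hc0 : c ≠ 0 := by rw [← norm_pos_iff, hcn]; exact hρn
  have key1 : y x - (y 0 * Complex.cos (ρ * x) + z 0 * (Complex.sin (ρ * x) / ρ))
      = (((z x + c * y x) - e1 * (z 0 + c * y 0)) - ((z x + -c * y x) - e2 * (z 0 + -c * y 0)))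
        / (2 * c) := by
    rw [hcos, hsin', eq_div_iff (by simpa using hc0), hc]
    field_simp
    linear_combination ((e1 - e2) * z 0) * Complex.I_sq
  have key2 : z x - (z 0 * Complex.cos (ρ * x) - ρ * y 0 * Complex.sin (ρ * x))
      = (((z x + c * y x) - e1 * (z 0 + c * y 0)) + ((z x + -c * y x) - e2 * (z 0 + -c * y 0)))
        / 2 := by
    rw [hcos, hsin', hc]
    ring
  constructor
  · rw [key1, norm_div, norm_mul, hcn]
    have := (norm_sub_le _ _).trans (add_le_add b1 b2)
    rw [div_le_iff₀ (by simpa using hρ)]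
    refine this.trans (le_of_eq ?_)
    simp only [RCLike.norm_ofNat]
    simp only [E]
    field_simp
    ring
  · rw [key2, norm_div]
    have := (norm_add_le _ _).trans (add_le_add b1 b2)
    rw [div_le_iff₀ (by simp)]
    refine this.trans (le_of_eq ?_)
    simp only [RCLike.norm_ofNat]
    ring

theorem norm_cos_le (ρ : ℂ) {x : ℝ} (hx : 0 ≤ x) :
    ‖Complex.cos (ρ * x)‖ ≤ Real.exp (|ρ.im| * x) := by
  have h1 := norm_exp_le (c := Complex.I * ρ) (ω := |ρ.im|) (by simp) hx
  have h2 := norm_exp_le (c := -(Complex.I * ρ)) (ω := |ρ.im|) (by simp) hx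
  rw [Complex.cos, norm_div, show ρ * x * Complex.I = Complex.I * ρ * x by ring,
      show -(ρ * x) * Complex.I = -(Complex.I * ρ) * x by ring, div_le_iff₀ (by simp)]
  refine (norm_add_le _ _).trans ((add_le_add h1 h2).trans (le_of_eq ?_))
  simp only [RCLike.norm_ofNat]
  ring

theorem norm_sin_le (ρ : ℂ) {x : ℝ} (hx : 0 ≤ x) :
    ‖Complex.sin (ρ * x)‖ ≤ Real.exp (|ρ.im| * x) := by
  have h1 := norm_exp_le (c := Complex.I * ρ) (ω := |ρ.im|) (by simp) hx
  have h2 := norm_exp_le (c := -(Complex.I * ρ)) (ω := |ρ.im|) (by simp) hx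
  rw [Complex.sin, norm_div, show ρ * x * Complex.I = Complex.I * ρ * x by ring,
      show -(ρ * x) * Complex.I = -(Complex.I * ρ) * x by ring, div_le_iff₀ (by simp), norm_mul,
      Complex.norm_I, mul_one]
  refine (norm_sub_le _ _).trans ((add_le_add h2 h1).trans (le_of_eq ?_))
  simp only [RCLike.norm_ofNat]
  ring

/-- A priori bounds for solutions at large frequency. -/
theorem bound (hT : 0 ≤ T) (hq : IntervalIntegrable q volume 0 T) (hρ : ρ ≠ 0)
    (hρq : 2 * (∫ t in (0 : ℝ)..T, |q t|) ≤ ‖ρ‖) (h : IsSLSolution q T (ρ ^ 2) y z) {x : ℝ}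
    (hx : x ∈ Icc 0 T) :
    ‖y x‖ ≤ 2 * ((‖z 0‖ + ‖ρ‖ * ‖y 0‖) / ‖ρ‖) * Real.exp (|ρ.im| * x) := by
  have hρn : 0 < ‖ρ‖ := norm_pos_iff.2 hρ
  set Q := ∫ t in (0 : ℝ)..T, |q t|
  -- The maximum `U` of the weighted norm is an admissible a priori bound. Comparison with the free
  -- solution at the maximum point gives `U ≤ D / ‖ρ‖ + Q * U / ‖ρ‖`, and `2 * Q ≤ ‖ρ‖` lets the
  -- last term be absorbed.
  have hcont : ContinuousOn (fun x => ‖y x‖ * Real.exp (-(|ρ.im| * x))) (Icc 0 T) :=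
    h.continuousOn_y.norm.mul (by fun_prop)
  obtain ⟨x₀, hx₀, hmax⟩ := isCompact_Icc.exists_isMaxOn ⟨x, hx⟩ hcont
  set U := ‖y x₀‖ * Real.exp (-(|ρ.im| * x₀)) with hU
  have hUx : ∀ x ∈ Icc 0 T, ‖y x‖ ≤ U * Real.exp (|ρ.im| * x) := by
    intro x hx
    have : ‖y x‖ * Real.exp (-(|ρ.im| * x)) ≤ U := hmax hx
    calc ‖y x‖ = (‖y x‖ * Real.exp (-(|ρ.im| * x))) * Real.exp (|ρ.im| * x) := by
          rw [mul_assoc, ← Real.exp_add]; simp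
      _ ≤ _ := by gcongr
  have hU0 : 0 ≤ U := by positivity
  have b := (h.free_approx_of_bound hT hq hρ hUx hx₀).1
  set D := ‖z 0‖ + ‖ρ‖ * ‖y 0‖
  have b1 : ‖y 0 * Complex.cos (ρ * x₀) + z 0 * (Complex.sin (ρ * x₀) / ρ)‖
      ≤ D / ‖ρ‖ * Real.exp (|ρ.im| * x₀) := by
    refine (norm_add_le _ _).trans ?_
    rw [norm_mul, norm_mul, norm_div]
    have := norm_cos_le ρ hx₀.1
    have := norm_sin_le ρ hx₀.1
    calc _ ≤ ‖y 0‖ * Real.exp (|ρ.im| * x₀) + ‖z 0‖ * (Real.exp (|ρ.im| * x₀) / ‖ρ‖) := by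
          gcongr
      _ = _ := by simp only [D]; field_simp; ring
  have b2 : ‖y x₀‖ ≤ (D / ‖ρ‖ + Q * U / ‖ρ‖) * Real.exp (|ρ.im| * x₀) := by
    have := norm_le_norm_add_norm_sub' (y x₀)
      (y 0 * Complex.cos (ρ * x₀) + z 0 * (Complex.sin (ρ * x₀) / ρ))
    linarith
  have b3 : U ≤ D / ‖ρ‖ + Q * U / ‖ρ‖ := by
    rw [hU, Real.exp_neg, ← div_eq_mul_inv, div_le_iff₀ (Real.exp_pos _)]
    rw [hU, Real.exp_neg, ← div_eq_mul_inv] at b2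
    exact b2
  have b4 : Q * U / ‖ρ‖ ≤ U / 2 := by
    rw [div_le_iff₀ hρn]
    nlinarith
  refine (hUx x hx).trans ?_
  gcongr
  linarith

theorem free_approx (hT : 0 ≤ T) (hq : IntervalIntegrable q volume 0 T) (hρ : ρ ≠ 0)
    (hρq : 2 * (∫ t in (0 : ℝ)..T, |q t|) ≤ ‖ρ‖) (h : IsSLSolution q T (ρ ^ 2) y z) {x : ℝ}
    (hx : x ∈ Icc 0 T) :
    ‖y x - (y 0 * Complex.cos (ρ * x) + z 0 * (Complex.sin (ρ * x) / ρ))‖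
      ≤ 2 * (∫ t in (0 : ℝ)..T, |q t|) * ((‖z 0‖ + ‖ρ‖ * ‖y 0‖) / ‖ρ‖) / ‖ρ‖ *
        Real.exp (|ρ.im| * x) ∧
    ‖z x - (z 0 * Complex.cos (ρ * x) - ρ * y 0 * Complex.sin (ρ * x))‖
      ≤ 2 * (∫ t in (0 : ℝ)..T, |q t|) * ((‖z 0‖ + ‖ρ‖ * ‖y 0‖) / ‖ρ‖) *
        Real.exp (|ρ.im| * x) := by
  obtain ⟨h1, h2⟩ := h.free_approx_of_bound hT hq hρ (fun t ht => h.bound hT hq hρ hρq ht) hx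
  exact ⟨h1.trans (le_of_eq (by ring)), h2.trans (le_of_eq (by ring))⟩

theorem bound_deriv (hT : 0 ≤ T) (hq : IntervalIntegrable q volume 0 T) (hρ : ρ ≠ 0)
    (hρq : 2 * (∫ t in (0 : ℝ)..T, |q t|) ≤ ‖ρ‖) (h : IsSLSolution q T (ρ ^ 2) y z) {x : ℝ}
    (hx : x ∈ Icc 0 T) :
    ‖z x‖ ≤ 2 * (‖z 0‖ + ‖ρ‖ * ‖y 0‖) * Real.exp (|ρ.im| * x) := by
  have hρn : 0 < ‖ρ‖ := norm_pos_iff.2 hρ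
  have b := (h.free_approx hT hq hρ hρq hx).2
  set Q := ∫ t in (0 : ℝ)..T, |q t|
  have b1 : ‖z 0 * Complex.cos (ρ * x) - ρ * y 0 * Complex.sin (ρ * x)‖
      ≤ (‖z 0‖ + ‖ρ‖ * ‖y 0‖) * Real.exp (|ρ.im| * x) := by
    refine (norm_sub_le _ _).trans ?_
    rw [norm_mul, norm_mul, norm_mul, add_mul]
    have := norm_cos_le ρ hx.1
    have := norm_sin_le ρ hx.1
    gcongr
  set D := ‖z 0‖ + ‖ρ‖ * ‖y 0‖ with hD
  have hD0 : 0 ≤ D := by positivity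
  have b2 : 2 * Q * (D / ‖ρ‖) ≤ D := by
    rw [mul_div_assoc', div_le_iff₀ hρn]; nlinarith
  have b3 : 2 * Q * (D / ‖ρ‖) * Real.exp (|ρ.im| * x) ≤ D * Real.exp (|ρ.im| * x) := by gcongr
  have := norm_le_norm_add_norm_sub' (z x)
      (z 0 * Complex.cos (ρ * x) - ρ * y 0 * Complex.sin (ρ * x))
  linarith

end IsSLSolution

/-! ### Entire dependence on the spectral parameter. -/

/-- A family of entire functions depending continuously on a parameter in `[0, T]`, uniformly
bounded on bounded sets. -/
structure EntireFamily (T : ℝ) (f : ℝ → ℂ → ℂ) : Prop where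
  differentiable : ∀ t ∈ Icc 0 T, Differentiable ℂ (f t)
  continuousOn : ∀ μ, ContinuousOn (fun t => f t μ) (Icc 0 T)
  bounded : ∀ R : ℝ, ∃ C, ∀ t ∈ Icc 0 T, ∀ μ, ‖μ‖ ≤ R → ‖f t μ‖ ≤ C

namespace EntireFamily

variable {T : ℝ} {f g : ℝ → ℂ → ℂ}

theorem const {h : ℂ → ℂ} (hh : Differentiable ℂ h) : EntireFamily T (fun _ => h) :=
  ⟨fun _ _ => hh, fun _ => continuousOn_const, fun R => by
    obtain ⟨C, hC⟩ := (isCompact_closedBall (0 : ℂ) R).exists_bound_of_continuousOn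
      hh.continuous.continuousOn
    exact ⟨C, fun _ _ μ hμ => hC μ (by simpa using hμ)⟩⟩

theorem mul (hf : EntireFamily T f) (hg : EntireFamily T g) :
    EntireFamily T (fun t μ => f t μ * g t μ) := by
  refine ⟨fun t ht => (hf.differentiable t ht).mul (hg.differentiable t ht),
    fun μ => (hf.continuousOn μ).mul (hg.continuousOn μ), fun R => ?_⟩
  obtain ⟨A, hA⟩ := hf.bounded R
  obtain ⟨B, hB⟩ := hg.bounded R
  refine ⟨A * B, fun t ht μ hμ => ?_⟩
  rw [norm_mul]
  exact mul_le_mul (hA t ht μ hμ) (hB t ht μ hμ) (norm_nonneg _)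
    ((norm_nonneg _).trans (hA t ht μ hμ))

theorem sub (hf : EntireFamily T f) (hg : EntireFamily T g) :
    EntireFamily T (fun t μ => f t μ - g t μ) := by
  refine ⟨fun t ht => (hf.differentiable t ht).sub (hg.differentiable t ht),
    fun μ => (hf.continuousOn μ).sub (hg.continuousOn μ), fun R => ?_⟩
  obtain ⟨A, hA⟩ := hf.bounded R
  obtain ⟨B, hB⟩ := hg.bounded R
  exact ⟨A + B, fun t ht μ hμ => (norm_sub_le _ _).trans (add_le_add (hA t ht μ hμ) (hB t ht μ hμ))⟩

theorem congr (hf : EntireFamily T f) (h : ∀ t ∈ Icc 0 T, ∀ μ, f t μ = g t μ) :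
    EntireFamily T g :=
  ⟨fun t ht => by rw [← funext (h t ht)]; exact hf.differentiable t ht,
    fun μ => (hf.continuousOn μ).congr fun t ht => (h t ht μ).symm,
    fun R => (hf.bounded R).imp fun C hC t ht μ hμ => by rw [← h t ht μ]; exact hC t ht μ hμ⟩

/-- Cauchy's estimate on unit circles, which costs an increase of the radius by 1. -/
theorem deriv_bounded (hf : EntireFamily T f) (R : ℝ) :
    ∃ C, ∀ t ∈ Icc 0 T, ∀ μ, ‖μ‖ ≤ R → ‖deriv (f t) μ‖ ≤ C := by
  obtain ⟨C, hC⟩ := hf.bounded (R + 1)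
  refine ⟨C, fun t ht μ hμ => ?_⟩
  have := Complex.norm_deriv_le_of_forall_mem_sphere_norm_le (c := μ) (R := 1) (C := C) one_pos
    (hf.differentiable t ht).diffContOnCl (fun z hz => hC t ht z (by
      have h1 : ‖z - μ‖ = 1 := by simpa using hz
      calc ‖z‖ = ‖μ + (z - μ)‖ := by ring_nf
        _ ≤ ‖μ‖ + ‖z - μ‖ := norm_add_le _ _
        _ ≤ R + 1 := by linarith))
  simpa using this

/-- Separate continuity suffices because the derivative bound makes the family Lipschitz in `μ`
uniformly in `t`. -/
theorem continuousOn_prod (hf : EntireFamily T f) :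
    ContinuousOn (fun p : ℝ × ℂ => f p.1 p.2) (Icc 0 T ×ˢ univ) := by
  rintro ⟨t₀, μ₀⟩ ⟨ht₀, -⟩
  obtain ⟨C, hC⟩ := hf.deriv_bounded (‖μ₀‖ + 1)
  have h1 : Tendsto (fun p : ℝ × ℂ => C * ‖p.2 - μ₀‖ + ‖f p.1 μ₀ - f t₀ μ₀‖)
      (𝓝[Icc 0 T ×ˢ univ] (t₀, μ₀)) (𝓝 (C * ‖μ₀ - μ₀‖ + ‖f t₀ μ₀ - f t₀ μ₀‖)) := by
    have c1 : ContinuousWithinAt (fun p : ℝ × ℂ => f p.1 μ₀) (Icc 0 T ×ˢ univ) (t₀, μ₀) :=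
      ContinuousWithinAt.comp (f := Prod.fst) (g := fun t => f t μ₀) (t := Icc 0 T)
        (hf.continuousOn μ₀ t₀ ht₀) continuousWithinAt_fst (fun p hp => hp.1)
    have c2 : ContinuousWithinAt (fun p : ℝ × ℂ => C * ‖p.2 - μ₀‖) (Icc 0 T ×ˢ univ) (t₀, μ₀) :=
      Continuous.continuousWithinAt (by fun_prop)
    exact c2.add (c1.sub continuousWithinAt_const).norm
  simp only [sub_self, norm_zero, mul_zero, add_zero] at h1
  rw [ContinuousWithinAt, tendsto_iff_norm_sub_tendsto_zero]
  refine squeeze_zero' (Eventually.of_forall fun _ => norm_nonneg _) ?_ h1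
  have hb : ∀ᶠ p : ℝ × ℂ in 𝓝[Icc 0 T ×ˢ univ] (t₀, μ₀), p.2 ∈ Metric.ball μ₀ 1 :=
    nhdsWithin_le_nhds (continuous_snd.continuousAt.eventually_mem
      (Metric.ball_mem_nhds _ one_pos))
  filter_upwards [hb, self_mem_nhdsWithin] with p hp hpm
  have hlip : ‖f p.1 p.2 - f p.1 μ₀‖ ≤ C * ‖p.2 - μ₀‖ := by
    refine (convex_ball μ₀ 1).norm_image_sub_le_of_norm_deriv_le (𝕜 := ℂ) (f := f p.1)
      (fun x _ => hf.differentiable p.1 hpm.1 x) (fun x hx => hC p.1 hpm.1 x ?_)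
      (Metric.mem_ball_self one_pos) hp
    have : ‖x - μ₀‖ < 1 := by simpa [dist_eq_norm] using hx
    have := norm_le_norm_add_norm_sub' x μ₀
    linarith
  calc ‖f p.1 p.2 - f t₀ μ₀‖ = ‖(f p.1 p.2 - f p.1 μ₀) + (f p.1 μ₀ - f t₀ μ₀)‖ := by ring_nf
    _ ≤ _ := (norm_add_le _ _).trans (by linarith)

theorem differentiable_integral (hf : EntireFamily T f) {w : ℝ → ℂ} {x : ℝ} (hx : x ∈ Icc 0 T)
    (hw : IntervalIntegrable w volume 0 x) :
    Differentiable ℂ (fun μ => ∫ t in (0 : ℝ)..x, w t * f t μ) := by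
  intro μ₀
  obtain ⟨C, hC⟩ := hf.deriv_bounded (‖μ₀‖ + 1)
  have hsub : uIoc 0 x ⊆ Icc 0 T := by
    rw [uIoc_of_le hx.1]; exact fun t ht => ⟨ht.1.le, ht.2.trans hx.2⟩
  have hint : ∀ μ, IntervalIntegrable (fun t => w t * f t μ) volume 0 x := fun μ =>
    hw.mul_continuousOn ((hf.continuousOn μ).mono (by
      rw [uIcc_of_le hx.1]; exact Icc_subset_Icc_right hx.2))
  -- The derivative in the parameter is measurable in `t` as a limit of difference quotients along a
  -- sequence tending to zero.
  have hmeas : AEStronglyMeasurable (fun t => w t * deriv (f t) μ₀) (volume.restrict (uIoc 0 x)) := by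
    set u : ℕ → ℂ := fun n => ((1 / ((n : ℝ) + 1) : ℝ) : ℂ) with hu
    have hu0 : Tendsto u atTop (𝓝[≠] 0) := by
      refine tendsto_nhdsWithin_iff.2 ⟨?_, Eventually.of_forall fun n => ?_⟩
      · have := (Complex.continuous_ofReal.tendsto 0).comp tendsto_one_div_add_atTop_nhds_zero_nat
        simpa [hu, Function.comp_def] using this
      · have : (0 : ℝ) < 1 / ((n : ℝ) + 1) := by positivity
        simpa [hu] using (Complex.ofReal_ne_zero.2 this.ne')
    refine aestronglyMeasurable_of_tendsto_ae (u := atTop)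
      (f := fun n t => (u n)⁻¹ * (w t * f t (μ₀ + u n) - w t * f t μ₀)) (fun n => ?_) ?_
    · exact (((hint _).sub (hint _)).const_mul _).aestronglyMeasurable_restrict_uIoc
    · refine (ae_restrict_iff' measurableSet_uIoc).2 (Eventually.of_forall fun t ht => ?_)
      have hd := ((hf.differentiable t (hsub ht)) μ₀).hasDerivAt.tendsto_slope_zero.comp hu0
      have := hd.const_mul (w t)
      refine this.congr fun n => ?_
      simp only [Function.comp_apply, smul_eq_mul]
      ring
  refine (intervalIntegral.hasDerivAt_integral_of_dominated_loc_of_deriv_le (𝕜 := ℂ) (μ := volume)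
    (F := fun μ t => w t * f t μ) (F' := fun μ t => w t * deriv (f t) μ)
    (s := Metric.ball μ₀ 1) (bound := fun t => ‖w t‖ * C)
    (Metric.ball_mem_nhds _ one_pos) ?_ (hint μ₀) hmeas ?_ (hw.norm.mul_const _) ?_).2.differentiableAt
  · exact Eventually.of_forall fun μ => (hint μ).aestronglyMeasurable_restrict_uIoc
  · refine Eventually.of_forall fun t ht μ hμ => ?_
    rw [norm_mul]
    refine mul_le_mul_of_nonneg_left (hC t (hsub ht) μ ?_) (norm_nonneg _)
    have : ‖μ - μ₀‖ < 1 := by simpa [dist_eq_norm] using hμ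
    have := norm_le_norm_add_norm_sub' μ μ₀
    linarith
  · exact Eventually.of_forall fun t ht μ _ =>
      ((hf.differentiable t (hsub ht)) μ).hasDerivAt.const_mul (w t)

theorem integral (hT : 0 ≤ T) (hf : EntireFamily T f) {w : ℝ → ℂ}
    (hw : IntervalIntegrable w volume 0 T) :
    EntireFamily T (fun x μ => ∫ t in (0 : ℝ)..x, w t * f t μ) := by
  have hwx : ∀ x ∈ Icc 0 T, IntervalIntegrable w volume 0 x := fun x hx => hw.mono_set (by
    rw [uIcc_of_le hx.1, uIcc_of_le hT]; exact Icc_subset_Icc_right hx.2)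
  refine ⟨fun x hx => hf.differentiable_integral hx (hwx x hx), fun μ => ?_, fun R => ?_⟩
  · have h1 : IntervalIntegrable (fun t => w t * f t μ) volume 0 T :=
      hw.mul_continuousOn (by rw [uIcc_of_le hT]; exact hf.continuousOn μ)
    have c := intervalIntegral.continuousOn_primitive_interval' h1 left_mem_uIcc
    rwa [uIcc_of_le hT] at c
  · obtain ⟨C, hC⟩ := hf.bounded R
    refine ⟨∫ t in (0 : ℝ)..T, ‖w t‖ * C, fun x hx μ hμ => ?_⟩
    have hC0 : 0 ≤ C := (norm_nonneg _).trans (hC x hx μ hμ)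
    calc _ ≤ ∫ t in (0 : ℝ)..x, ‖w t‖ * C := by
          refine intervalIntegral.norm_integral_le_of_norm_le hx.1
            (Eventually.of_forall fun t ht => ?_) ((hwx x hx).norm.mul_const _)
          rw [norm_mul]
          exact mul_le_mul_of_nonneg_left (hC t ⟨ht.1.le, ht.2.trans hx.2⟩ μ hμ) (norm_nonneg _)
      _ ≤ _ := intervalIntegral.integral_mono_interval le_rfl hx.1 hx.2
          (Eventually.of_forall fun s => by positivity) (hw.norm.mul_const _)

end EntireFamily

theorem entireFamily_slPicard {q : ℝ → ℝ} {T : ℝ} (hT : 0 ≤ T)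
    (hq : IntervalIntegrable q volume 0 T) (α β : ℂ) (n : ℕ) :
    EntireFamily T (fun x lam => (slPicard q lam α β n).1 x) ∧
      EntireFamily T (fun x lam => (slPicard q lam α β n).2 x) := by
  induction n with
  | zero =>
    exact ⟨EntireFamily.const (h := fun _ => α) (by fun_prop),
      EntireFamily.const (h := fun _ => β) (by fun_prop)⟩
  | succ n ih =>
    have hqc : IntervalIntegrable (fun t => (q t : ℂ)) volume 0 T := ⟨hq.1.ofReal, hq.2.ofReal⟩
    refine ⟨(ih.2.integral hT (w := fun _ => 1) intervalIntegrable_const).congr fun x _ lam => ?_,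
      ((ih.1.integral hT hqc).sub ((EntireFamily.const differentiable_id).mul
        (ih.1.integral hT (w := fun _ => 1) intervalIntegrable_const))).congr fun x hx lam => ?_⟩
    · simp [slPicard]
    · simp only [slPicard, one_mul, id_eq]
      rw [← intervalIntegral.integral_const_mul, ← intervalIntegral.integral_sub]
      · congr 1
        ext t
        ring
      · have := sl_intervalIntegrable hq 0 (slPicard_continuousOn hT hq lam α β n).1 hx
        simpa using this
      · have hc := (slPicard_continuousOn hT hq lam α β n).1.mono (Icc_subset_Icc_right hx.2)
        rw [← uIcc_of_le hx.1] at hc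
        exact hc.intervalIntegrable.const_mul lam

/-- The remainders of the Picard series obey the same recursion as its terms, hence the same
factorial bound. Since `slSol` is only chosen abstractly, this series is the means of reading off
its dependence on `lam`. -/
theorem IsSLSolution.hasSum_slPicard {q : ℝ → ℝ} {T : ℝ} (hq : IntervalIntegrable q volume 0 T)
    {lam : ℂ} {y z : ℝ → ℂ} (h : IsSLSolution q T lam y z) {x : ℝ} (hx : x ∈ Icc 0 T) :
    HasSum (fun n => (slPicard q lam (y 0) (z 0) n).1 x) (y x) ∧
      HasSum (fun n => (slPicard q lam (y 0) (z 0) n).2 x) (z x) := by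
  have hT : 0 ≤ T := hx.1.trans hx.2
  set P := slPicard q lam (y 0) (z 0) with hP
  have hc := slPicard_continuousOn hT hq lam (y 0) (z 0)
  obtain ⟨A, hA⟩ := isCompact_Icc.exists_bound_of_continuousOn h.continuousOn_y
  obtain ⟨B, hB⟩ := isCompact_Icc.exists_bound_of_continuousOn h.continuousOn_z
  have hcs1 : ∀ n, ContinuousOn (fun t => y t - ∑ i ∈ Finset.range n, (P i).1 t) (Icc 0 T) :=
    fun n => h.continuousOn_y.sub (continuousOn_finsetSum _ fun i _ => (hc i).1)
  have hint : ∀ {w : ℝ → ℂ}, ContinuousOn w (Icc 0 T) → ∀ x ∈ Icc 0 T,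
      IntervalIntegrable w volume 0 x := fun {w} hw x hx =>
    ContinuousOn.intervalIntegrable (by
      rw [uIcc_of_le hx.1]; exact hw.mono (Icc_subset_Icc_right hx.2))
  have key : ∀ n : ℕ, ∀ x ∈ Icc 0 T,
      ‖y x - ∑ i ∈ Finset.range n, (P i).1 x‖ ≤ max A B *
        ((∫ s in (0 : ℝ)..x, (1 + ‖(q s : ℂ) - lam‖)) ^ n / n.factorial) ∧
      ‖z x - ∑ i ∈ Finset.range n, (P i).2 x‖ ≤ max A B *
        ((∫ s in (0 : ℝ)..x, (1 + ‖(q s : ℂ) - lam‖)) ^ n / n.factorial) := by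
    intro n
    induction n with
    | zero =>
      intro x hx
      simp only [pow_zero, Nat.factorial_zero, Nat.cast_one, div_one, mul_one, Finset.range_zero,
        Finset.sum_empty, sub_zero]
      exact ⟨(hA x hx).trans (le_max_left A B), (hB x hx).trans (le_max_right A B)⟩
    | succ n ih =>
      intro x hx
      have := sl_step hq lam (y := fun t => y t - ∑ i ∈ Finset.range n, (P i).1 t)
        (z := fun t => z t - ∑ i ∈ Finset.range n, (P i).2 t) n
        (fun t ht => (ih t ht).1) (fun t ht => (ih t ht).2) x hx
      have e1 : y x - ∑ i ∈ Finset.range (n + 1), (P i).1 x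
          = ∫ t in (0 : ℝ)..x, (z t - ∑ i ∈ Finset.range n, (P i).2 t) := by
        rw [intervalIntegral.integral_sub (hint h.continuousOn_z x hx)
          (hint (continuousOn_finsetSum _ fun i _ => (hc i).2) x hx),
          intervalIntegral.integral_finsetSum (fun i _ => hint (hc i).2 x hx),
          Finset.sum_range_succ', h.y_eq x hx]
        simp only [hP, slPicard]
        ring
      have e2 : z x - ∑ i ∈ Finset.range (n + 1), (P i).2 x
          = ∫ t in (0 : ℝ)..x, ((q t : ℂ) - lam) * (y t - ∑ i ∈ Finset.range n, (P i).1 t) := by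
        simp_rw [mul_sub]
        rw [intervalIntegral.integral_sub (sl_intervalIntegrable hq lam h.continuousOn_y hx)
          (sl_intervalIntegrable hq lam (continuousOn_finsetSum _ fun i _ => (hc i).1) hx)]
        simp_rw [Finset.mul_sum]
        rw [intervalIntegral.integral_finsetSum
            (fun i _ => sl_intervalIntegrable hq lam (hc i).1 hx),
          Finset.sum_range_succ', h.z_eq x hx]
        simp only [hP, slPicard]
        ring
      rw [e1, e2]
      exact this
  have lim := (FloorSemiring.tendsto_pow_div_factorial_atTop
    (∫ s in (0 : ℝ)..x, (1 + ‖(q s : ℂ) - lam‖))).const_mul (max A B)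
  rw [mul_zero] at lim
  have hs : ∀ n, ‖(P n).1 x‖ ≤ _ ∧ ‖(P n).2 x‖ ≤ _ := fun n =>
    slPicard_bound hq lam (y 0) (z 0) n x hx
  have hbs := (Real.summable_pow_div_factorial
    (∫ s in (0 : ℝ)..x, (1 + ‖(q s : ℂ) - lam‖))).mul_left (max ‖y 0‖ ‖z 0‖)
  have s1 : Summable fun n => (P n).1 x := Summable.of_norm_bounded hbs fun n => (hs n).1
  have s2 : Summable fun n => (P n).2 x := Summable.of_norm_bounded hbs fun n => (hs n).2
  constructor
  · rw [s1.hasSum_iff_tendsto_nat]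
    have := squeeze_zero_norm (fun n => (key n x hx).1) lim
    simpa using this.const_sub (y x)
  · rw [s2.hasSum_iff_tendsto_nat]
    have := squeeze_zero_norm (fun n => (key n x hx).2) lim
    simpa using this.const_sub (z x)

/-- The Picard terms are entire and are dominated, uniformly for `‖lam‖ ≤ R`, by an exponential
series in `L R`; Weierstrass' theorem applies. -/
theorem entireFamily_slSol {q : ℝ → ℝ} {T : ℝ} (hT : 0 ≤ T)
    (hq : IntervalIntegrable q volume 0 T) (α β : ℂ) :
    EntireFamily T (fun x lam => (slSol q T lam α β).1 x) ∧
      EntireFamily T (fun x lam => (slSol q T lam α β).2 x) := by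
  set L : ℝ → ℝ := fun R => ∫ s in (0 : ℝ)..T, (1 + (|q s| + R)) with hL
  have hLint : ∀ R : ℝ, IntervalIntegrable (fun s => 1 + (|q s| + R)) volume 0 T := fun R =>
    intervalIntegrable_const.add ((IntervalIntegrable.norm hq).add intervalIntegrable_const)
  have hb : ∀ R : ℝ, ∀ n, ∀ x ∈ Icc 0 T, ∀ lam : ℂ, ‖lam‖ ≤ R →
      ‖(slPicard q lam α β n).1 x‖ ≤ max ‖α‖ ‖β‖ * (L R ^ n / n.factorial) ∧
      ‖(slPicard q lam α β n).2 x‖ ≤ max ‖α‖ ‖β‖ * (L R ^ n / n.factorial) := by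
    intro R n x hx lam hlam
    have hR : 0 ≤ R := (norm_nonneg _).trans hlam
    have h0 : 0 ≤ ∫ s in (0 : ℝ)..x, (1 + ‖(q s : ℂ) - lam‖) :=
      intervalIntegral.integral_nonneg hx.1 (fun s _ => by positivity)
    have hxsub : uIcc 0 x ⊆ uIcc 0 T := by
      rw [uIcc_of_le hx.1, uIcc_of_le hT]; exact Icc_subset_Icc_right hx.2
    have hq' : IntervalIntegrable (fun s => (q s : ℂ) - lam) volume 0 x :=
      (IntervalIntegrable.sub (f := fun s => (q s : ℂ)) ⟨hq.1.ofReal, hq.2.ofReal⟩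
        intervalIntegrable_const).mono_set hxsub
    have h1 : ∫ s in (0 : ℝ)..x, (1 + ‖(q s : ℂ) - lam‖) ≤ L R := by
      calc _ ≤ ∫ s in (0 : ℝ)..x, (1 + (|q s| + R)) := by
            refine intervalIntegral.integral_mono_on hx.1 (intervalIntegrable_const.add hq'.norm)
              ((hLint R).mono_set hxsub) fun s _ => ?_
            have := norm_sub_le (q s : ℂ) lam
            rw [Complex.norm_real, Real.norm_eq_abs] at this
            linarith
        _ ≤ _ := intervalIntegral.integral_mono_interval le_rfl hx.1 hx.2
          (Eventually.of_forall fun s => by positivity) (hLint R)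
    have h2 : max ‖α‖ ‖β‖ * ((∫ s in (0 : ℝ)..x, (1 + ‖(q s : ℂ) - lam‖)) ^ n / n.factorial)
        ≤ max ‖α‖ ‖β‖ * (L R ^ n / n.factorial) := by gcongr
    exact ⟨((slPicard_bound hq lam α β n x hx).1).trans h2,
      ((slPicard_bound hq lam α β n x hx).2).trans h2⟩
  have hsum : ∀ R, Summable fun n : ℕ => max ‖α‖ ‖β‖ * (L R ^ n / n.factorial) := fun R =>
    (Real.summable_pow_div_factorial (L R)).mul_left _
  have hs : ∀ x ∈ Icc 0 T, ∀ lam,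
      HasSum (fun n => (slPicard q lam α β n).1 x) ((slSol q T lam α β).1 x) ∧
      HasSum (fun n => (slPicard q lam α β n).2 x) ((slSol q T lam α β).2 x) := by
    intro x hx lam
    obtain ⟨h, h1, h2⟩ := slSol_spec hT hq lam α β
    have := h.hasSum_slPicard hq hx
    rwa [h1, h2] at this
  constructor
  · refine ⟨fun x hx lam₀ => ?_, fun lam => (slSol_spec hT hq lam α β).1.continuousOn_y,
      fun R => ⟨_, fun x hx lam hlam =>
        (hs x hx lam).1.norm_le_of_bounded (hsum R).hasSum fun n => (hb R n x hx lam hlam).1⟩⟩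
    have hd := Complex.differentiableOn_tsum_of_summable_norm (hsum (‖lam₀‖ + 1))
      (U := Metric.ball 0 (‖lam₀‖ + 1))
      (fun n => ((entireFamily_slPicard hT hq α β n).1.differentiable x hx).differentiableOn)
      Metric.isOpen_ball (fun n lam hlam => (hb _ n x hx lam (mem_ball_zero_iff.1 hlam).le).1)
    have hm : Metric.ball (0 : ℂ) (‖lam₀‖ + 1) ∈ 𝓝 lam₀ :=
      Metric.isOpen_ball.mem_nhds (by simp)
    have := hd.differentiableAt hm
    simpa only [(hs x hx _).1.tsum_eq] using this
  · refine ⟨fun x hx lam₀ => ?_, fun lam => (slSol_spec hT hq lam α β).1.continuousOn_z,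
      fun R => ⟨_, fun x hx lam hlam =>
        (hs x hx lam).2.norm_le_of_bounded (hsum R).hasSum fun n => (hb R n x hx lam hlam).2⟩⟩
    have hd := Complex.differentiableOn_tsum_of_summable_norm (hsum (‖lam₀‖ + 1))
      (U := Metric.ball 0 (‖lam₀‖ + 1))
      (fun n => ((entireFamily_slPicard hT hq α β n).2.differentiable x hx).differentiableOn)
      Metric.isOpen_ball (fun n lam hlam => (hb _ n x hx lam (mem_ball_zero_iff.1 hlam).le).2)
    have hm : Metric.ball (0 : ℂ) (‖lam₀‖ + 1) ∈ 𝓝 lam₀ :=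
      Metric.isOpen_ball.mem_nhds (by simp)
    have := hd.differentiableAt hm
    simpa only [(hs x hx _).2.tsum_eq] using this

section

variable {q : ℝ → ℝ} {T : ℝ}

theorem entireFamily_slS (hT : 0 ≤ T) (hq : IntervalIntegrable q volume 0 T) :
    EntireFamily T (slS q T) := (entireFamily_slSol hT hq 0 1).1

theorem entireFamily_slS' (hT : 0 ≤ T) (hq : IntervalIntegrable q volume 0 T) :
    EntireFamily T (slS' q T) := (entireFamily_slSol hT hq 0 1).2

theorem entireFamily_slC (hT : 0 ≤ T) (hq : IntervalIntegrable q volume 0 T) :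
    EntireFamily T (slC q T) := (entireFamily_slSol hT hq 1 0).1

theorem entireFamily_slC' (hT : 0 ≤ T) (hq : IntervalIntegrable q volume 0 T) :
    EntireFamily T (slC' q T) := (entireFamily_slSol hT hq 1 0).2

end

/-! ### Integrals along horizontal lines. -/

section Contour

variable {f : ℂ → ℂ} {τ C R₀ : ℝ}

/-- Shifting a horizontal line to infinity. -/
theorem tendsto_integral_line_of_decay (hf : ∀ z : ℂ, τ ≤ z.im → DifferentiableAt ℂ f z)
    (hb : ∀ z : ℂ, τ ≤ z.im → R₀ ≤ ‖z‖ → ‖f z‖ ≤ C / ‖z‖ ^ 2) (hτ : 0 < τ) :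
    Tendsto (fun R : ℝ => ∫ σ in (-R)..R, f (σ + τ * Complex.I)) atTop (𝓝 0) := by
  have hlim : Tendsto (fun R : ℝ => 4 * |C| / R) atTop (𝓝 0) := tendsto_const_nhds.div_atTop tendsto_id
  refine squeeze_zero_norm' ?_ hlim
  filter_upwards [eventually_ge_atTop R₀, eventually_gt_atTop 0] with R hR hR0
  -- The rectangle has base `[-R, R]` at height `τ` and height `R`. Its other three sides have total
  -- length `4 * R` and the function is `O(R⁻²)` on them.
  have hrect := Complex.integral_boundary_rect_eq_zero_of_differentiableOn f
    ((-R : ℝ) + τ * Complex.I) ((R : ℝ) + (τ + R : ℝ) * Complex.I) (fun z hz => by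
      refine (hf z ?_).differentiableWithinAt
      have := hz.2
      simp only [Complex.add_im, Complex.ofReal_im, Complex.mul_im, Complex.ofReal_re,
        Complex.I_im, mul_one, Complex.I_re, mul_zero, add_zero, zero_add, mem_preimage] at this
      rw [uIcc_of_le (by linarith)] at this
      exact this.1)
  simp only [Complex.add_im, Complex.ofReal_im, Complex.mul_im, Complex.ofReal_re,
        Complex.I_im, mul_one, Complex.I_re, mul_zero, add_zero, zero_add, Complex.add_re,
        Complex.mul_re, sub_self, smul_eq_mul] at hrect
  have hbd : ∀ z : ℂ, τ ≤ z.im → R ≤ ‖z‖ → ‖f z‖ ≤ |C| / R ^ 2 := fun z hz hz' =>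
    (hb z hz (hR.trans hz')).trans (by
      have : C ≤ |C| := le_abs_self C
      gcongr)
  have h1 : ‖∫ x in (-R)..R, f (x + (τ + R : ℝ) * Complex.I)‖ ≤ |C| / R ^ 2 * |R - -R| := by
    refine intervalIntegral.norm_integral_le_of_norm_le_const fun x _ => hbd _ (by simp; linarith) ?_
    refine le_trans ?_ (Complex.abs_im_le_norm _)
    simp only [Complex.add_im, Complex.ofReal_im, Complex.mul_im, Complex.ofReal_re,
        Complex.I_im, mul_one, Complex.I_re, mul_zero, add_zero, zero_add]
    rw [abs_of_pos (by linarith)]; linarith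
  have h2 : ‖∫ y in τ..(τ + R), f ((R : ℝ) + y * Complex.I)‖ ≤ |C| / R ^ 2 * |τ + R - τ| := by
    refine intervalIntegral.norm_integral_le_of_norm_le_const fun y hy => hbd _ ?_ ?_
    · rw [uIoc_of_le (by linarith)] at hy
      simpa using hy.1.le
    · refine le_trans ?_ (Complex.abs_re_le_norm _)
      simp [abs_of_pos hR0]
  have h3 : ‖∫ y in τ..(τ + R), f ((-R : ℝ) + y * Complex.I)‖ ≤ |C| / R ^ 2 * |τ + R - τ| := by
    refine intervalIntegral.norm_integral_le_of_norm_le_const fun y hy => hbd _ ?_ ?_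
    · rw [uIoc_of_le (by linarith)] at hy
      simpa using hy.1.le
    · refine le_trans ?_ (Complex.abs_re_le_norm _)
      simp [abs_of_pos hR0]
  have e : ∫ σ in (-R)..R, f (σ + τ * Complex.I)
      = (∫ x in (-R)..R, f (x + (τ + R : ℝ) * Complex.I))
        - Complex.I * (∫ y in τ..(τ + R), f ((R : ℝ) + y * Complex.I))
        + Complex.I * (∫ y in τ..(τ + R), f ((-R : ℝ) + y * Complex.I)) := by
    linear_combination hrect
  rw [e]
  refine (norm_add_le _ _).trans ((add_le_add (norm_sub_le _ _) le_rfl).trans ?_)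
  rw [norm_mul, norm_mul, Complex.norm_I, one_mul, one_mul]
  refine (add_le_add (add_le_add h1 h2) h3).trans (le_of_eq ?_)
  rw [show R - -R = 2 * R by ring, show τ + R - τ = R by ring, abs_of_pos hR0,
    abs_of_pos (mul_pos two_pos hR0)]
  field_simp
  ring

/-- The principal value of an odd entire function along a horizontal line vanishes. -/
theorem tendsto_integral_line_of_odd (hf : Differentiable ℂ f) (hodd : ∀ z, f (-z) = -f z)
    (hτ : 0 < τ)
    (hb : ∀ z : ℂ, |z.im| ≤ τ → R₀ ≤ ‖z‖ → ‖f z‖ ≤ C / ‖z‖) :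
    Tendsto (fun R : ℝ => ∫ σ in (-R)..R, f (σ + τ * Complex.I)) atTop (𝓝 0) := by
  have hlim : Tendsto (fun R : ℝ => 2 * |C| * τ / R) atTop (𝓝 0) :=
    tendsto_const_nhds.div_atTop tendsto_id
  refine squeeze_zero_norm' ?_ hlim
  filter_upwards [eventually_ge_atTop R₀, eventually_gt_atTop 0] with R hR hR0
  -- The rectangle lies between the real axis and the line. The integral over the real side vanishes
  -- by oddness, and the vertical sides keep the fixed length `τ` while the function decays.
  have hrect := Complex.integral_boundary_rect_eq_zero_of_differentiableOn f
    ((-R : ℝ)) ((R : ℝ) + τ * Complex.I) hf.differentiableOn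
  simp only [Complex.add_im, Complex.ofReal_im, Complex.mul_im, Complex.ofReal_re,
        Complex.I_im, mul_one, Complex.I_re, mul_zero, add_zero, zero_add, Complex.add_re,
        Complex.mul_re, sub_self, smul_eq_mul] at hrect
  have h0 : ∫ x in (-R)..R, f (x + (0 : ℝ) * Complex.I) = 0 := by
    have h := intervalIntegral.integral_comp_neg (fun x : ℝ => f x) (a := -R) (b := R)
    simp only [Complex.ofReal_neg, hodd, neg_neg] at h
    rw [intervalIntegral.integral_neg] at h
    simp only [Complex.ofReal_zero, zero_mul, add_zero]
    linear_combination (-1 / 2 : ℂ) * h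
  rw [h0] at hrect
  have hbd : ∀ z : ℂ, |z.im| ≤ τ → R ≤ ‖z‖ → ‖f z‖ ≤ |C| / R := fun z hz hz' =>
    (hb z hz (hR.trans hz')).trans (by
      have : C ≤ |C| := le_abs_self C
      gcongr)
  have h2 : ‖∫ y in (0 : ℝ)..τ, f ((R : ℝ) + y * Complex.I)‖ ≤ |C| / R * |τ - 0| := by
    refine intervalIntegral.norm_integral_le_of_norm_le_const fun y hy => hbd _ ?_ ?_
    · rw [uIoc_of_le hτ.le] at hy
      simpa [abs_of_pos hy.1] using hy.2
    · refine le_trans ?_ (Complex.abs_re_le_norm _)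
      simp [abs_of_pos hR0]
  have h3 : ‖∫ y in (0 : ℝ)..τ, f ((-R : ℝ) + y * Complex.I)‖ ≤ |C| / R * |τ - 0| := by
    refine intervalIntegral.norm_integral_le_of_norm_le_const fun y hy => hbd _ ?_ ?_
    · rw [uIoc_of_le hτ.le] at hy
      simpa [abs_of_pos hy.1] using hy.2
    · refine le_trans ?_ (Complex.abs_re_le_norm _)
      simp [abs_of_pos hR0]
  have e : ∫ σ in (-R)..R, f (σ + τ * Complex.I)
      = Complex.I * (∫ y in (0 : ℝ)..τ, f ((R : ℝ) + y * Complex.I))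
        - Complex.I * (∫ y in (0 : ℝ)..τ, f ((-R : ℝ) + y * Complex.I)) := by
    linear_combination -hrect
  rw [e]
  refine (norm_sub_le _ _).trans ?_
  rw [norm_mul, norm_mul, Complex.norm_I, one_mul, one_mul]
  refine (add_le_add h2 h3).trans (le_of_eq ?_)
  rw [sub_zero, abs_of_pos hτ]
  ring

theorem line_ne_zero (hτ : 0 < τ) (σ : ℝ) : (σ : ℂ) + τ * Complex.I ≠ 0 := by
  intro h
  have := congrArg Complex.im h
  simp at this
  exact hτ.ne' this

/-- The antiderivative is a branch of 2 log θ. Its logarithmic part is even in σ and cancels between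
symmetric limits; the arctangent part produces the limit. -/
theorem tendsto_integral_line_inv (hτ : 0 < τ) :
    Tendsto (fun R : ℝ => ∫ σ in (-R)..R, 2 / ((σ : ℂ) + τ * Complex.I)) atTop
      (𝓝 (-(2 * Real.pi * Complex.I))) := by
  have hder : ∀ σ : ℝ, HasDerivAt
      (fun σ : ℝ => ((Real.log (σ ^ 2 + τ ^ 2) : ℝ) : ℂ) - 2 * Complex.I * (Real.arctan (σ / τ) : ℝ))
      (2 / ((σ : ℂ) + τ * Complex.I)) σ := by
    intro σ
    have hp : σ ^ 2 + τ ^ 2 ≠ 0 := by positivity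
    have h1 : HasDerivAt (fun σ : ℝ => Real.log (σ ^ 2 + τ ^ 2)) (2 * σ / (σ ^ 2 + τ ^ 2)) σ := by
      have := (((hasDerivAt_id σ).pow 2).add_const (τ ^ 2)).log hp
      simpa using! this
    have h2 : HasDerivAt (fun σ : ℝ => Real.arctan (σ / τ)) (τ / (σ ^ 2 + τ ^ 2)) σ := by
      have := ((hasDerivAt_id σ).div_const τ).arctan
      convert! this using 1
      simp only [id]
      field_simp
      ring
    have h3 := h1.ofReal_comp.sub (h2.ofReal_comp.const_mul (2 * Complex.I))
    convert! h3 using 1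
    have hz := line_ne_zero hτ σ
    have hp' : ((σ : ℂ) ^ 2 + τ ^ 2) ≠ 0 := by exact_mod_cast hp
    push_cast
    field_simp
    linear_combination (τ ^ 2 : ℂ) * Complex.I_sq
  have hcont : Continuous (fun σ : ℝ => 2 / ((σ : ℂ) + τ * Complex.I)) :=
    continuous_const.div (by fun_prop) (line_ne_zero hτ)
  have hval : ∀ R : ℝ, ∫ σ in (-R)..R, 2 / ((σ : ℂ) + τ * Complex.I)
      = -(4 * Complex.I * ((Real.arctan (R / τ) : ℝ) : ℂ)) := by
    intro R
    rw [intervalIntegral.integral_eq_sub_of_hasDerivAt (fun σ _ => hder σ)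
      (hcont.intervalIntegrable _ _), neg_div, Real.arctan_neg, neg_sq]
    push_cast
    ring
  simp_rw [hval]
  have h1 : Tendsto (fun R : ℝ => Real.arctan (R / τ)) atTop (𝓝 (Real.pi / 2)) :=
    (Real.tendsto_arctan_atTop.mono_right nhdsWithin_le_nhds).comp
      (tendsto_id.atTop_div_const hτ)
  have h2 := (((Complex.continuous_ofReal.tendsto _).comp h1).const_mul (4 * Complex.I)).neg
  convert! h2 using 2
  push_cast
  ring

end Contour

/-! ### Square integrability of Fourier integrals. -/

section Plancherel

open FourierTransform SchwartzMap

/-- Plancherel: the Fourier integral of a function in `L¹ ∩ L²` is in `L²`. -/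
theorem memLp_two_fourier {f : ℝ → ℂ} (h1 : Integrable f) (h2 : MemLp f 2) :
    MemLp (𝓕 f) 2 := by
  set g : Lp ℂ 2 (volume : Measure ℝ) := 𝓕 h2.toLp with hg
  have hgL : MemLp g 2 := Lp.memLp g
  refine hgL.ae_eq ?_
  have hdist := Lp.fourier_toTemperedDistribution_eq h2.toLp
  have hcont : Continuous (𝓕 f) := VectorFourier.fourierIntegral_continuous Real.continuous_fourierChar
    (by exact continuous_inner) h1
  have hloc : LocallyIntegrable (fun x => g x - 𝓕 f x) :=
    (hgL.locallyIntegrable (by norm_num)).sub hcont.locallyIntegrable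
  -- The L² Fourier transform and the Fourier integral have the same pairing with every test
  -- function, being equal as tempered distributions; two locally integrable functions with this
  -- property agree almost everywhere.
  have hz := ae_eq_zero_of_integral_contDiff_smul_eq_zero hloc (fun φ hφ hφc => by
    have hc : HasCompactSupport (Complex.ofRealCLM ∘ φ) := hφc.comp_left rfl
    have hs : ContDiff ℝ ((⊤ : ℕ∞) : WithTop ℕ∞) (Complex.ofRealCLM ∘ φ) := by fun_prop
    set u : 𝓢(ℝ, ℂ) := hc.toSchwartzMap hs with hu
    have hux : ∀ x, u x = φ x := fun x => by simp [hu]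
    have e := congrArg (fun F => F u) hdist
    simp only [TemperedDistribution.fourier_apply, Lp.toTemperedDistribution_apply] at e
    have e1 : ∫ x, (𝓕 u) x • (h2.toLp : Lp ℂ 2 (volume : Measure ℝ)) x = ∫ x, u x • 𝓕 f x := by
      have := VectorFourier.integral_fourierIntegral_smul_eq_flip (L := innerₗ ℝ) (μ := volume)
        (ν := volume) Real.continuous_fourierChar continuous_inner u.integrable h1
      simp only [flip_innerₗ] at this
      rw [← show _ = ∫ x, u x • 𝓕 f x from this]
      refine integral_congr_ae ?_
      filter_upwards [h2.coeFn_toLp] with x hx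
      rw [hx]
      rfl
    rw [e1] at e
    have i1 : Integrable (fun x => φ x • g x) := by
      have := (hgL.locallyIntegrable (by norm_num)).integrable_smul_left_of_hasCompactSupport
        hφ.continuous hφc
      exact this
    have i2 : Integrable (fun x => φ x • 𝓕 f x) :=
      hcont.locallyIntegrable.integrable_smul_left_of_hasCompactSupport hφ.continuous hφc
    simp_rw [smul_sub]
    rw [integral_sub i1 i2, sub_eq_zero]
    simp only [hux] at e
    simpa using e.symm)
  filter_upwards [hz] with x hx
  exact sub_eq_zero.1 hx

/-- The inner integral is the Fourier integral of `p`, extended by zero, at the frequency `-(c /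
(2π)) * σ`; the factor 2π comes from the normalisation of the Fourier kernel. -/
theorem integrable_sq_norm_integral_exp {p : ℝ → ℂ} {T : ℝ} (hT : 0 ≤ T)
    (hp : MemLp p 2 (volume.restrict (Ioc 0 T))) {c : ℝ} (hc : c ≠ 0) :
    Integrable (fun σ : ℝ => ‖∫ t in (0 : ℝ)..T, p t * Complex.exp (Complex.I * c * σ * t)‖ ^ 2) := by
  set f : ℝ → ℂ := (Ioc 0 T).indicator p with hf
  have hfL : MemLp f 2 := (memLp_indicator_iff_restrict measurableSet_Ioc).2 hp
  have hfi : Integrable f := by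
    rw [hf, integrable_indicator_iff measurableSet_Ioc]
    exact hp.integrable (by norm_num)
  have hF := (memLp_two_iff_integrable_sq_norm (memLp_two_fourier hfi hfL).1).1
    (memLp_two_fourier hfi hfL)
  have hk : -(c / (2 * Real.pi)) ≠ 0 := by
    have := Real.pi_pos
    simp only [ne_eq, neg_eq_zero, div_eq_zero_iff, hc, false_or]
    positivity
  have := hF.comp_mul_left' hk
  refine this.congr (Eventually.of_forall fun σ => ?_)
  simp only
  congr 2
  rw [Real.fourier_eq', intervalIntegral.integral_of_le hT, ← integral_indicator measurableSet_Ioc]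
  congr 1
  ext t
  by_cases ht : t ∈ Ioc 0 T
  · simp only [hf, indicator_of_mem ht, smul_eq_mul]
    rw [mul_comm]
    congr 2
    have hpi : (Real.pi : ℂ) ≠ 0 := by exact_mod_cast Real.pi_ne_zero
    simp only [RCLike.inner_apply, conj_trivial]
    push_cast
    field_simp
  · simp [hf, indicator_of_notMem ht]

end Plancherel

/-! ### Bounds for the fundamental solutions S and C. -/

section Fundamental

variable {q q' : ℝ → ℝ} {T : ℝ}

theorem isSLSolution_slS (hT : 0 ≤ T) (hq : IntervalIntegrable q volume 0 T) (lam : ℂ) :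
    IsSLSolution q T lam (fun x => slS q T x lam) (fun x => slS' q T x lam) :=
  (slSol_spec hT hq lam 0 1).1

theorem isSLSolution_slC (hT : 0 ≤ T) (hq : IntervalIntegrable q volume 0 T) (lam : ℂ) :
    IsSLSolution q T lam (fun x => slC q T x lam) (fun x => slC' q T x lam) :=
  (slSol_spec hT hq lam 1 0).1

theorem slS_zero (hT : 0 ≤ T) (hq : IntervalIntegrable q volume 0 T) (lam : ℂ) :
    slS q T 0 lam = 0 := (slSol_spec hT hq lam 0 1).2.1

theorem slS'_zero (hT : 0 ≤ T) (hq : IntervalIntegrable q volume 0 T) (lam : ℂ) :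
    slS' q T 0 lam = 1 := (slSol_spec hT hq lam 0 1).2.2

theorem slC_zero (hT : 0 ≤ T) (hq : IntervalIntegrable q volume 0 T) (lam : ℂ) :
    slC q T 0 lam = 1 := (slSol_spec hT hq lam 1 0).2.1

theorem slC'_zero (hT : 0 ≤ T) (hq : IntervalIntegrable q volume 0 T) (lam : ℂ) :
    slC' q T 0 lam = 0 := (slSol_spec hT hq lam 1 0).2.2

theorem slC_mul_slS'_sub (hT : 0 ≤ T) (hq : IntervalIntegrable q volume 0 T) (lam : ℂ) {x : ℝ}
    (hx : x ∈ Icc 0 T) :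
    slC q T x lam * slS' q T x lam - slC' q T x lam * slS q T x lam = 1 := by
  have := (isSLSolution_slC hT hq lam).wronskian hT hq (isSLSolution_slS hT hq lam) hx
  simpa [slS_zero hT hq, slS'_zero hT hq, slC_zero hT hq, slC'_zero hT hq] using this

/-- `‖ρ‖` beyond which the a priori bounds hold. -/
noncomputable def freqThreshold (q : ℝ → ℝ) (T : ℝ) : ℝ := 2 * (∫ t in (0 : ℝ)..T, |q t|) + 1

theorem integral_abs_nonneg (hT : 0 ≤ T) : 0 ≤ ∫ t in (0 : ℝ)..T, |q t| :=
  intervalIntegral.integral_nonneg hT fun _ _ => abs_nonneg _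

theorem one_le_freqThreshold (hT : 0 ≤ T) : 1 ≤ freqThreshold q T := by
  have := integral_abs_nonneg (q := q) hT
  rw [freqThreshold]; linarith

variable {ρ : ℂ}

theorem ne_zero_of_freqThreshold_le (hT : 0 ≤ T) (hρ : freqThreshold q T ≤ ‖ρ‖) : ρ ≠ 0 := by
  rw [← norm_pos_iff]; linarith [one_le_freqThreshold (q := q) hT]

theorem le_of_freqThreshold_le (hρ : freqThreshold q T ≤ ‖ρ‖) :
    2 * (∫ t in (0 : ℝ)..T, |q t|) ≤ ‖ρ‖ := by
  rw [freqThreshold] at hρ; linarith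

theorem norm_slS_le (hT : 0 ≤ T) (hq : IntervalIntegrable q volume 0 T)
    (hρ : freqThreshold q T ≤ ‖ρ‖) {x : ℝ} (hx : x ∈ Icc 0 T) :
    ‖slS q T x (ρ ^ 2)‖ ≤ 2 / ‖ρ‖ * Real.exp (|ρ.im| * x) := by
  have := (isSLSolution_slS hT hq (ρ ^ 2)).bound hT hq (ne_zero_of_freqThreshold_le hT hρ)
    (le_of_freqThreshold_le hρ) hx
  simpa [slS_zero hT hq, slS'_zero hT hq, div_eq_mul_inv] using this

theorem norm_slS'_le (hT : 0 ≤ T) (hq : IntervalIntegrable q volume 0 T)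
    (hρ : freqThreshold q T ≤ ‖ρ‖) {x : ℝ} (hx : x ∈ Icc 0 T) :
    ‖slS' q T x (ρ ^ 2)‖ ≤ 2 * Real.exp (|ρ.im| * x) := by
  have := (isSLSolution_slS hT hq (ρ ^ 2)).bound_deriv hT hq (ne_zero_of_freqThreshold_le hT hρ)
    (le_of_freqThreshold_le hρ) hx
  simpa [slS_zero hT hq, slS'_zero hT hq] using this

theorem norm_slC_le (hT : 0 ≤ T) (hq : IntervalIntegrable q volume 0 T)
    (hρ : freqThreshold q T ≤ ‖ρ‖) {x : ℝ} (hx : x ∈ Icc 0 T) :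
    ‖slC q T x (ρ ^ 2)‖ ≤ 2 * Real.exp (|ρ.im| * x) := by
  have h0 := ne_zero_of_freqThreshold_le hT hρ
  have := (isSLSolution_slC hT hq (ρ ^ 2)).bound hT hq h0 (le_of_freqThreshold_le hρ) hx
  simpa [slC_zero hT hq, slC'_zero hT hq, h0] using this

theorem norm_slC'_le (hT : 0 ≤ T) (hq : IntervalIntegrable q volume 0 T)
    (hρ : freqThreshold q T ≤ ‖ρ‖) {x : ℝ} (hx : x ∈ Icc 0 T) :
    ‖slC' q T x (ρ ^ 2)‖ ≤ 2 * ‖ρ‖ * Real.exp (|ρ.im| * x) := by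
  have h0 := ne_zero_of_freqThreshold_le hT hρ
  have := (isSLSolution_slC hT hq (ρ ^ 2)).bound_deriv hT hq h0 (le_of_freqThreshold_le hρ) hx
  simpa [slC_zero hT hq, slC'_zero hT hq] using this

theorem norm_slS_sub_sin_le (hT : 0 ≤ T) (hq : IntervalIntegrable q volume 0 T)
    (hρ : freqThreshold q T ≤ ‖ρ‖) {x : ℝ} (hx : x ∈ Icc 0 T) :
    ‖slS q T x (ρ ^ 2) - Complex.sin (ρ * x) / ρ‖
      ≤ freqThreshold q T / ‖ρ‖ ^ 2 * Real.exp (|ρ.im| * x) := by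
  have h0 := ne_zero_of_freqThreshold_le hT hρ
  have := ((isSLSolution_slS hT hq (ρ ^ 2)).free_approx hT hq h0 (le_of_freqThreshold_le hρ) hx).1
  simp only [slS_zero hT hq, slS'_zero hT hq, zero_mul, one_mul, zero_add, norm_one, norm_zero,
    mul_zero, add_zero] at this
  refine this.trans ?_
  gcongr ?_ * _
  rw [freqThreshold, mul_one_div, div_div, ← sq]
  gcongr
  linarith

theorem le_norm_sin (ρ : ℂ) (x : ℝ) :
    (Real.exp (ρ.im * x) - Real.exp (-(ρ.im * x))) / 2 ≤ ‖Complex.sin (ρ * x)‖ := by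
  have e : Complex.sin (ρ * x)
      = (Complex.exp (-(ρ * x) * Complex.I) - Complex.exp (ρ * x * Complex.I)) * Complex.I / 2 := by
    rw [Complex.sin]
  rw [e, norm_div, norm_mul, Complex.norm_I, mul_one, RCLike.norm_ofNat]
  gcongr
  refine le_trans (le_of_eq ?_) (norm_sub_norm_le _ _)
  rw [Complex.norm_exp, Complex.norm_exp]
  congr 2 <;> simp

/-- Lower bound for `S` away from the positive half-axis. -/
theorem exists_le_norm_slS (hT : 0 ≤ T) (hq : IntervalIntegrable q volume 0 T) {τ : ℝ}
    (hτ : 0 < τ) {x : ℝ} (hx : x ∈ Icc 0 T) (hx0 : 0 < x) :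
    ∃ c > 0, ∃ R, freqThreshold q T ≤ R ∧ ∀ ρ : ℂ, τ ≤ ρ.im → R ≤ ‖ρ‖ →
      c / ‖ρ‖ * Real.exp (ρ.im * x) ≤ ‖slS q T x (ρ ^ 2)‖ := by
  -- For `τ ≤ ρ.im` this choice gives `‖sin (ρ x)‖ ≥ d / 2 * exp (ρ.im * x)`. Beyond `4 *
  -- freqThreshold q T / d` the deviation of `S` from `sin (ρ x) / ρ` consumes at most half of that.
  set d : ℝ := 1 - Real.exp (-(2 * τ * x)) with hd
  have hd0 : 0 < d := by
    have : Real.exp (-(2 * τ * x)) < Real.exp 0 :=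
      Real.exp_lt_exp.2 (by nlinarith [mul_pos hτ hx0])
    rw [Real.exp_zero] at this
    linarith
  have hF := one_le_freqThreshold (q := q) hT
  refine ⟨d / 4, by positivity, max (freqThreshold q T) (4 * freqThreshold q T / d),
    le_max_left _ _, fun ρ him hρ => ?_⟩
  have hρ1 := (le_max_left _ _).trans hρ
  have hρ2 := (le_max_right _ _).trans hρ
  have hρ0 : 0 < ‖ρ‖ := by linarith
  have h1 := norm_slS_sub_sin_le hT hq hρ1 hx
  have h2 := le_norm_sin ρ x
  have him0 : 0 < ρ.im := hτ.trans_le him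
  rw [abs_of_pos him0] at h1
  have h3 : Real.exp (-(ρ.im * x)) ≤ Real.exp (ρ.im * x) * Real.exp (-(2 * τ * x)) := by
    rw [← Real.exp_add]
    apply Real.exp_le_exp.2
    nlinarith
  set E := Real.exp (ρ.im * x) with hE
  have hE0 : 0 < E := Real.exp_pos _
  have h4 : d / 2 * E ≤ ‖Complex.sin (ρ * x)‖ := by
    refine le_trans ?_ h2
    rw [hd]; linarith
  have h5 : ‖Complex.sin (ρ * x) / ρ‖ ≤ ‖slS q T x (ρ ^ 2)‖ +
      freqThreshold q T / ‖ρ‖ ^ 2 * E := by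
    have := norm_sub_norm_le (Complex.sin (ρ * x) / ρ) (slS q T x (ρ ^ 2))
    rw [norm_sub_rev] at this
    linarith
  rw [norm_div] at h5
  have h6 : freqThreshold q T / ‖ρ‖ ^ 2 * E ≤ d / 4 / ‖ρ‖ * E := by
    refine mul_le_mul_of_nonneg_right ?_ hE0.le
    rw [div_le_div_iff₀ (by positivity) hρ0]
    rw [div_le_iff₀ hd0] at hρ2
    nlinarith
  have h7 : d / 2 / ‖ρ‖ * E ≤ ‖Complex.sin (ρ * x)‖ / ‖ρ‖ := by
    rw [div_mul_eq_mul_div]; gcongr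
  have h8 : d / 2 / ‖ρ‖ * E = d / 4 / ‖ρ‖ * E + d / 4 / ‖ρ‖ * E := by ring
  linarith

theorem exists_slS_ne_zero (hT : 0 ≤ T) (hq : IntervalIntegrable q volume 0 T) {x : ℝ}
    (hx : x ∈ Icc 0 T) (hx0 : 0 < x) : ∃ μ, slS q T x μ ≠ 0 := by
  obtain ⟨c, hc, R, hR, h⟩ := exists_le_norm_slS hT hq one_pos hx hx0
  have hR1 : 1 ≤ R := (one_le_freqThreshold hT).trans hR
  refine ⟨(R * Complex.I) ^ 2, ?_⟩
  have hn : ‖(R : ℂ) * Complex.I‖ = R := by simp [abs_of_pos (by linarith : 0 < R)]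
  have := h (R * Complex.I) (by simpa using hR1) hn.ge
  rw [← norm_pos_iff]
  refine lt_of_lt_of_le ?_ this
  rw [hn]
  have : 0 < R := by linarith
  positivity

end Fundamental

/-! ### Weyl-type solutions and completeness of the functions S. -/

section Weyl

/-- The Weyl-type solution `C + M S` on an edge. -/
noncomputable def weylSol (q : ℝ → ℝ) (T : ℝ) (M : ℂ → ℂ) (x : ℝ) (lam : ℂ) : ℂ :=
  slC q T x lam + M lam * slS q T x lam

/-- The derivative of the Weyl-type solution. -/
noncomputable def weylSol' (q : ℝ → ℝ) (T : ℝ) (M : ℂ → ℂ) (x : ℝ) (lam : ℂ) : ℂ :=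
  slC' q T x lam + M lam * slS' q T x lam

/-- `M` is holomorphic outside the parabola `(Im θ = τ)²` and the solution `C + M S` decays
there at large frequencies. -/
structure IsDecayingWeyl (q : ℝ → ℝ) (T τ : ℝ) (M : ℂ → ℂ) : Prop where
  differentiableAt : ∀ θ : ℂ, τ ≤ θ.im → DifferentiableAt ℂ M (θ ^ 2)
  bound : ∃ C ≥ 0, ∃ R, ∀ θ : ℂ, τ ≤ θ.im → R ≤ ‖θ‖ → ∀ x ∈ Icc 0 T,
    ‖weylSol q T M x (θ ^ 2)‖ ≤ C * Real.exp (-(θ.im * x)) ∧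
    ‖weylSol' q T M x (θ ^ 2)‖ ≤ C * ‖θ‖ * Real.exp (-(θ.im * x))

variable {q q' : ℝ → ℝ} {T τ : ℝ} {M M' : ℂ → ℂ}

theorem isSLSolution_weylSol (hT : 0 ≤ T) (hq : IntervalIntegrable q volume 0 T) (lam : ℂ) :
    IsSLSolution q T lam (fun x => weylSol q T M x lam) (fun x => weylSol' q T M x lam) :=
  (isSLSolution_slC hT hq lam).add hT hq ((isSLSolution_slS hT hq lam).const_mul hT hq (M lam))

theorem IsPrimitiveOn.eq_zero_of_continuousOn {F f : ℝ → ℂ} (hT : 0 < T)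
    (h : IsPrimitiveOn T F f) (hF : ∀ x ∈ Icc 0 T, F x = 0) (hf : ContinuousOn f (Icc 0 T)) :
    ∀ x ∈ Icc 0 T, f x = 0 := by
  have hint : ∀ x ∈ Ioo 0 T, f x = 0 := by
    intro x hx
    have hxm : x ∈ Icc 0 T := Ioo_subset_Icc_self hx
    have hn : Icc 0 T ∈ 𝓝 x := Icc_mem_nhds hx.1 hx.2
    have hd := intervalIntegral.integral_hasDerivAt_right (h.integrable_left hxm)
      (hf.stronglyMeasurableAtFilter_nhdsWithin measurableSet_Icc x |>.filter_mono (by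
        rw [nhdsWithin_eq_nhds.2 hn])) (hf.continuousAt hn)
    have hz : (fun u => ∫ t in (0 : ℝ)..u, f t) =ᶠ[𝓝 x] fun _ => 0 := by
      filter_upwards [hn] with u hu
      have := h.eq u hu
      rw [hF u hu, hF 0 ⟨le_rfl, hT.le⟩] at this
      simpa using this.symm
    exact hd.unique ((hasDerivAt_const x (0 : ℂ)).congr_of_eventuallyEq hz)
  have hcl : closure (Ioo 0 T) = Icc 0 T := closure_Ioo hT.ne
  intro x hx
  have := (show EqOn f (fun _ => 0) (Ioo 0 T) from hint).of_subset_closure hf continuousOn_const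
    Ioo_subset_Icc_self hcl.ge
  exact this hx

theorem exists_sq_eq_im_nonneg (μ : ℂ) : ∃ θ : ℂ, θ ^ 2 = μ ∧ 0 ≤ θ.im := by
  obtain ⟨θ, hθ⟩ := IsAlgClosed.exists_pow_nat_eq μ (n := 2) two_pos
  rcases le_total 0 θ.im with h | h
  · exact ⟨θ, hθ, h⟩
  · exact ⟨-θ, by rw [neg_sq, hθ], by simpa using h⟩

theorem EntireFamily.mono {f : ℝ → ℂ → ℂ} {x : ℝ} (hf : EntireFamily T f) (hx : x ≤ T) :
    EntireFamily x f :=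
  ⟨fun t ht => hf.differentiable t ⟨ht.1, ht.2.trans hx⟩,
    fun μ => (hf.continuousOn μ).mono (Icc_subset_Icc_right hx),
    fun R => (hf.bounded R).imp fun _ hC t ht => hC t ⟨ht.1, ht.2.trans hx⟩⟩

theorem norm_integral_mul_le {k f : ℝ → ℂ} {a b x B : ℝ} (ha : 0 ≤ a) (hab : a ≤ b) (hbx : b ≤ x)
    (hk : IntervalIntegrable k volume 0 x) (hf : ∀ t ∈ Icc a b, ‖f t‖ ≤ B) (hB : 0 ≤ B) :
    ‖∫ t in a..b, k t * f t‖ ≤ (∫ t in (0 : ℝ)..x, ‖k t‖) * B := by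
  have h0b := ha.trans hab
  have hsub : uIcc a b ⊆ uIcc 0 x := by
    rw [uIcc_of_le hab, uIcc_of_le (h0b.trans hbx)]
    exact Icc_subset_Icc ha hbx
  calc _ ≤ ∫ t in a..b, ‖k t‖ * B := by
        refine intervalIntegral.norm_integral_le_of_norm_le hab (Eventually.of_forall fun t ht => ?_)
          ((hk.mono_set hsub).norm.mul_const _)
        rw [norm_mul]
        exact mul_le_mul_of_nonneg_left (hf t (Ioc_subset_Icc_self ht)) (norm_nonneg _)
    _ = (∫ t in a..b, ‖k t‖) * B := intervalIntegral.integral_mul_const _ _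
    _ ≤ _ := by
        gcongr
        exact intervalIntegral.integral_mono_interval ha hab hbx
          (Eventually.of_forall fun s => norm_nonneg _) hk.norm

/-- Completeness of the family `S(·, λ)` on `[0, x]`. -/
theorem eq_zero_of_integral_mul_slS_eq_zero (hq : IntervalIntegrable q volume 0 T)
    (W : IsDecayingWeyl q T τ M) (hτ : 0 < τ) {x : ℝ} (hx0 : 0 < x) (hxT : x ≤ T) {k : ℝ → ℂ}
    (hk : ContinuousOn k (Icc 0 x)) (h : ∀ lam, ∫ t in (0 : ℝ)..x, k t * slS q T t lam = 0) :
    ∀ t ∈ Icc 0 x, k t = 0 := by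
  have hT : 0 ≤ T := hx0.le.trans hxT
  have hki : IntervalIntegrable k volume 0 x :=
    ContinuousOn.intervalIntegrable (by rwa [uIcc_of_le hx0.le])
  have eS := (entireFamily_slS hT hq).mono hxT
  have eC := (entireFamily_slC hT hq).mono hxT
  set cS : ℝ → ℂ → ℂ := fun s μ => ∫ t in (0 : ℝ)..s, k t * slS q T t μ with hcS
  set cC : ℝ → ℂ → ℂ := fun s μ => ∫ t in (0 : ℝ)..s, k t * slC q T t μ with hcC
  have ecS : EntireFamily x cS := eS.integral hx0.le hki
  have ecC : EntireFamily x cC := eC.integral hx0.le hki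
  have hxm : x ∈ Icc 0 x := ⟨hx0.le, le_rfl⟩
  have hcont : ∀ μ, ContinuousOn (fun t => slS q T t μ) (Icc 0 x) := eS.continuousOn
  have hcontC : ∀ μ, ContinuousOn (fun t => slC q T t μ) (Icc 0 x) := eC.continuousOn
  have iS : ∀ μ, ∀ a ∈ Icc 0 x, ∀ b ∈ Icc 0 x,
      IntervalIntegrable (fun t => k t * slS q T t μ) volume a b := fun μ a ha b hb =>
    ((hk.mul (hcont μ)).mono (uIcc_subset_Icc ha hb)).intervalIntegrable
  have iC : ∀ μ, ∀ a ∈ Icc 0 x, ∀ b ∈ Icc 0 x,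
      IntervalIntegrable (fun t => k t * slC q T t μ) volume a b := fun μ a ha b hb =>
    ((hk.mul (hcontC μ)).mono (uIcc_subset_Icc ha hb)).intervalIntegrable
  obtain ⟨C, hC0, R, hW⟩ := W.bound
  set K := ∫ t in (0 : ℝ)..x, ‖k t‖ with hK
  have hK0 : 0 ≤ K := intervalIntegral.integral_nonneg hx0.le fun _ _ => norm_nonneg _
  -- The left side is Green's operator applied to `k`: Φ(s) ∫_0^s k S + S(s) ∫_s^x k Φ with Φ = C +
  -- M S. The terms with `M` cancel because `k` is orthogonal to S, which makes the expression
  -- entire; decay at infinity and Liouville's theorem then give zero.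
  have hZ : ∀ s ∈ Icc 0 x, ∀ μ, slS q T s μ * (cC x μ - cC s μ) + slC q T s μ * cS s μ = 0 := by
    intro s hs μ
    have hsT : s ∈ Icc 0 T := ⟨hs.1, hs.2.trans hxT⟩
    set Z : ℂ → ℂ := fun μ => slS q T s μ * (cC x μ - cC s μ) + slC q T s μ * cS s μ with hZdef
    have hdiff : Differentiable ℂ Z :=
      ((eS.differentiable s hs).mul ((ecC.differentiable x hxm).sub (ecC.differentiable s hs))).add
        ((eC.differentiable s hs).mul (ecS.differentiable s hs))
    -- The first summand serves `τ ≤ θ.im`, where the decay of Φ compensates the growth of S; the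
    -- second serves the strip `0 ≤ θ.im ≤ τ`, where every exponential is at most `exp (τ * T)`.
    set A := 4 * C * K + 8 * K * Real.exp (2 * τ * T) with hA
    have hb : ∀ θ : ℂ, 0 ≤ θ.im → max R (freqThreshold q T) ≤ ‖θ‖ → ‖Z (θ ^ 2)‖ ≤ A / ‖θ‖ := by
      intro θ him hθ
      have hθR := (le_max_left _ _).trans hθ
      have hθF := (le_max_right _ _).trans hθ
      have hθ0 : 0 < ‖θ‖ := norm_pos_iff.2 (ne_zero_of_freqThreshold_le hT hθF)
      rcases le_total τ θ.im with hle | hle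
      · have e : Z (θ ^ 2) = weylSol q T M s (θ ^ 2) * cS s (θ ^ 2)
            + slS q T s (θ ^ 2) * ∫ t in s..x, k t * weylSol q T M t (θ ^ 2) := by
          have e1 : ∫ t in s..x, k t * weylSol q T M t (θ ^ 2)
              = (cC x (θ ^ 2) - cC s (θ ^ 2)) + M (θ ^ 2) * (cS x (θ ^ 2) - cS s (θ ^ 2)) := by
            simp only [hcC, hcS]
            rw [intervalIntegral.integral_interval_sub_left
                (iC _ 0 ⟨le_rfl, hx0.le⟩ x hxm) (iC _ 0 ⟨le_rfl, hx0.le⟩ s hs),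
              intervalIntegral.integral_interval_sub_left
                (iS _ 0 ⟨le_rfl, hx0.le⟩ x hxm) (iS _ 0 ⟨le_rfl, hx0.le⟩ s hs),
              ← intervalIntegral.integral_const_mul,
              ← intervalIntegral.integral_add (iC _ s hs x hxm) ((iS _ s hs x hxm).const_mul _)]
            congr 1
            ext t
            rw [weylSol]
            ring
          have e2 : cS x (θ ^ 2) = 0 := h _
          rw [e1, e2]
          simp only [hZdef, weylSol]
          ring
        have b1 : ‖cS s (θ ^ 2)‖ ≤ K * (2 / ‖θ‖ * Real.exp (θ.im * s)) := by
          refine norm_integral_mul_le le_rfl hs.1 hs.2 hki (fun t ht => ?_) (by positivity)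
          have := norm_slS_le hT hq hθF ⟨ht.1, ht.2.trans hsT.2⟩
          rw [abs_of_nonneg him] at this
          refine this.trans ?_
          gcongr
          exact ht.2
        have b2 : ‖∫ t in s..x, k t * weylSol q T M t (θ ^ 2)‖
            ≤ K * (C * Real.exp (-(θ.im * s))) := by
          refine norm_integral_mul_le hs.1 hs.2 le_rfl hki (fun t ht => ?_) (by positivity)
          refine (hW θ hle hθR t ⟨hs.1.trans ht.1, ht.2.trans hxT⟩).1.trans ?_
          gcongr
          exact ht.1
        have b3 := (hW θ hle hθR s hsT).1
        have b4 := norm_slS_le hT hq hθF hsT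
        rw [abs_of_nonneg him] at b4
        have hexp : Real.exp (-(θ.im * s)) * Real.exp (θ.im * s) = 1 := by
          rw [← Real.exp_add]; simp
        rw [e]
        calc _ ≤ (C * Real.exp (-(θ.im * s))) * (K * (2 / ‖θ‖ * Real.exp (θ.im * s)))
              + (2 / ‖θ‖ * Real.exp (θ.im * s)) * (K * (C * Real.exp (-(θ.im * s)))) := by
              refine (norm_add_le _ _).trans ?_
              rw [norm_mul, norm_mul]
              gcongr
          _ = 4 * C * K / ‖θ‖ * (Real.exp (-(θ.im * s)) * Real.exp (θ.im * s)) := by ring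
          _ ≤ A / ‖θ‖ := by
              rw [hexp, mul_one, hA]
              gcongr
              have : 0 ≤ 8 * K * Real.exp (2 * τ * T) := by positivity
              linarith
      · set E := Real.exp (τ * T) with hE
        have hexp : ∀ t ∈ Icc 0 T, Real.exp (|θ.im| * t) ≤ E := fun t ht => by
          apply Real.exp_le_exp.2
          rw [abs_of_nonneg him]
          exact mul_le_mul hle ht.2 ht.1 hτ.le
        have bS : ∀ t ∈ Icc 0 T, ‖slS q T t (θ ^ 2)‖ ≤ 2 / ‖θ‖ * E := fun t ht =>
          (norm_slS_le hT hq hθF ht).trans (by gcongr; exact hexp t ht)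
        have bC : ∀ t ∈ Icc 0 T, ‖slC q T t (θ ^ 2)‖ ≤ 2 * E := fun t ht =>
          (norm_slC_le hT hq hθF ht).trans (by gcongr; exact hexp t ht)
        have e1 : cC x (θ ^ 2) - cC s (θ ^ 2) = ∫ t in s..x, k t * slC q T t (θ ^ 2) :=
          intervalIntegral.integral_interval_sub_left
                (iC _ 0 ⟨le_rfl, hx0.le⟩ x hxm) (iC _ 0 ⟨le_rfl, hx0.le⟩ s hs)
        have b1 : ‖cS s (θ ^ 2)‖ ≤ K * (2 / ‖θ‖ * E) :=
          norm_integral_mul_le le_rfl hs.1 hs.2 hki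
            (fun t ht => bS t ⟨ht.1, ht.2.trans hsT.2⟩) (by positivity)
        have b2 : ‖cC x (θ ^ 2) - cC s (θ ^ 2)‖ ≤ K * (2 * E) := by
          rw [e1]
          exact norm_integral_mul_le hs.1 hs.2 le_rfl hki
            (fun t ht => bC t ⟨hs.1.trans ht.1, ht.2.trans hxT⟩) (by positivity)
        have hEE : E * E = Real.exp (2 * τ * T) := by
          rw [hE, ← Real.exp_add]; congr 1; ring
        calc _ ≤ (2 / ‖θ‖ * E) * (K * (2 * E)) + (2 * E) * (K * (2 / ‖θ‖ * E)) := by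
              refine (norm_add_le _ _).trans ?_
              rw [norm_mul, norm_mul]
              gcongr
              · exact bS s hsT
              · exact bC s hsT
          _ = 8 * K * (E * E) / ‖θ‖ := by ring
          _ ≤ A / ‖θ‖ := by
              rw [hEE, hA]
              gcongr
              have : 0 ≤ 4 * C * K := by positivity
              linarith
    -- Every μ is `θ ^ 2` with `0 ≤ θ.im`, and then `‖θ‖` is the square root of `‖μ‖`; so the bound
    -- on the closed upper half-plane covers a neighbourhood of infinity.
    have hlim : Tendsto Z (cocompact ℂ) (𝓝 0) := by
      have h1 : Tendsto (fun μ : ℂ => A / Real.sqrt ‖μ‖) (cocompact ℂ) (𝓝 0) :=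
        tendsto_const_nhds.div_atTop (Real.tendsto_sqrt_atTop.comp (tendsto_norm_cocompact_atTop))
      refine squeeze_zero_norm' ?_ h1
      have h2 := (Real.tendsto_sqrt_atTop.comp (tendsto_norm_cocompact_atTop (E := ℂ)))
      filter_upwards [h2.eventually_ge_atTop (max R (freqThreshold q T))] with μ hμ
      obtain ⟨θ, rfl, hθ⟩ := exists_sq_eq_im_nonneg μ
      have e : Real.sqrt ‖θ ^ 2‖ = ‖θ‖ := by rw [norm_pow, Real.sqrt_sq (norm_nonneg _)]
      simp only [Function.comp_apply, e] at hμ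
      rw [e]
      exact hb θ hθ hμ
    exact hdiff.apply_eq_of_tendsto_cocompact μ hlim
  have hcSz : ∀ μ, ∀ s ∈ Icc 0 x, cS s μ = 0 := by
    intro μ
    have hxI : x ∈ Icc 0 T := ⟨hx0.le, hxT⟩
    have solS := (isSLSolution_slS hT hq μ).mono hxI
    have solC := (isSLSolution_slC hT hq μ).mono hxI
    have p0 : IsPrimitiveOn x (fun s => cS s μ) (fun t => k t * slS q T t μ) :=
      ⟨iS μ 0 ⟨le_rfl, hx0.le⟩ x hxm, fun s _ => by simp [hcS]⟩
    have p1 : IsPrimitiveOn x (fun s => cC s μ) (fun t => k t * slC q T t μ) :=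
      ⟨iC μ 0 ⟨le_rfl, hx0.le⟩ x hxm, fun s _ => by simp [hcC]⟩
    have pc : IsPrimitiveOn x (fun _ => cC x μ) (fun _ => 0) :=
      IsPrimitiveOn.of_hasDerivAt (fun s => hasDerivAt_const s _) continuous_const
    -- In the derivative of the vanishing function in `s` the terms containing `k` cancel. This
    -- gives a second linear equation, and the Wronskian of C and S being 1 forces `cS s μ = 0`.
    have p2 := (((solS.primitive_y hx0.le).mul hx0.le (pc.sub p1)).add
      ((solC.primitive_y hx0.le).mul hx0.le p0)).congr_right hx0.le
      (g := fun s => slS' q T s μ * (cC x μ - cC s μ) + slC' q T s μ * cS s μ)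
      (fun s _ => by ring)
    have hcont2 := ((solS.continuousOn_z.mul ((continuousOn_const (c := cC x μ)).sub (ecC.continuousOn μ))).add
      (solC.continuousOn_z.mul (ecS.continuousOn μ)))
    have z2 := p2.eq_zero_of_continuousOn hx0 (fun s hs => hZ s hs μ) hcont2
    intro s hs
    have w := slC_mul_slS'_sub hT hq μ (x := s) ⟨hs.1, hs.2.trans hxT⟩
    have z1 := hZ s hs μ
    have z3 : slS' q T s μ * (cC x μ - cC s μ) + slC' q T s μ * cS s μ = 0 := z2 s hs
    linear_combination (-cS s μ) * w + slS' q T s μ * z1 - slS q T s μ * z3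
  have hkS : ∀ μ, ∀ t ∈ Icc 0 x, k t * slS q T t μ = 0 := fun μ =>
    IsPrimitiveOn.eq_zero_of_continuousOn hx0 (F := fun s => cS s μ)
      ⟨iS μ 0 ⟨le_rfl, hx0.le⟩ x hxm, fun s _ => by simp [hcS]⟩ (hcSz μ) (hk.mul (hcont μ))
  -- The point 0 is left out because S(0, μ) = 0 for every μ; there `k` vanishes by continuity.
  have hIoc : ∀ t ∈ Ioc 0 x, k t = 0 := by
    intro t ht
    obtain ⟨μ, hμ⟩ := exists_slS_ne_zero hT hq ⟨ht.1.le, ht.2.trans hxT⟩ ht.1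
    exact (mul_eq_zero.1 (hkS μ t (Ioc_subset_Icc_self ht))).resolve_right hμ
  have := (show EqOn k (fun _ => 0) (Ioc 0 x) from hIoc).of_subset_closure hk continuousOn_const
    Ioc_subset_Icc_self (closure_Ioc hx0.ne).ge
  exact fun t ht => this ht

end Weyl

/-! ### The Cauchy kernel in the variable θ, and exchange of integrals. -/

section Resolvent

variable {τ : ℝ}

theorem norm_lt_norm_sq_of_le_im {lam θ : ℂ} (hτ : 0 < τ) (hlam : ‖lam‖ < τ ^ 2)
    (hθ : τ ≤ θ.im) : ‖lam‖ < ‖θ ^ 2‖ := by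
  have h1 : τ ≤ ‖θ‖ := hθ.trans ((le_abs_self _).trans (Complex.abs_im_le_norm θ))
  rw [norm_pow]
  exact hlam.trans_le (by gcongr)

theorem half_sq_le_norm_sub_sq {lam θ : ℂ} (h : 2 * ‖lam‖ ≤ ‖θ‖ ^ 2) :
    ‖θ‖ ^ 2 / 2 ≤ ‖lam - θ ^ 2‖ := by
  have := norm_sub_norm_le (θ ^ 2) lam
  rw [norm_sub_rev, norm_pow] at this
  linarith

theorem line_im (σ : ℝ) : ((σ : ℂ) + τ * Complex.I).im = τ := by simp

/-- Uses 2θ/(λ - θ²) = 2λ/(θ(λ - θ²)) - 2/θ: the first term decays like θ⁻³ and integrates to zero,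
the second is explicit. The bound on `lam` keeps the poles off the half-plane, where `‖θ ^ 2‖ ≥ τ ^
2`. -/
theorem tendsto_integral_line_resolvent (hτ : 0 < τ) {lam : ℂ} (hlam : ‖lam‖ < τ ^ 2) :
    Tendsto (fun R : ℝ => ∫ σ in (-R)..R,
      2 * ((σ : ℂ) + τ * Complex.I) / (lam - ((σ : ℂ) + τ * Complex.I) ^ 2)) atTop
      (𝓝 (2 * Real.pi * Complex.I)) := by
  have hne : ∀ θ : ℂ, τ ≤ θ.im → lam - θ ^ 2 ≠ 0 := fun θ hθ h => by
    have := norm_lt_norm_sq_of_le_im hτ hlam hθ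
    rw [sub_eq_zero.1 h] at this
    exact lt_irrefl _ this
  have hne0 : ∀ θ : ℂ, τ ≤ θ.im → θ ≠ 0 := fun θ hθ h => by
    rw [h] at hθ; exact absurd hθ (by simpa using hτ)
  have h1 := tendsto_integral_line_of_decay (f := fun θ => 2 * lam / (θ * (lam - θ ^ 2)))
    (τ := τ) (C := 4 * ‖lam‖) (R₀ := 1 + 2 * ‖lam‖)
    (fun z hz => (differentiableAt_const _).div (by fun_prop) (mul_ne_zero (hne0 z hz) (hne z hz)))
    (fun z hz hR => by
      have hz1 : 1 ≤ ‖z‖ := by linarith [norm_nonneg lam]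
      have h2 : 2 * ‖lam‖ ≤ ‖z‖ ^ 2 := by nlinarith [norm_nonneg lam]
      have h3 := half_sq_le_norm_sub_sq h2
      have h4 : 0 < ‖lam - z ^ 2‖ := norm_pos_iff.2 (hne z hz)
      rw [norm_div, norm_mul, norm_mul, RCLike.norm_ofNat]
      rw [div_le_div_iff₀ (by positivity) (by positivity)]
      calc 2 * ‖lam‖ * ‖z‖ ^ 2 = 4 * ‖lam‖ * (1 * (‖z‖ ^ 2 / 2)) := by ring
        _ ≤ _ := by gcongr) hτ
  have h2 := h1.sub (tendsto_integral_line_inv hτ)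
  rw [zero_sub, neg_neg] at h2
  refine h2.congr fun R => ?_
  have hc1 : Continuous fun σ : ℝ => 2 * lam / (((σ : ℂ) + τ * Complex.I) *
      (lam - ((σ : ℂ) + τ * Complex.I) ^ 2)) :=
    continuous_const.div (by fun_prop)
      (fun σ => mul_ne_zero (line_ne_zero hτ σ) (hne _ (line_im σ).ge))
  have hc2 : Continuous fun σ : ℝ => 2 / ((σ : ℂ) + τ * Complex.I) :=
    continuous_const.div (by fun_prop) (line_ne_zero hτ)
  rw [← intervalIntegral.integral_sub (hc1.intervalIntegrable _ _) (hc2.intervalIntegrable _ _)]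
  congr 1
  ext σ
  have n1 := line_ne_zero hτ σ
  have n2 := hne _ (line_im (τ := τ) σ).ge
  field_simp
  ring

end Resolvent

section Fubini

theorem intervalIntegral_integral_swap_of_bound {g : ℝ → ℝ → ℂ} {x : ℝ} (hx : 0 ≤ x) {β : ℝ → ℝ}
    (hg : ContinuousOn (Function.uncurry g) (Icc 0 x ×ˢ univ)) (hβ : Integrable β)
    (hb : ∀ t ∈ Icc 0 x, ∀ σ, ‖g t σ‖ ≤ β σ) :
    IntervalIntegrable (fun t => ∫ σ, g t σ) volume 0 x ∧
      Integrable (fun σ => ∫ t in (0 : ℝ)..x, g t σ) ∧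
      ∫ t in (0 : ℝ)..x, ∫ σ, g t σ = ∫ σ, ∫ t in (0 : ℝ)..x, g t σ := by
  have hi : Integrable (Function.uncurry g) ((volume.restrict (Ioc 0 x)).prod volume) := by
    have h1 : Integrable (fun z : ℝ × ℝ => (fun _ => (1 : ℝ)) z.1 * β z.2)
        ((volume.restrict (Ioc 0 x)).prod volume) :=
      Integrable.mul_prod (integrable_const 1) hβ
    have hmeq : (volume.restrict (Ioc 0 x)).prod (volume : Measure ℝ)
        = (volume : Measure (ℝ × ℝ)).restrict (Ioc 0 x ×ˢ univ) := by
      rw [Measure.volume_eq_prod, ← Measure.prod_restrict, Measure.restrict_univ]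
    refine h1.mono' ?_ ?_
    · rw [hmeq]
      exact (hg.mono (prod_mono Ioc_subset_Icc_self subset_rfl)).aestronglyMeasurable
        (measurableSet_Ioc.prod MeasurableSet.univ)
    · rw [hmeq]
      refine (ae_restrict_iff' (measurableSet_Ioc.prod MeasurableSet.univ)).2
        (Eventually.of_forall fun z hz => ?_)
      simpa [Function.uncurry] using hb z.1 (Ioc_subset_Icc_self hz.1) z.2
  refine ⟨?_, ?_, ?_⟩
  · rw [intervalIntegrable_iff_integrableOn_Ioc_of_le hx]
    exact hi.integral_prod_left
  · simp only [intervalIntegral.integral_of_le hx]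
    exact hi.integral_prod_right
  · simp only [intervalIntegral.integral_of_le hx]
    exact integral_integral_swap hi

end Fubini

/-! ### Convergence and continuity of integrals over the parabola. -/

/-- A family of entire functions which is `O(1/θ)` on the line `Im θ = τ`, where `λ = θ²`. -/
structure IsLineDecaying (T τ : ℝ) (f : ℝ → ℂ → ℂ) : Prop where
  entire : EntireFamily T f
  bound : ∃ C ≥ 0, ∀ σ : ℝ, ∀ t ∈ Icc 0 T,
    ‖f t (((σ : ℂ) + τ * Complex.I) ^ 2)‖ ≤ C / ‖(σ : ℂ) + τ * Complex.I‖

theorem isLineDecaying_slS {q : ℝ → ℝ} {T τ : ℝ} (hT : 0 ≤ T) (hτ : 0 < τ)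
    (hq : IntervalIntegrable q volume 0 T) : IsLineDecaying T τ (slS q T) := by
  have he := entireFamily_slS hT hq
  refine ⟨he, ?_⟩
  set F := freqThreshold q T with hF
  have hF1 : 1 ≤ F := one_le_freqThreshold hT
  obtain ⟨C, hC⟩ := he.bounded (F ^ 2)
  -- The first summand is the high-frequency bound; the second covers the bounded part of the line
  -- with `‖θ‖ ≤ F`, where only the bound on a disc is available.
  refine ⟨2 * Real.exp (τ * T) + F * |C|, by positivity, fun σ t ht => ?_⟩
  have him : ((σ : ℂ) + τ * Complex.I).im = τ := line_im σ
  have h0 : 0 < ‖(σ : ℂ) + τ * Complex.I‖ := norm_pos_iff.2 (line_ne_zero hτ σ)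
  set θ := (σ : ℂ) + τ * Complex.I
  rw [le_div_iff₀ h0]
  rcases le_total F ‖θ‖ with h | h
  · have h1 := norm_slS_le hT hq h ht
    rw [him, abs_of_pos hτ] at h1
    have h2 : Real.exp (τ * t) ≤ Real.exp (τ * T) := by
      gcongr
      exact ht.2
    calc _ ≤ (2 / ‖θ‖ * Real.exp (τ * t)) * ‖θ‖ := by gcongr
      _ = 2 * Real.exp (τ * t) := by field_simp
      _ ≤ 2 * Real.exp (τ * T) + F * |C| := by
          have : 0 ≤ F * |C| := by positivity
          linarith
  · have h1 := hC t ht (θ ^ 2) (by rw [norm_pow]; gcongr)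
    calc _ ≤ |C| * F := by
          gcongr
          exact h1.trans (le_abs_self C)
      _ ≤ _ := by
          have := Real.exp_pos (τ * T)
          linarith

/-- The integrand of a contour integral of `(M - M') f(x, ·) g(t, ·)` over the parabola. -/
noncomputable def parabolaIntegrand (f g : ℝ → ℂ → ℂ) (M M' : ℂ → ℂ) (τ x t σ : ℝ) : ℂ :=
  (M (((σ : ℂ) + τ * Complex.I) ^ 2) - M' (((σ : ℂ) + τ * Complex.I) ^ 2)) *
    f x (((σ : ℂ) + τ * Complex.I) ^ 2) * g t (((σ : ℂ) + τ * Complex.I) ^ 2) *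
    (2 * ((σ : ℂ) + τ * Complex.I))

/-- Two Weyl-type functions for two potentials on one edge that are close enough to each other. -/
structure IsWeylPair (q q' : ℝ → ℝ) (T τ : ℝ) (M M' : ℂ → ℂ) : Prop where
  left : IsDecayingWeyl q T τ M
  right : IsDecayingWeyl q' T τ M'
  wronskian : ∃ C ≥ 0, ∃ R, ∀ θ : ℂ, τ ≤ θ.im → R ≤ ‖θ‖ → ∀ x ∈ Icc 0 T,
    ‖weylSol q T M x (θ ^ 2) * weylSol' q' T M' x (θ ^ 2)
      - weylSol' q T M x (θ ^ 2) * weylSol q' T M' x (θ ^ 2)‖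
      ≤ C * (Real.exp (-(θ.im * x)) * Real.exp (-(θ.im * x)))
  integrable : Integrable fun σ : ℝ =>
    (M (((σ : ℂ) + τ * Complex.I) ^ 2) - M' (((σ : ℂ) + τ * Complex.I) ^ 2)) /
      ((σ : ℂ) + τ * Complex.I)

section Integrand

variable {T τ : ℝ} {f g : ℝ → ℂ → ℂ} {M M' : ℂ → ℂ} {q q' : ℝ → ℝ}

/-- The two families contribute `1 / θ` each and the Jacobian contributes `2 * θ`, which leaves the
integrable quotient (M - M')/θ. The majorant does not depend on `x` and `t`, so it serves dominated
convergence and Fubini as well. -/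
theorem exists_parabolaIntegrand_bound (hτ : 0 < τ) (hf : IsLineDecaying T τ f)
    (hg : IsLineDecaying T τ g) (W : IsWeylPair q q' T τ M M') :
    ∃ β : ℝ → ℝ, Integrable β ∧ ∀ x ∈ Icc 0 T, ∀ t ∈ Icc 0 T, ∀ σ,
      ‖parabolaIntegrand f g M M' τ x t σ‖ ≤ β σ := by
  obtain ⟨A, hA0, hA⟩ := hf.bound
  obtain ⟨B, hB0, hB⟩ := hg.bound
  refine ⟨_, W.integrable.norm.const_mul (2 * A * B), fun x hx t ht σ => ?_⟩
  have h0 : 0 < ‖(σ : ℂ) + τ * Complex.I‖ := norm_pos_iff.2 (line_ne_zero hτ σ)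
  have h1 := hA σ x hx
  have h2 := hB σ t ht
  rw [parabolaIntegrand, norm_mul, norm_mul, norm_mul, norm_mul, norm_div, RCLike.norm_ofNat]
  calc _ ≤ ‖M (((σ : ℂ) + τ * Complex.I) ^ 2) - M' (((σ : ℂ) + τ * Complex.I) ^ 2)‖ *
        (A / ‖(σ : ℂ) + τ * Complex.I‖) * (B / ‖(σ : ℂ) + τ * Complex.I‖) *
        (2 * ‖(σ : ℂ) + τ * Complex.I‖) := by gcongr
    _ = _ := by field_simp

theorem IsDecayingWeyl.continuous_line (W : IsDecayingWeyl q T τ M) :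
    Continuous fun σ : ℝ => M (((σ : ℂ) + τ * Complex.I) ^ 2) := by
  rw [continuous_iff_continuousAt]
  intro σ
  exact ContinuousAt.comp (g := M) (f := fun σ : ℝ => ((σ : ℂ) + τ * Complex.I) ^ 2)
    (W.differentiableAt _ (line_im σ).ge).continuousAt (by fun_prop)

theorem EntireFamily.continuousOn_comp (hf : EntireFamily T f) {X : Type*} [TopologicalSpace X]
    {s : Set X} {a : X → ℝ} {b : X → ℂ} (ha : ContinuousOn a s) (hb : ContinuousOn b s)
    (has : ∀ p ∈ s, a p ∈ Icc 0 T) : ContinuousOn (fun p => f (a p) (b p)) s :=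
  hf.continuousOn_prod.comp (ha.prodMk hb) fun p hp => ⟨has p hp, mem_univ _⟩

theorem continuousOn_parabolaIntegrand (hf : EntireFamily T f) (hg : EntireFamily T g)
    (W : IsWeylPair q q' T τ M M') {X : Type*} [TopologicalSpace X] {s : Set X} {a b c : X → ℝ}
    (ha : ContinuousOn a s) (hb : ContinuousOn b s) (hc : ContinuousOn c s)
    (has : ∀ p ∈ s, a p ∈ Icc 0 T) (hbs : ∀ p ∈ s, b p ∈ Icc 0 T) :
    ContinuousOn (fun p => parabolaIntegrand f g M M' τ (a p) (b p) (c p)) s := by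
  have hθ : ContinuousOn (fun p => ((c p : ℂ) + τ * Complex.I)) s := by fun_prop
  exact ((((W.left.continuous_line.comp_continuousOn hc).sub
    (W.right.continuous_line.comp_continuousOn hc)).mul
      (hf.continuousOn_comp ha (hθ.pow 2) has)).mul
      (hg.continuousOn_comp hb (hθ.pow 2) hbs)).mul (continuousOn_const.mul hθ)

theorem integrable_parabolaIntegrand (hτ : 0 < τ) (hf : IsLineDecaying T τ f)
    (hg : IsLineDecaying T τ g) (W : IsWeylPair q q' T τ M M') {x t : ℝ} (hx : x ∈ Icc 0 T)
    (ht : t ∈ Icc 0 T) : Integrable (parabolaIntegrand f g M M' τ x t) := by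
  obtain ⟨β, hβ, hb⟩ := exists_parabolaIntegrand_bound hτ hf hg W
  refine hβ.mono' ?_ (Eventually.of_forall fun σ => hb x hx t ht σ)
  have : ContinuousOn (fun σ : ℝ => parabolaIntegrand f g M M' τ x t σ) univ :=
    continuousOn_parabolaIntegrand hf.entire hg.entire W continuousOn_const continuousOn_const
      continuousOn_id (fun _ _ => hx) (fun _ _ => ht)
  exact (continuousOn_univ.1 this).aestronglyMeasurable

theorem continuousOn_integral_parabolaIntegrand (hτ : 0 < τ) (hf : IsLineDecaying T τ f)
    (hg : IsLineDecaying T τ g) (W : IsWeylPair q q' T τ M M') :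
    ContinuousOn (fun p : ℝ × ℝ => ∫ σ, parabolaIntegrand f g M M' τ p.1 p.2 σ)
      (Icc 0 T ×ˢ Icc 0 T) := by
  obtain ⟨β, hβ, hb⟩ := exists_parabolaIntegrand_bound hτ hf hg W
  refine continuousOn_of_dominated (bound := β)
    (fun p hp => (integrable_parabolaIntegrand hτ hf hg W hp.1 hp.2).aestronglyMeasurable)
    (fun p hp => Eventually.of_forall fun σ => hb _ hp.1 _ hp.2 σ) hβ
    (Eventually.of_forall fun σ => ?_)
  exact continuousOn_parabolaIntegrand hf.entire hg.entire W continuousOn_fst continuousOn_snd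
    continuousOn_const (fun p hp => hp.1) (fun p hp => hp.2)

end Integrand

/-! ### Decay of mixed Wronskians. -/

section Transformation

variable {T τ : ℝ} {M M' : ℂ → ℂ} {q q' : ℝ → ℝ}

theorem norm_slS_sub_slS_le (hT : 0 ≤ T) (hq : IntervalIntegrable q volume 0 T)
    (hq' : IntervalIntegrable q' volume 0 T) {ρ : ℂ} (hρ : freqThreshold q T ≤ ‖ρ‖)
    (hρ' : freqThreshold q' T ≤ ‖ρ‖) {x : ℝ} (hx : x ∈ Icc 0 T) :
    ‖slS q' T x (ρ ^ 2) - slS q T x (ρ ^ 2)‖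
      ≤ (freqThreshold q T + freqThreshold q' T) / ‖ρ‖ ^ 2 * Real.exp (|ρ.im| * x) := by
  have h1 := norm_slS_sub_sin_le hT hq hρ hx
  have h2 := norm_slS_sub_sin_le hT hq' hρ' hx
  have := norm_sub_le_norm_sub_add_norm_sub (slS q' T x (ρ ^ 2)) (Complex.sin (ρ * x) / ρ)
    (slS q T x (ρ ^ 2))
  rw [norm_sub_rev (Complex.sin (ρ * x) / ρ)] at this
  rw [add_div, add_mul]
  linarith

/-- Decay of the mixed Wronskians. -/
theorem IsWeylPair.exists_mixed_bound (hT : 0 ≤ T) (hτ : 0 < τ)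
    (hq : IntervalIntegrable q volume 0 T)
    (hq' : IntervalIntegrable q' volume 0 T) (W : IsWeylPair q q' T τ M M') {x : ℝ}
    (hx : x ∈ Icc 0 T) :
    ∃ C ≥ 0, ∃ R, ∀ θ : ℂ, τ ≤ θ.im → R ≤ ‖θ‖ →
      ‖slS q' T x (θ ^ 2) * weylSol' q T M x (θ ^ 2)
        - weylSol q' T M' x (θ ^ 2) * slS' q T x (θ ^ 2) + 1‖ ≤ C / ‖θ‖ ∧
      ‖slS q' T x (θ ^ 2) * weylSol q T M x (θ ^ 2)
        - weylSol q' T M' x (θ ^ 2) * slS q T x (θ ^ 2)‖ ≤ C / ‖θ‖ := by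
  obtain ⟨C₁, hC₁, R₁, h₁⟩ := W.left.bound
  obtain ⟨C₂, hC₂, R₂, h₂⟩ := W.right.bound
  obtain ⟨C₃, hC₃, R₃, h₃⟩ := W.wronskian
  set F := freqThreshold q T + freqThreshold q' T with hF
  have hF1 := one_le_freqThreshold (q := q) hT
  have hF2 := one_le_freqThreshold (q := q') hT
  set P := ∫ t in (0 : ℝ)..T, ‖(q t : ℂ) - q' t‖ with hP
  have hP0 : 0 ≤ P := intervalIntegral.integral_nonneg hT fun _ _ => norm_nonneg _
  have hqq : IntervalIntegrable (fun t => (q t : ℂ) - q' t) volume 0 T :=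
    IntervalIntegrable.sub (f := fun t => (q t : ℂ)) (g := fun t => (q' t : ℂ))
      ⟨hq.1.ofReal, hq.2.ofReal⟩ ⟨hq'.1.ofReal, hq'.2.ofReal⟩
  set D := 2 * P * C₁ * C₂ + 2 * C₃ with hD
  refine ⟨F * C₁ + 2 * D + 2 * (C₁ + C₂), by positivity, max F (max R₁ (max R₂ R₃)),
    fun θ him hθ => ?_⟩
  have hθF := (le_max_left _ _).trans hθ
  have hθ' := (le_max_right _ _).trans hθ
  have hθ1 := (le_max_left _ _).trans hθ'
  have hθ'' := (le_max_right _ _).trans hθ'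
  have hθ2 := (le_max_left _ _).trans hθ''
  have hθ3 := (le_max_right _ _).trans hθ''
  have hθq : freqThreshold q T ≤ ‖θ‖ := by linarith
  have hθq' : freqThreshold q' T ≤ ‖θ‖ := by linarith
  have hn : 0 < ‖θ‖ := by linarith
  have him0 : 0 ≤ θ.im := hτ.le.trans him
  have hexp : ∀ t : ℝ, Real.exp (-(θ.im * t)) * Real.exp (θ.im * t) = 1 := fun t => by
    rw [← Real.exp_add]; simp
  have hS : ∀ t ∈ Icc 0 T, ‖slS q T t (θ ^ 2)‖ ≤ 2 / ‖θ‖ * Real.exp (θ.im * t) := fun t ht => by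
    have := norm_slS_le hT hq hθq ht
    rwa [abs_of_nonneg him0] at this
  have hS'' : ‖slS q' T x (θ ^ 2)‖ ≤ 2 / ‖θ‖ * Real.exp (θ.im * x) := by
    have := norm_slS_le hT hq' hθq' hx
    rwa [abs_of_nonneg him0] at this
  have hS' : ‖slS' q T x (θ ^ 2)‖ ≤ 2 * Real.exp (θ.im * x) := by
    have := norm_slS'_le hT hq hθq hx
    rwa [abs_of_nonneg him0] at this
  have hd := norm_slS_sub_slS_le hT hq hq' hθq hθq' hx
  rw [abs_of_nonneg him0, ← hF] at hd
  -- the first mixed Wronskian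
  have hX : ‖weylSol q' T M' x (θ ^ 2) * slS' q T x (θ ^ 2)
      - weylSol' q' T M' x (θ ^ 2) * slS q T x (θ ^ 2) - 1‖ ≤ P * (2 * C₂ / ‖θ‖) := by
    have e := ((isSLSolution_weylSol (M := M') hT hq' (θ ^ 2)).lagrange hT hq' hq
      (isSLSolution_slS hT hq (θ ^ 2))).eq x hx
    simp only [slS_zero hT hq, slS'_zero hT hq, mul_zero, sub_zero, mul_one, weylSol,
      slC_zero hT hq', slS_zero hT hq', add_zero] at e
    -- By Lagrange's identity the Wronskian of Φ̃ and S changes from its value 1 at `x = 0` only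
    -- through `q - q'`. Under the integral the decay of Φ̃ cancels the growth of S and leaves the
    -- factor `1 / ‖θ‖` of S.
    have e' : weylSol q' T M' x (θ ^ 2) * slS' q T x (θ ^ 2)
        - weylSol' q' T M' x (θ ^ 2) * slS q T x (θ ^ 2) - 1
        = ∫ t in (0 : ℝ)..x, ((q t : ℂ) - q' t) *
          (weylSol q' T M' t (θ ^ 2) * slS q T t (θ ^ 2)) := by
      simp only [weylSol]
      rw [e, add_sub_cancel_left]
      congr 1
      ext t
      ring
    rw [e']
    refine norm_integral_mul_le le_rfl hx.1 hx.2 hqq (fun t ht => ?_) (by positivity)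
    have htT : t ∈ Icc 0 T := ⟨ht.1, ht.2.trans hx.2⟩
    rw [norm_mul]
    calc _ ≤ (C₂ * Real.exp (-(θ.im * t))) * (2 / ‖θ‖ * Real.exp (θ.im * t)) := by
          gcongr
          · exact (h₂ θ him hθ2 t htT).1
          · exact hS t htT
      _ = 2 * C₂ / ‖θ‖ * (Real.exp (-(θ.im * t)) * Real.exp (θ.im * t)) := by ring
      _ = _ := by rw [hexp, mul_one]
  have hΦ := (h₁ θ him hθ1 x hx)
  have hΦ' := (h₂ θ him hθ2 x hx).1
  have hZ := h₃ θ him hθ3 x hx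
  have hw : weylSol q T M x (θ ^ 2) * slS' q T x (θ ^ 2)
      - weylSol' q T M x (θ ^ 2) * slS q T x (θ ^ 2) = 1 := by
    have := slC_mul_slS'_sub hT hq (θ ^ 2) hx
    simp only [weylSol, weylSol']
    linear_combination this
  set S := slS q T x (θ ^ 2)
  set S₁ := slS' q T x (θ ^ 2)
  set St := slS q' T x (θ ^ 2)
  set Φ := weylSol q T M x (θ ^ 2)
  set Φ₁ := weylSol' q T M x (θ ^ 2)
  set Φt := weylSol q' T M' x (θ ^ 2)
  set Φt₁ := weylSol' q' T M' x (θ ^ 2)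
  have hee := hexp x
  set e := Real.exp (θ.im * x)
  set e' := Real.exp (-(θ.im * x))
  have he0 : 0 < e := Real.exp_pos _
  have he0' : 0 < e' := Real.exp_pos _
  -- Expanding Φ̃ in the basis Φ, S expresses Φ̃ - Φ through the Wronskian just estimated and the
  -- Wronskian of Φ and Φ̃; the double exponential decay of the latter outweighs the growth of S.
  have hδ : ‖Φt - Φ‖ ≤ D / ‖θ‖ * e' := by
    have e1 : Φt - Φ = Φ * (Φt * S₁ - Φt₁ * S - 1) + S * (Φ * Φt₁ - Φ₁ * Φt) := by
      linear_combination (-Φt) * hw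
    rw [e1]
    refine (norm_add_le _ _).trans ?_
    rw [norm_mul, norm_mul]
    calc _ ≤ (C₁ * e') * (P * (2 * C₂ / ‖θ‖)) + (2 / ‖θ‖ * e) * (C₃ * (e' * e')) := by
          gcongr
          · exact hΦ.1
          · exact hS x hx
      _ = (2 * P * C₁ * C₂) / ‖θ‖ * e' + 2 * C₃ / ‖θ‖ * e' * (e' * e) := by ring
      _ = _ := by rw [hee, hD]; ring
  constructor
  -- Without tildes the expression would be exactly zero, since the Wronskian of Φ and S is 1; only
  -- the small differences St - S and Φt - Φ remain.
  · have e1 : St * Φ₁ - Φt * S₁ + 1 = (St - S) * Φ₁ - (Φt - Φ) * S₁ := by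
      linear_combination -hw
    rw [e1]
    refine (norm_sub_le _ _).trans ?_
    rw [norm_mul, norm_mul]
    calc _ ≤ (F / ‖θ‖ ^ 2 * e) * (C₁ * ‖θ‖ * e') + (D / ‖θ‖ * e') * (2 * e) := by
          gcongr
          exact hΦ.2
      _ = (F * C₁ + 2 * D) / ‖θ‖ * (e' * e) := by field_simp
      _ ≤ _ := by
          rw [hee, mul_one]
          refine div_le_div_of_nonneg_right ?_ hn.le
          have : 0 ≤ 2 * (C₁ + C₂) := by positivity
          linarith
  · refine (norm_sub_le _ _).trans ?_
    rw [norm_mul, norm_mul]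
    calc _ ≤ (2 / ‖θ‖ * e) * (C₁ * e') + (C₂ * e') * (2 / ‖θ‖ * e) := by
          gcongr
          · exact hΦ.1
          · exact hS x hx
      _ = (2 * (C₁ + C₂)) / ‖θ‖ * (e' * e) := by ring
      _ ≤ _ := by
          rw [hee, mul_one]
          refine div_le_div_of_nonneg_right ?_ hn.le
          have : 0 ≤ F * C₁ + 2 * D := by positivity
          linarith

end Transformation

/-! ### The contour kernel, its uniqueness and the Gelfand-Levitan equation. -/

section Transformation

variable {T τ : ℝ} {M M' : ℂ → ℂ} {q q' : ℝ → ℝ}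

theorem EntireFamily.differentiable_comp_sq {f : ℝ → ℂ → ℂ} (hf : EntireFamily T f) {x : ℝ}
    (hx : x ∈ Icc 0 T) : Differentiable ℂ fun θ : ℂ => f x (θ ^ 2) :=
  (hf.differentiable x hx).comp (by fun_prop)

theorem IsDecayingWeyl.differentiableAt_comp_sq (W : IsDecayingWeyl q T τ M) {θ : ℂ}
    (hθ : τ ≤ θ.im) : DifferentiableAt ℂ (fun θ : ℂ => M (θ ^ 2)) θ :=
  DifferentiableAt.comp (g := M) (f := fun θ : ℂ => θ ^ 2) θ (W.differentiableAt θ hθ) (by fun_prop)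

theorem IsDecayingWeyl.differentiableAt_weylSol (W : IsDecayingWeyl q T τ M) (hT : 0 ≤ T)
    (hq : IntervalIntegrable q volume 0 T) {θ : ℂ} (hθ : τ ≤ θ.im) {x : ℝ} (hx : x ∈ Icc 0 T) :
    DifferentiableAt ℂ (fun θ : ℂ => weylSol q T M x (θ ^ 2)) θ ∧
      DifferentiableAt ℂ (fun θ : ℂ => weylSol' q T M x (θ ^ 2)) θ :=
  ⟨((entireFamily_slC hT hq).differentiable_comp_sq hx θ).add
      ((W.differentiableAt_comp_sq hθ).mul ((entireFamily_slS hT hq).differentiable_comp_sq hx θ)),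
    ((entireFamily_slC' hT hq).differentiable_comp_sq hx θ).add
      ((W.differentiableAt_comp_sq hθ).mul ((entireFamily_slS' hT hq).differentiable_comp_sq hx θ))⟩

/-- Written as a product rather than a quotient, so that `lam = μ` is no exception. -/
theorem mul_integral_slS_mul_slS (hT : 0 ≤ T) (hq : IntervalIntegrable q volume 0 T) (lam μ : ℂ)
    {x : ℝ} (hx : x ∈ Icc 0 T) :
    (lam - μ) * ∫ t in (0 : ℝ)..x, slS q T t lam * slS q T t μ
      = slS q T x lam * slS' q T x μ - slS' q T x lam * slS q T x μ := by
  have := ((isSLSolution_slS hT hq lam).lagrange hT hq hq (isSLSolution_slS hT hq μ)).eq x hx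
  simp only [slS_zero hT hq, mul_zero, zero_mul, sub_zero, zero_add] at this
  rw [this, ← intervalIntegral.integral_const_mul]
  congr 1
  ext t
  ring

theorem dslope_mul_eq (N : ℂ → ℂ) (lam μ : ℂ) : (μ - lam) * dslope N lam μ = N μ - N lam :=
  sub_smul_dslope N lam μ

theorem differentiable_dslope {N : ℂ → ℂ} (hN : Differentiable ℂ N) (lam : ℂ) :
    Differentiable ℂ (dslope N lam) := by
  rw [← differentiableOn_univ, Complex.differentiableOn_dslope univ_mem]
  exact hN.differentiableOn

/-- After division by 2πi this is the transformation formula for H. The integrand in σ splits into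
three parts: `F₁`, built from mixed Wronskians and removed by shifting the line upwards; `F₂`, odd
and entire; and (S̃(x,λ) - S(x,λ)) times the Cauchy kernel 2θ/(λ - θ²), which contributes the factor
2πi. -/
theorem slS_eq_add_integral_of_norm_lt (hT : 0 ≤ T) (hτ : 0 < τ)
    (hq : IntervalIntegrable q volume 0 T) (hq' : IntervalIntegrable q' volume 0 T)
    (W : IsWeylPair q q' T τ M M') {x : ℝ} (hx : x ∈ Icc 0 T) {lam : ℂ} (hlam : ‖lam‖ < τ ^ 2) :
    ∫ t in (0 : ℝ)..x, (∫ σ, parabolaIntegrand (slS q' T) (slS q T) M M' τ x t σ) * slS q T t lam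
      = 2 * Real.pi * Complex.I * (slS q' T x lam - slS q T x lam) := by
  have eS := entireFamily_slS hT hq
  have eS' := entireFamily_slS' hT hq
  have eC := entireFamily_slC hT hq
  have eC' := entireFamily_slC' hT hq
  have eSt := entireFamily_slS hT hq'
  have eCt := entireFamily_slC hT hq'
  have dS := isLineDecaying_slS hT hτ hq
  have dSt := isLineDecaying_slS hT hτ hq'
  obtain ⟨β, hβ, hb⟩ := exists_parabolaIntegrand_bound hτ dSt dS W
  obtain ⟨B, hB⟩ := eS.bounded ‖lam‖
  have hsub : Icc 0 x ⊆ Icc 0 T := Icc_subset_Icc_right hx.2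
  obtain ⟨-, hint, hswap⟩ := intervalIntegral_integral_swap_of_bound hx.1
    (g := fun t σ => parabolaIntegrand (slS q' T) (slS q T) M M' τ x t σ * slS q T t lam)
    (β := fun σ => β σ * B)
    ((continuousOn_parabolaIntegrand eSt eS W (a := fun _ => x) (b := Prod.fst) (c := Prod.snd)
      continuousOn_const continuousOn_fst continuousOn_snd (fun p _ => hx)
      (fun p hp => hsub hp.1)).mul (eS.continuousOn_comp continuousOn_fst
        (continuousOn_const (c := lam)) (fun p hp => hsub hp.1)))
    (hβ.mul_const B) (fun t ht σ => by
      rw [norm_mul]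
      have h1 := hb x hx t (hsub ht) σ
      exact mul_le_mul h1 (hB t (hsub ht) lam le_rfl) (norm_nonneg _)
        ((norm_nonneg _).trans h1))
  simp only [integral_mul_const] at hswap
  rw [hswap]
  -- The whole integral converges absolutely, so it is the limit of symmetric ones. This form is
  -- needed because `F₂` and the Cauchy kernel are only controlled as `O(1 / θ)`.
  have hlim := intervalIntegral_tendsto_integral hint tendsto_neg_atTop_atBot tendsto_id
  refine tendsto_nhds_unique hlim ?_
  set Sl := slS q T x lam with hSl
  set Sl' := slS' q T x lam with hSl'
  -- The part left when M S and M̃ S̃ are replaced by Φ - C and Φ̃ - C̃. It contains no Weyl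
  -- function, hence is entire, and at `μ = lam` the Wronskian relation reduces it to S̃(x,λ).
  set N : ℂ → ℂ := fun μ => -Sl * (slC' q T x μ * slS q' T x μ - slC q' T x μ * slS' q T x μ)
    + Sl' * (slC q T x μ * slS q' T x μ - slC q' T x μ * slS q T x μ) with hN
  have hNd : Differentiable ℂ N :=
    ((((eC'.differentiable x hx).mul (eSt.differentiable x hx)).sub
      ((eCt.differentiable x hx).mul (eS'.differentiable x hx))).const_mul _).add
    ((((eC.differentiable x hx).mul (eSt.differentiable x hx)).sub
      ((eCt.differentiable x hx).mul (eS.differentiable x hx))).const_mul _)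
  have hNlam : N lam = slS q' T x lam := by
    have := slC_mul_slS'_sub hT hq lam hx
    simp only [hN, hSl, hSl']
    linear_combination slS q' T x lam * this
  have hne : ∀ θ : ℂ, τ ≤ θ.im → lam - θ ^ 2 ≠ 0 := fun θ hθ h => by
    have := norm_lt_norm_sq_of_le_im hτ hlam hθ
    rw [sub_eq_zero.1 h] at this
    exact lt_irrefl _ this
  -- the part decaying in the upper half-plane
  set Q : ℂ → ℂ := fun θ => slS q' T x (θ ^ 2) * weylSol' q T M x (θ ^ 2)
        - weylSol q' T M' x (θ ^ 2) * slS' q T x (θ ^ 2) + 1 with hQ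
  set Q₂ : ℂ → ℂ := fun θ => slS q' T x (θ ^ 2) * weylSol q T M x (θ ^ 2)
        - weylSol q' T M' x (θ ^ 2) * slS q T x (θ ^ 2) with hQ₂
  set F₁ : ℂ → ℂ := fun θ => (Sl * Q θ - Sl' * Q₂ θ) * (2 * θ / (lam - θ ^ 2)) with hF₁
  have hF₁d : ∀ θ : ℂ, τ ≤ θ.im → DifferentiableAt ℂ F₁ θ := by
    intro θ hθ
    have d1 := W.left.differentiableAt_weylSol hT hq hθ hx
    have d2 := W.right.differentiableAt_weylSol hT hq' hθ hx
    have d3 := eSt.differentiable_comp_sq hx θ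
    have d4 := eS.differentiable_comp_sq hx θ
    have d5 := eS'.differentiable_comp_sq hx θ
    exact (((((d3.mul d1.2).sub (d2.1.mul d5)).add_const 1).const_mul Sl).sub
      (((d3.mul d1.1).sub (d2.1.mul d4)).const_mul Sl')).mul
      (DifferentiableAt.div (by fun_prop) (by fun_prop) (hne θ hθ))
  have hker : ∀ θ : ℂ, 1 + 2 * ‖lam‖ ≤ ‖θ‖ → ‖2 * θ / (lam - θ ^ 2)‖ ≤ 4 / ‖θ‖ := by
    intro θ hθ
    have hz1 : 1 ≤ ‖θ‖ := by linarith [norm_nonneg lam]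
    have h2 : 2 * ‖lam‖ ≤ ‖θ‖ ^ 2 := by nlinarith [norm_nonneg lam]
    have h3 := half_sq_le_norm_sub_sq h2
    have h4 : 0 < ‖lam - θ ^ 2‖ := lt_of_lt_of_le (by positivity) h3
    rw [norm_div, norm_mul, RCLike.norm_ofNat, div_le_div_iff₀ h4 (by positivity)]
    nlinarith
  obtain ⟨C, hC0, R, hC⟩ := W.exists_mixed_bound hT hτ hq hq' hx
  have lim₁ := tendsto_integral_line_of_decay (f := F₁) (τ := τ)
    (C := (‖Sl‖ + ‖Sl'‖) * C * 4) (R₀ := max R (1 + 2 * ‖lam‖)) hF₁d (fun θ hθ hR => by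
      have h1 := hC θ hθ ((le_max_left _ _).trans hR)
      have h2 := hker θ ((le_max_right _ _).trans hR)
      rw [hF₁, norm_mul]
      calc _ ≤ (‖Sl‖ * (C / ‖θ‖) + ‖Sl'‖ * (C / ‖θ‖)) * (4 / ‖θ‖) := by
            gcongr
            refine (norm_sub_le _ _).trans ?_
            rw [norm_mul, norm_mul]
            gcongr
            · exact h1.1
            · exact h1.2
        _ = _ := by ring) hτ
  -- the odd entire part
  set F₂ : ℂ → ℂ := fun θ => -(2 * θ * dslope N lam (θ ^ 2)) with hF₂
  have hF₂d : Differentiable ℂ F₂ :=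
    (Differentiable.mul (by fun_prop) ((differentiable_dslope hNd lam).comp
      (by fun_prop : Differentiable ℂ fun θ : ℂ => θ ^ 2))).neg
  set E := Real.exp (τ * T) with hE
  have hE0 : 0 < E := Real.exp_pos _
  have lim₂ := tendsto_integral_line_of_odd (f := F₂) (τ := τ)
    (C := ((‖Sl‖ + ‖Sl'‖) * (8 * (E * E)) + ‖N lam‖) * 4)
    (R₀ := max (1 + 2 * ‖lam‖) (max (freqThreshold q T) (freqThreshold q' T)))
    hF₂d (fun θ => by simp only [hF₂, neg_sq]; ring) hτ (fun θ hθ hR => by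
      have hRk := (le_max_left _ _).trans hR
      have hR' := (le_max_right _ _).trans hR
      have hRq := (le_max_left _ _).trans hR'
      have hRq' := (le_max_right _ _).trans hR'
      have hz1 : 1 ≤ ‖θ‖ := by linarith [norm_nonneg lam]
      have hz0 : 0 < ‖θ‖ := by linarith
      have hexp : Real.exp (|θ.im| * x) ≤ E := by
        apply Real.exp_le_exp.2
        exact mul_le_mul hθ hx.2 hx.1 hτ.le
      have bS := (norm_slS_le hT hq hRq hx).trans (mul_le_mul_of_nonneg_left hexp (by positivity))
      have bS' := (norm_slS'_le hT hq hRq hx).trans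
        (mul_le_mul_of_nonneg_left hexp (by positivity))
      have bC := (norm_slC_le hT hq hRq hx).trans (mul_le_mul_of_nonneg_left hexp (by positivity))
      have bC' := (norm_slC'_le hT hq hRq hx).trans
        (mul_le_mul_of_nonneg_left hexp (by positivity))
      have bSt := (norm_slS_le hT hq' hRq' hx).trans
        (mul_le_mul_of_nonneg_left hexp (by positivity))
      have bCt := (norm_slC_le hT hq' hRq' hx).trans
        (mul_le_mul_of_nonneg_left hexp (by positivity))
      have hle : 2 / ‖θ‖ ≤ 2 := by
        rw [div_le_iff₀ hz0]; linarith
      -- In the strip all exponentials are bounded by `E`, and the growth `‖θ‖` of C' is offset by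
      -- the factor `1 / ‖θ‖` of S̃.
      have hNb : ‖N (θ ^ 2)‖ ≤ (‖Sl‖ + ‖Sl'‖) * (8 * (E * E)) := by
        have n1 : ‖slC' q T x (θ ^ 2) * slS q' T x (θ ^ 2)
            - slC q' T x (θ ^ 2) * slS' q T x (θ ^ 2)‖ ≤ 8 * (E * E) := by
          refine (norm_sub_le _ _).trans ?_
          rw [norm_mul, norm_mul]
          calc _ ≤ (2 * ‖θ‖ * E) * (2 / ‖θ‖ * E) + (2 * E) * (2 * E) := by gcongr
            _ = 8 * (E * E) := by field_simp; ring
        have n2 : ‖slC q T x (θ ^ 2) * slS q' T x (θ ^ 2)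
            - slC q' T x (θ ^ 2) * slS q T x (θ ^ 2)‖ ≤ 8 * (E * E) := by
          refine (norm_sub_le _ _).trans ?_
          rw [norm_mul, norm_mul]
          calc _ ≤ (2 * E) * (2 / ‖θ‖ * E) + (2 * E) * (2 / ‖θ‖ * E) := by gcongr
            _ ≤ (2 * E) * (2 * E) + (2 * E) * (2 * E) := by gcongr
            _ = 8 * (E * E) := by ring
        refine (norm_add_le _ _).trans ?_
        rw [norm_mul, norm_mul, norm_neg, add_mul]
        gcongr
      have hk := hker θ hRk
      have hne' : lam - θ ^ 2 ≠ 0 := by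
        rw [← norm_pos_iff]
        exact lt_of_lt_of_le (by positivity) (half_sq_le_norm_sub_sq (lam := lam) (θ := θ)
          (by nlinarith [norm_nonneg lam]))
      have e : F₂ θ = (N (θ ^ 2) - N lam) * (2 * θ / (lam - θ ^ 2)) := by
        rw [← dslope_mul_eq]
        simp only [hF₂]
        field_simp
        ring
      rw [e, norm_mul]
      calc _ ≤ ((‖Sl‖ + ‖Sl'‖) * (8 * (E * E)) + ‖N lam‖) * (4 / ‖θ‖) := by
            gcongr
            exact (norm_sub_le _ _).trans (by gcongr)
        _ = _ := by ring)
  have lim₃ := (tendsto_integral_line_resolvent hτ hlam).const_mul (slS q' T x lam - Sl)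
  have hlim' := (lim₁.add lim₂).add lim₃
  rw [zero_add, zero_add, mul_comm (slS q' T x lam - Sl)] at hlim'
  refine hlim'.congr fun R => ?_
  have c₁ : Continuous fun σ : ℝ => F₁ (σ + τ * Complex.I) := by
    rw [continuous_iff_continuousAt]
    intro σ
    exact ContinuousAt.comp (g := F₁) (f := fun σ : ℝ => (σ : ℂ) + τ * Complex.I)
      (hF₁d _ (line_im σ).ge).continuousAt (by fun_prop)
  have c₂ : Continuous fun σ : ℝ => F₂ (σ + τ * Complex.I) :=
    hF₂d.continuous.comp (by fun_prop)
  have c₃ : Continuous fun σ : ℝ => 2 * ((σ : ℂ) + τ * Complex.I) /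
      (lam - ((σ : ℂ) + τ * Complex.I) ^ 2) :=
    Continuous.div (by fun_prop) (by fun_prop) (fun σ => hne _ (line_im σ).ge)
  rw [← intervalIntegral.integral_const_mul, ← intervalIntegral.integral_add
    (c₁.intervalIntegrable _ _) (c₂.intervalIntegrable _ _), ← intervalIntegral.integral_add
    (f := fun σ : ℝ => F₁ ((σ : ℂ) + τ * Complex.I) + F₂ ((σ : ℂ) + τ * Complex.I))
    (g := fun σ : ℝ => (slS q' T x lam - Sl) *
      (2 * ((σ : ℂ) + τ * Complex.I) / (lam - ((σ : ℂ) + τ * Complex.I) ^ 2)))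
    ((c₁.add c₂).intervalIntegrable _ _) ((continuous_const.mul c₃).intervalIntegrable _ _)]
  congr 1
  ext σ
  have hv : ∫ t in (0 : ℝ)..x, parabolaIntegrand (slS q' T) (slS q T) M M' τ x t σ * slS q T t lam
      = (M (((σ : ℂ) + τ * Complex.I) ^ 2) - M' (((σ : ℂ) + τ * Complex.I) ^ 2)) *
        slS q' T x (((σ : ℂ) + τ * Complex.I) ^ 2) * (2 * ((σ : ℂ) + τ * Complex.I)) *
        ∫ t in (0 : ℝ)..x, slS q T t lam * slS q T t (((σ : ℂ) + τ * Complex.I) ^ 2) := by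
    rw [← intervalIntegral.integral_const_mul]
    congr 1
    ext t
    rw [parabolaIntegrand]
    ring
  rw [hv]
  have hθ := hne _ (line_im (τ := τ) σ).ge
  set θ := (σ : ℂ) + τ * Complex.I
  have hV := mul_integral_slS_mul_slS hT hq lam (θ ^ 2) hx
  set V := ∫ t in (0 : ℝ)..x, slS q T t lam * slS q T t (θ ^ 2)
  have hds := dslope_mul_eq N lam (θ ^ 2)
  rw [hNlam] at hds
  have e2 : F₂ θ = (N (θ ^ 2) - slS q' T x lam) * (2 * θ / (lam - θ ^ 2)) := by
    rw [← hds]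
    simp only [hF₂]
    field_simp
    ring
  have e3 : V = (Sl * slS' q T x (θ ^ 2) - Sl' * slS q T x (θ ^ 2)) / (lam - θ ^ 2) := by
    rw [eq_div_iff hθ, mul_comm, hV]
  rw [e2, e3]
  simp only [hF₁, hQ, hQ₂, hN, weylSol, weylSol']
  field_simp
  ring

/-- The kernel of the transformation operator as a contour integral. -/
noncomputable def contourKernel (q q' : ℝ → ℝ) (T : ℝ) (M M' : ℂ → ℂ) (τ x t : ℝ) : ℂ :=
  (1 / (2 * Real.pi * Complex.I)) *
    ∫ σ, parabolaIntegrand (slS q' T) (slS q T) M M' τ x t σ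

theorem continuousOn_contourKernel (hT : 0 ≤ T) (hτ : 0 < τ)
    (hq : IntervalIntegrable q volume 0 T) (hq' : IntervalIntegrable q' volume 0 T)
    (W : IsWeylPair q q' T τ M M') :
    ContinuousOn (fun p : ℝ × ℝ => contourKernel q q' T M M' τ p.1 p.2) (Icc 0 T ×ˢ Icc 0 T) :=
  continuousOn_const.mul (continuousOn_integral_parabolaIntegrand hτ (isLineDecaying_slS hT hτ hq')
    (isLineDecaying_slS hT hτ hq) W)

theorem continuousOn_contourKernel_right (hT : 0 ≤ T) (hτ : 0 < τ)
    (hq : IntervalIntegrable q volume 0 T) (hq' : IntervalIntegrable q' volume 0 T)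
    (W : IsWeylPair q q' T τ M M') {x : ℝ} (hx : x ∈ Icc 0 T) :
    ContinuousOn (contourKernel q q' T M M' τ x) (Icc 0 T) :=
  (continuousOn_contourKernel hT hτ hq hq' W).comp (f := fun t => (x, t)) (by fun_prop)
    (fun _ ht => ⟨hx, ht⟩)

/-- The identity holds for `‖lam‖ < τ ^ 2` and both sides are entire in `lam`, so the identity
theorem extends it. -/
theorem isTransformationKernel_contourKernel (hT : 0 ≤ T) (hτ : 0 < τ)
    (hq : IntervalIntegrable q volume 0 T) (hq' : IntervalIntegrable q' volume 0 T)
    (W : IsWeylPair q q' T τ M M') :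
    IsTransformationKernel T q q' (contourKernel q q' T M M' τ) := by
  refine ⟨(continuousOn_contourKernel hT hτ hq hq' W).mono fun p hp =>
    ⟨⟨hp.1.trans hp.2.1, hp.2.2⟩, ⟨hp.1, hp.2.1.trans hp.2.2⟩⟩, fun x hx lam => ?_⟩
  have hpi : (2 * Real.pi * Complex.I : ℂ) ≠ 0 := by simp [Real.pi_ne_zero]
  have hsmall : ∀ lam : ℂ, ‖lam‖ < τ ^ 2 → slS q' T x lam = slS q T x lam
      + ∫ t in (0 : ℝ)..x, contourKernel q q' T M M' τ x t * slS q T t lam := by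
    intro lam hlam
    have := slS_eq_add_integral_of_norm_lt hT hτ hq hq' W hx hlam
    simp only [contourKernel, mul_assoc (1 / (2 * Real.pi * Complex.I) : ℂ)]
    rw [intervalIntegral.integral_const_mul, this]
    field_simp
    ring
  have hw : IntervalIntegrable (contourKernel q q' T M M' τ x) volume 0 x :=
    ContinuousOn.intervalIntegrable ((continuousOn_contourKernel_right hT hτ hq hq' W hx).mono (by
      rw [uIcc_of_le hx.1]; exact Icc_subset_Icc_right hx.2))
  have d1 := (entireFamily_slS hT hq').differentiable x hx
  have d2 := ((entireFamily_slS hT hq).differentiable x hx).add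
    ((entireFamily_slS hT hq).differentiable_integral hx hw)
  have := AnalyticOnNhd.eq_of_eventuallyEq (𝕜 := ℂ) (z₀ := (0 : ℂ))
    (fun z _ => d1.analyticAt z) (fun z _ => d2.analyticAt z) (by
      filter_upwards [Metric.ball_mem_nhds (0 : ℂ) (by positivity : 0 < τ ^ 2)] with lam hlam
      exact hsmall lam (mem_ball_zero_iff.1 hlam))
  exact congrFun this lam

/-- The transformation kernel is unique. -/
theorem IsTransformationKernel.eq_contourKernel (hT : 0 < T) (hτ : 0 < τ)
    (hq : IntervalIntegrable q volume 0 T) (hq' : IntervalIntegrable q' volume 0 T)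
    (W : IsWeylPair q q' T τ M M') {K : ℝ → ℝ → ℂ} (hK : IsTransformationKernel T q q' K) {x t : ℝ}
    (hx : x ∈ Icc 0 T) (ht : t ∈ Icc 0 x) : K x t = contourKernel q q' T M M' τ x t := by
  have hH := isTransformationKernel_contourKernel hT.le hτ hq hq' W
  have hcont : ∀ {K : ℝ → ℝ → ℂ}, IsTransformationKernel T q q' K → ∀ x ∈ Icc 0 T,
      ContinuousOn (K x) (Icc 0 x) := fun {K} hK x hx =>
    hK.1.comp (f := fun t => (x, t)) (by fun_prop) (fun t ht => ⟨ht.1, ht.2, hx.2⟩)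
  have hpos : ∀ x, 0 < x → x ≤ T → ∀ t ∈ Icc 0 x, K x t = contourKernel q q' T M M' τ x t := by
    intro x hx0 hxT t ht
    have hx : x ∈ Icc 0 T := ⟨hx0.le, hxT⟩
    have c1 := hcont hK x hx
    have c2 := hcont hH x hx
    have cS : ∀ lam, ContinuousOn (fun t => slS q T t lam) (Icc 0 x) := fun lam =>
      ((entireFamily_slS hT.le hq).continuousOn lam).mono (Icc_subset_Icc_right hxT)
    have hI : ∀ {k : ℝ → ℂ}, ContinuousOn k (Icc 0 x) → ∀ lam,
        IntervalIntegrable (fun t => k t * slS q T t lam) volume 0 x := fun {k} hk lam =>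
      ContinuousOn.intervalIntegrable (by rw [uIcc_of_le hx0.le]; exact hk.mul (cS lam))
    have := eq_zero_of_integral_mul_slS_eq_zero hq W.left hτ hx0 hxT (c1.sub c2) (fun lam => by
      have e1 := hK.2 x hx lam
      have e2 := hH.2 x hx lam
      simp only [Pi.sub_apply, sub_mul]
      rw [intervalIntegral.integral_sub (hI c1 lam) (hI c2 lam)]
      linear_combination e2 - e1) t ht
    exact sub_eq_zero.1 this
  -- At `x = 0` the transformation formula says nothing about K(0,0); that value is obtained by
  -- continuity along `t = 0` from positive `x`.
  rcases hx.1.eq_or_lt with rfl | hx0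
  · have ht0 : t = 0 := le_antisymm ht.2 ht.1
    subst ht0
    have hdiag : ∀ {K : ℝ → ℝ → ℂ}, IsTransformationKernel T q q' K →
        ContinuousOn (fun x => K x 0) (Icc 0 T) := fun {K} hK =>
      hK.1.comp (f := fun x => (x, (0 : ℝ))) (by fun_prop) (fun x hx => ⟨le_rfl, hx.1, hx.2⟩)
    have := (show EqOn (fun x => K x 0) (fun x => contourKernel q q' T M M' τ x 0) (Ioc 0 T) from
      fun x hx => hpos x hx.1 hx.2 0 ⟨le_rfl, hx.1.le⟩).of_subset_closure (hdiag hK) (hdiag hH)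
      Ioc_subset_Icc_self (closure_Ioc hT.ne).ge
    exact this hx
  · exact hpos x hx0 hx.2 t ht

/-- The Gelfand-Levitan equation for the kernel of the transformation operator. -/
theorem IsTransformationKernel.gelfandLevitan (hT : 0 < T) (hτ : 0 < τ)
    (hq : IntervalIntegrable q volume 0 T) (hq' : IntervalIntegrable q' volume 0 T)
    (W : IsWeylPair q q' T τ M M') {K : ℝ → ℝ → ℂ} (hK : IsTransformationKernel T q q' K) {x t : ℝ}
    (hx : x ∈ Icc 0 T) (ht : t ∈ Icc 0 x) {F : ℝ → ℝ → ℂ}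
    (hF : ∀ x t, F x t = -(1 / (2 * Real.pi * Complex.I)) *
      ∫ σ, parabolaIntegrand (slS q T) (slS q T) M M' τ x t σ) :
    IntervalIntegrable (fun s => K x s * F s t) volume 0 x ∧
      K x t + F x t + ∫ s in (0 : ℝ)..x, K x s * F s t = 0 := by
  have htT : t ∈ Icc 0 T := ⟨ht.1, ht.2.trans hx.2⟩
  have hsub : Icc 0 x ⊆ Icc 0 T := Icc_subset_Icc_right hx.2
  have eS := entireFamily_slS hT.le hq
  have dS := isLineDecaying_slS hT.le hτ hq
  obtain ⟨β, hβ, hb⟩ := exists_parabolaIntegrand_bound hτ dS dS W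
  have cK : ContinuousOn (K x) (Icc 0 x) :=
    hK.1.comp (f := fun t => (x, t)) (by fun_prop) (fun t ht => ⟨ht.1, ht.2, hx.2⟩)
  obtain ⟨B, hB⟩ := isCompact_Icc.exists_bound_of_continuousOn cK
  obtain ⟨i1, i2, hswap⟩ := intervalIntegral_integral_swap_of_bound hx.1
    (g := fun s σ => K x s * parabolaIntegrand (slS q T) (slS q T) M M' τ s t σ)
    (β := fun σ => B * β σ)
    ((cK.comp continuousOn_fst (fun p hp => hp.1)).mul
      (continuousOn_parabolaIntegrand eS eS W (a := Prod.fst) (b := fun _ => t) (c := Prod.snd)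
      continuousOn_fst continuousOn_const continuousOn_snd (fun p hp => hsub hp.1)
      (fun p _ => htT)))
    (hβ.const_mul B) (fun s hs σ => by
      rw [norm_mul]
      have h1 := hb s (hsub hs) t htT σ
      exact mul_le_mul (hB s hs) h1 (norm_nonneg _) ((norm_nonneg _).trans (hB s hs)))
  simp only [integral_const_mul] at i1 hswap
  have hfun : (fun s => K x s * F s t) = fun s => -(1 / (2 * Real.pi * Complex.I)) *
      (K x s * ∫ σ, parabolaIntegrand (slS q T) (slS q T) M M' τ s t σ) := by
    ext s
    rw [hF]
    ring
  rw [hfun]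
  refine ⟨i1.const_mul _, ?_⟩
  rw [intervalIntegral.integral_const_mul, hswap, hF, hK.eq_contourKernel hT hτ hq hq' W hx ht,
    contourKernel]
  -- The transformation formula is inserted for S̃(x,·) inside the contour kernel; the `K` term is
  -- then the exchanged double integral.
  have hsum : ∫ σ, parabolaIntegrand (slS q' T) (slS q T) M M' τ x t σ
      = (∫ σ, parabolaIntegrand (slS q T) (slS q T) M M' τ x t σ) +
        ∫ σ, ∫ s in (0 : ℝ)..x, K x s * parabolaIntegrand (slS q T) (slS q T) M M' τ s t σ := by
    rw [← integral_add (integrable_parabolaIntegrand hτ dS dS W hx htT) i2]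
    congr 1
    ext σ
    simp only [parabolaIntegrand]
    rw [hK.2 x hx]
    have e : ∫ s in (0 : ℝ)..x, K x s *
        ((M (((σ : ℂ) + τ * Complex.I) ^ 2) - M' (((σ : ℂ) + τ * Complex.I) ^ 2)) *
          slS q T s (((σ : ℂ) + τ * Complex.I) ^ 2) * slS q T t (((σ : ℂ) + τ * Complex.I) ^ 2) *
          (2 * ((σ : ℂ) + τ * Complex.I)))
        = ((M (((σ : ℂ) + τ * Complex.I) ^ 2) - M' (((σ : ℂ) + τ * Complex.I) ^ 2)) *
          slS q T t (((σ : ℂ) + τ * Complex.I) ^ 2) * (2 * ((σ : ℂ) + τ * Complex.I))) *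
          ∫ s in (0 : ℝ)..x, K x s * slS q T s (((σ : ℂ) + τ * Complex.I) ^ 2) := by
      rw [← intervalIntegral.integral_const_mul]
      congr 1
      ext s
      ring
    rw [e]
    ring
  rw [hsum]
  ring

end Transformation

/-! ### Linear algebra at the internal vertex. -/

section GraphAlgebra

variable {m : ℕ} {T : Fin (m + 1) → ℝ} {a : ℝ} {q : Fin (m + 1) → ℝ → ℝ} {lam : ℂ}

/-- A solution of the Sturm-Liouville system on the graph that satisfies the matching conditions
at the internal vertex. -/
structure IsGraphSolution (T : Fin (m + 1) → ℝ) (a : ℝ) (q : Fin (m + 1) → ℝ → ℝ) (lam : ℂ)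
    (y z : Fin (m + 1) → ℝ → ℂ) : Prop where
  sol : ∀ i, IsSLSolution (q i) (T i) lam (y i) (z i)
  loop : y 0 0 = a * y 0 (T 0)
  edge : ∀ j : Fin m, a * y 0 (T 0) = y j.succ (T j.succ)
  kirchhoff : z 0 0 = (a : ℂ)⁻¹ * z 0 (T 0) + ∑ j : Fin m, z j.succ (T j.succ)

/-- The combination of fundamental solutions with coefficients `c, p` on the loop and given
functions on the boundary edges. -/
theorem isGraphSolution_cons (hT : ∀ i, 0 < T i)
    (hq : ∀ i, IntervalIntegrable (q i) volume 0 (T i)) {c p : ℂ} {y z : Fin m → ℝ → ℂ}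
    (hyz : ∀ j, IsSLSolution (q j.succ) (T j.succ) lam (y j) (z j))
    (hloop : c = a * (c * slC (q 0) (T 0) (T 0) lam + p * slS (q 0) (T 0) (T 0) lam))
    (hedge : ∀ j, c = y j (T j.succ))
    (hk : p = (a : ℂ)⁻¹ * (c * slC' (q 0) (T 0) (T 0) lam + p * slS' (q 0) (T 0) (T 0) lam)
      + ∑ j, z j (T j.succ)) :
    IsGraphSolution T a q lam
      (Fin.cons (fun x => c * slC (q 0) (T 0) x lam + p * slS (q 0) (T 0) x lam) y)
      (Fin.cons (fun x => c * slC' (q 0) (T 0) x lam + p * slS' (q 0) (T 0) x lam) z) where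
  sol i := by
    refine Fin.cases ?_ (fun j => ?_) i
    · exact ((isSLSolution_slC (hT 0).le (hq 0) lam).const_mul (hT 0).le (hq 0) c).add (hT 0).le
        (hq 0) ((isSLSolution_slS (hT 0).le (hq 0) lam).const_mul (hT 0).le (hq 0) p)
    · exact hyz j
  loop := by
    simp only [Fin.cons_zero]
    rw [← hloop, slC_zero (hT 0).le (hq 0), slS_zero (hT 0).le (hq 0)]
    ring
  edge j := by
    simp only [Fin.cons_zero, Fin.cons_succ]
    rw [← hloop, hedge j]
  kirchhoff := by
    simp only [Fin.cons_zero, Fin.cons_succ]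
    rw [← hk, slC'_zero (hT 0).le (hq 0), slS'_zero (hT 0).le (hq 0)]
    ring

/-- Reduces the eigenvalue problem to a linear system: `c` is the vertex value y_0(0), `p` is
y_0'(0) and `b j` is the initial slope on the boundary edge `j`. Nontriviality can be read off these
initial data. -/
theorem isGraphEigenvalue_of_coeff (hT : ∀ i, 0 < T i)
    (hq : ∀ i, IntervalIntegrable (q i) volume 0 (T i)) {c p : ℂ} {b : Fin m → ℂ}
    (hloop : c = a * (c * slC (q 0) (T 0) (T 0) lam + p * loopH T q lam))
    (hedge : ∀ j, c = b j * endS T q j lam)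
    (hk : p = (a : ℂ)⁻¹ * (c * slC' (q 0) (T 0) (T 0) lam + p * slS' (q 0) (T 0) (T 0) lam)
      + ∑ j, b j * endS' T q j lam)
    (hne : c ≠ 0 ∨ p ≠ 0 ∨ ∃ j, b j ≠ 0) : IsGraphEigenvalue T a q lam := by
  have hsol := isGraphSolution_cons (a := a) (lam := lam) hT hq (c := c) (p := p)
    (y := fun j x => b j * slS (q j.succ) (T j.succ) x lam)
    (z := fun j x => b j * slS' (q j.succ) (T j.succ) x lam)
    (fun j => (isSLSolution_slS (hT _).le (hq _) lam).const_mul (hT _).le (hq _) (b j))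
    hloop hedge hk
  refine ⟨_, _, hsol.sol, fun j => ?_, hsol.loop, hsol.edge, hsol.kirchhoff, ?_⟩
  · simp [slS_zero (hT _).le (hq _)]
  · by_contra! h0
    have hz := fun i => ((hsol.sol i).primitive_y (hT i).le).eq_zero_of_continuousOn (hT i)
      (h0 i) (hsol.sol i).continuousOn_z 0 ⟨le_rfl, (hT i).le⟩
    rcases hne with h | h | ⟨j, h⟩
    · have := h0 0 0 ⟨le_rfl, (hT 0).le⟩
      simp [slC_zero (hT 0).le (hq 0), slS_zero (hT 0).le (hq 0)] at this
      exact h this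
    · have := hz 0
      simp [slC'_zero (hT 0).le (hq 0), slS'_zero (hT 0).le (hq 0)] at this
      exact h this
    · have := hz j.succ
      simp [slS'_zero (hT _).le (hq _)] at this
      exact h this

theorem endS'_ne_zero (hT : ∀ i, 0 < T i) (hq : ∀ i, IntervalIntegrable (q i) volume 0 (T i))
    {j : Fin m} (h : endS T q j lam = 0) : endS' T q j lam ≠ 0 := by
  intro h'
  have := slC_mul_slS'_sub (hT j.succ).le (hq j.succ) lam (x := T j.succ) ⟨(hT _).le, le_rfl⟩
  rw [endS] at h
  rw [endS'] at h'
  simp [h, h'] at this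

/-- Zeros of the characteristic function are eigenvalues. -/
theorem isGraphEigenvalue_of_charDelta_eq_zero (hT : ∀ i, 0 < T i) (ha : a ≠ 0)
    (hq : ∀ i, IntervalIntegrable (q i) volume 0 (T i)) (h : charDelta T a q lam = 0) :
    IsGraphEigenvalue T a q lam := by
  have ha' : (a : ℂ) ≠ 0 := by exact_mod_cast ha
  have hW := slC_mul_slS'_sub (hT 0).le (hq 0) lam (x := T 0) ⟨(hT 0).le, le_rfl⟩
  by_cases hs : ∃ r, endS T q r lam = 0
  · obtain ⟨r, hr⟩ := hs
    by_cases hr2 : ∃ s, s ≠ r ∧ endS T q s lam = 0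
    · obtain ⟨s, hsr, hs⟩ := hr2
      -- Two edges with S_r = S_s = 0 at the vertex carry an eigenfunction vanishing on the rest of
      -- the graph; the coefficients make the two fluxes cancel.
      refine isGraphEigenvalue_of_coeff hT hq (c := 0) (p := 0)
        (b := Pi.single r (endS' T q s lam) + Pi.single s (-endS' T q r lam)) (by simp)
        (fun j => ?_) ?_ (Or.inr (Or.inr ⟨r, ?_⟩))
      · by_cases h1 : j = r
        · subst h1; simp [hr]
        · by_cases h2 : j = s
          · subst h2; simp [hs]
          · simp [h1, h2]
      · simp [add_mul, Finset.sum_add_distrib, Pi.single_apply, ite_mul]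
        ring
      · simpa [hsr.symm] using endS'_ne_zero hT hq hs
    · push Not at hr2
      have hr' := endS'_ne_zero hT hq hr
      -- When exactly one S_r vanishes, a single term of Δ survives and forces h = 0. Then S_0 on
      -- the loop vanishes at both ends, and a multiple of S_r balances its flux.
      have hh : loopH T q lam = 0 := by
        rw [charDelta, Finset.prod_eq_zero (Finset.mem_univ r) hr, mul_zero, zero_add,
          Finset.sum_eq_single r] at h
        · have hp : ∏ j ∈ Finset.univ.erase r, endS T q j lam ≠ 0 :=
            Finset.prod_ne_zero_iff.2 fun j hj => hr2 j (Finset.ne_of_mem_erase hj)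
          simpa [ha, hr', hp] using h
        · intro s _ hsr
          rw [Finset.prod_eq_zero (Finset.mem_erase.2 ⟨hsr.symm, Finset.mem_univ r⟩) hr, mul_zero]
        · simp
      refine isGraphEigenvalue_of_coeff hT hq (c := 0) (p := 1)
        (b := Pi.single r ((1 - (a : ℂ)⁻¹ * slS' (q 0) (T 0) (T 0) lam) / endS' T q r lam))
        (by simp [hh]) (fun j => ?_) ?_ (Or.inr (Or.inl one_ne_zero))
      · by_cases h1 : j = r
        · subst h1; simp [hr]
        · simp [h1]
      · simp [Pi.single_apply, ite_mul, hr']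
  · push Not at hs
    -- With no S_j vanishing, Δ divided by their product is the condition obtained by eliminating
    -- the boundary edges.
    have hsum : charDelta T a q lam = (∏ j, endS T q j lam) * ((hillD T a q lam - 2)
        + a * loopH T q lam * ∑ r, endS' T q r lam / endS T q r lam) := by
      rw [charDelta, mul_add, Finset.mul_sum, Finset.mul_sum, Finset.mul_sum]
      congr 1
      · ring
      · refine Finset.sum_congr rfl fun r _ => ?_
        rw [← Finset.mul_prod_erase _ _ (Finset.mem_univ r)]
        have := hs r
        field_simp
    rw [hsum] at h
    have hD := (mul_eq_zero.1 h).resolve_left (Finset.prod_ne_zero_iff.2 fun j _ => hs j)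
    rw [hillD] at hD
    by_cases hh : loopH T q lam = 0
    · rw [hh] at hD
      rw [loopH] at hh
      rw [hh] at hW
      set u := slC (q 0) (T 0) (T 0) lam
      set w := slS' (q 0) (T 0) (T 0) lam
      -- Here h = 0, so `u * w = 1` while `a * u` and `a⁻¹ * w` add up to 2; both are therefore 1,
      -- and S_0 alone on the loop satisfies the matching conditions.
      have hu : (a * u - 1) ^ 2 = 0 := by
        have : w = a * (2 - a * u) := by
          field_simp at hD
          linear_combination hD
        rw [this] at hW
        linear_combination -hW
      have hu : a * u = 1 := by simpa [sub_eq_zero] using hu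
      have hw : (a : ℂ)⁻¹ * w = 1 := by linear_combination hD - hu
      exact isGraphEigenvalue_of_coeff hT hq (c := 0) (p := 1) (b := 0) (by simp [loopH, hh])
        (by simp) (by simpa using hw.symm) (Or.inr (Or.inl one_ne_zero))
    -- With vertex value 1, continuity on the loop fixes `p` and continuity on the edges fixes `b`;
    -- Kirchhoff's condition is then Δ = 0.
    · refine isGraphEigenvalue_of_coeff hT hq (c := 1)
        (p := ((a : ℂ)⁻¹ - slC (q 0) (T 0) (T 0) lam) / loopH T q lam)
        (b := fun j => (endS T q j lam)⁻¹) ?_ (fun j => (inv_mul_cancel₀ (hs j)).symm) ?_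
        (Or.inl one_ne_zero)
      · field_simp
        ring
      · have e : ∑ j, (endS T q j lam)⁻¹ * endS' T q j lam
            = ∑ r, endS' T q r lam / endS T q r lam :=
          Finset.sum_congr rfl fun r _ => by rw [div_eq_inv_mul]
        rw [e]
        set Ψ := ∑ r, endS' T q r lam / endS T q r lam
        change _ - _ * loopH T q lam = _ at hW
        field_simp
        field_simp at hD
        linear_combination -hD + a * hW

/-- The graph solution extending the Weyl-type solution on the `k`-th boundary edge. -/
theorem exists_isGraphSolution_weylSol (hT : ∀ i, 0 < T i) (ha : a ≠ 0)
    (hq : ∀ i, IntervalIntegrable (q i) volume 0 (T i)) (k : Fin m)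
    (hs : ∀ j, endS T q j lam ≠ 0) (hh : loopH T q lam ≠ 0) (hΔ : charDelta T a q lam ≠ 0) :
    ∃ y z, IsGraphSolution T a q lam y z ∧ (∀ j, j ≠ k → y j.succ 0 = 0) ∧
      (∀ x, y k.succ x = weylSol (q k.succ) (T k.succ) (weylM T a q k) x lam) ∧
      ∀ x, z k.succ x = weylSol' (q k.succ) (T k.succ) (weylM T a q k) x lam := by
  have ha' : (a : ℂ) ≠ 0 := by exact_mod_cast ha
  have hW := slC_mul_slS'_sub (hT 0).le (hq 0) lam (x := T 0) ⟨(hT 0).le, le_rfl⟩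
  set M := weylM T a q k with hM
  set v := weylSol (q k.succ) (T k.succ) M (T k.succ) lam with hv
  set y : Fin m → ℝ → ℂ := Function.update
    (fun j x => v / endS T q j lam * slS (q j.succ) (T j.succ) x lam) k
    (fun x => weylSol (q k.succ) (T k.succ) M x lam) with hy
  set z : Fin m → ℝ → ℂ := Function.update
    (fun j x => v / endS T q j lam * slS' (q j.succ) (T j.succ) x lam) k
    (fun x => weylSol' (q k.succ) (T k.succ) M x lam) with hz
  -- Both determinants are linear in the data of edge `k` with common factors: Δ = P (S_k G + a h
  -- S_k') and Δ_k = P (C_k G + a h C_k'). Hence M is exactly the value for which Φ = C_k + M S_k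
  -- satisfies Φ G + a h Φ' = 0 at T_k, which is Kirchhoff's condition after eliminating the other
  -- edges.
  set G := hillD T a q lam - 2 + a * loopH T q lam *
    ∑ r ∈ Finset.univ.erase k, endS' T q r lam / endS T q r lam with hG
  set P := ∏ j ∈ Finset.univ.erase k, endS T q j lam with hP
  have hP0 : P ≠ 0 := Finset.prod_ne_zero_iff.2 fun j _ => hs j
  have hprod : ∀ r ∈ Finset.univ.erase k, ∏ j ∈ (Finset.univ.erase k).erase r, endS T q j lam
      = P / endS T q r lam := fun r hr => by
    rw [eq_div_iff (hs r), mul_comm]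
    exact Finset.mul_prod_erase _ (fun j => endS T q j lam) hr
  have e1 : charDelta T a q lam
      = P * (endS T q k lam * G + a * loopH T q lam * endS' T q k lam) := by
    rw [charDelta, ← Finset.mul_prod_erase _ _ (Finset.mem_univ k),
      ← Finset.add_sum_erase _ _ (Finset.mem_univ k), ← hP, hG]
    have : ∑ r ∈ Finset.univ.erase k, endS' T q r lam * ∏ j ∈ Finset.univ.erase r, endS T q j lam
        = endS T q k lam * P * ∑ r ∈ Finset.univ.erase k, endS' T q r lam / endS T q r lam := by
      rw [Finset.mul_sum]
      refine Finset.sum_congr rfl fun r hr => ?_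
      have hkr : k ∈ Finset.univ.erase r :=
        Finset.mem_erase.2 ⟨(Finset.ne_of_mem_erase hr).symm, Finset.mem_univ k⟩
      rw [← Finset.mul_prod_erase _ (fun j => endS T q j lam) hkr, Finset.erase_right_comm, hprod r hr]
      ring
    rw [this]
    ring
  have e2 : charDeltaK T a q k lam
      = P * (endC T q k lam * G + a * loopH T q lam * endC' T q k lam) := by
    rw [charDeltaK, ← hP, hG]
    have : ∑ r ∈ Finset.univ.erase k, endS' T q r lam *
        ∏ j ∈ (Finset.univ.erase k).erase r, endS T q j lam
        = P * ∑ r ∈ Finset.univ.erase k, endS' T q r lam / endS T q r lam := by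
      rw [Finset.mul_sum]
      refine Finset.sum_congr rfl fun r hr => ?_
      rw [hprod r hr]
      ring
    rw [this]
    ring
  have hDk : endS T q k lam * G + a * loopH T q lam * endS' T q k lam ≠ 0 := by
    intro h0
    rw [h0, mul_zero] at e1
    exact hΔ e1
  have hMe : M lam * (endS T q k lam * G + a * loopH T q lam * endS' T q k lam)
      = -(endC T q k lam * G + a * loopH T q lam * endC' T q k lam) := by
    rw [hM, weylM, e1, e2, mul_div_mul_left _ _ hP0, neg_mul, div_mul_cancel₀ _ hDk]
  have hvk : v * G + a * loopH T q lam * weylSol' (q k.succ) (T k.succ) M (T k.succ) lam = 0 := by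
    rw [hv, weylSol, weylSol']
    change (endC T q k lam + M lam * endS T q k lam) * G + a * loopH T q lam *
      (endC' T q k lam + M lam * endS' T q k lam) = 0
    linear_combination hMe
  have hzsum : ∑ j, z j (T j.succ) = weylSol' (q k.succ) (T k.succ) M (T k.succ) lam
      + v * ∑ r ∈ Finset.univ.erase k, endS' T q r lam / endS T q r lam := by
    rw [← Finset.add_sum_erase _ _ (Finset.mem_univ k), Finset.mul_sum]
    congr 1
    · simp [hz]
    · refine Finset.sum_congr rfl fun r hr => ?_
      rw [hz, Function.update_of_ne (Finset.ne_of_mem_erase hr)]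
      simp only [endS']
      ring
  refine ⟨_, _, isGraphSolution_cons (c := v)
    (p := v * ((a : ℂ)⁻¹ - slC (q 0) (T 0) (T 0) lam) / loopH T q lam) (y := y) (z := z) hT hq
    (fun j => ?_) ?_ (fun j => ?_) ?_, fun j hj => ?_, fun x => ?_, fun x => ?_⟩
  · rcases eq_or_ne j k with rfl | hj
    · simpa [hy, hz] using isSLSolution_weylSol (hT _).le (hq _) lam
    · simpa [hy, hz, hj] using (isSLSolution_slS (hT _).le (hq _) lam).const_mul (hT _).le (hq _) _
  · rw [← loopH]
    field_simp
    ring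
  · rcases eq_or_ne j k with rfl | hj
    · simp [hy, hv]
    · simp only [hy, Function.update_of_ne hj]
      exact (div_mul_cancel₀ v (hs j)).symm
  · rw [hzsum]
    rw [hG, hillD] at hvk
    change _ - _ * loopH T q lam = _ at hW
    set Ψ := ∑ r ∈ Finset.univ.erase k, endS' T q r lam / endS T q r lam
    field_simp
    field_simp at hvk
    linear_combination -hvk + a * v * hW
  · simp [hy, hj, slS_zero (hT _).le (hq _)]
  · simp [hy]
  · simp [hz]

end GraphAlgebra

/-! ### Form bound and boundary-controlled decay on one edge. -/

section SingleEdge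

variable {q q' : ℝ → ℝ} {T : ℝ}

/-- The quadratic form of the Sturm-Liouville operator is bounded from below. -/
theorem exists_form_bound (hT : 0 < T) (hq : IntervalIntegrable q volume 0 T) :
    ∃ c ≥ 0, ∀ (lam : ℂ) (y z : ℝ → ℂ), IsSLSolution q T lam y z →
      -c * ∫ x in (0 : ℝ)..T, ‖y x‖ ^ 2 ≤ ∫ x in (0 : ℝ)..T, (‖z x‖ ^ 2 + q x * ‖y x‖ ^ 2) := by
  set Q := ∫ x in (0 : ℝ)..T, |q x| with hQ
  have hQ0 : 0 ≤ Q := integral_abs_nonneg hT.le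
  refine ⟨Q * (1 / T + (Q + 1)), by positivity, fun lam y z h => ?_⟩
  have cy := h.continuousOn_y
  have cz := h.continuousOn_z
  have hTm : T ∈ Icc 0 T := ⟨hT.le, le_rfl⟩
  have iy : IntervalIntegrable (fun x => ‖y x‖ ^ 2) volume 0 T :=
    ContinuousOn.intervalIntegrable (by rw [uIcc_of_le hT.le]; exact cy.norm.pow 2)
  have iz : IntervalIntegrable (fun x => ‖z x‖ ^ 2) volume 0 T :=
    ContinuousOn.intervalIntegrable (by rw [uIcc_of_le hT.le]; exact cz.norm.pow 2)
  have iq : IntervalIntegrable (fun x => q x * ‖y x‖ ^ 2) volume 0 T :=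
    hq.mul_continuousOn (by rw [uIcc_of_le hT.le]; exact cy.norm.pow 2)
  set N := ∫ x in (0 : ℝ)..T, ‖y x‖ ^ 2 with hN
  set Z := ∫ x in (0 : ℝ)..T, ‖z x‖ ^ 2 with hZ
  have hN0 : 0 ≤ N := intervalIntegral.integral_nonneg hT.le fun _ _ => by positivity
  have hZ0 : 0 ≤ Z := intervalIntegral.integral_nonneg hT.le fun _ _ => by positivity
  have hprim := ((h.primitive_y hT.le).mul hT.le (h.primitive_y hT.le).conj)
  -- The oscillation of |y|² is at most ∫ 2 |y| |y'|, split by Young's inequality with weight `1 /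
  -- (Q + 1)` on |y'|²; multiplied by `Q` this weight stays below 1, so the kinetic term absorbs it.
  have hosc : ∀ x ∈ Icc 0 T, ∀ s ∈ Icc 0 T,
      ‖y x‖ ^ 2 ≤ ‖y s‖ ^ 2 + (1 / (Q + 1) * Z + (Q + 1) * N) := by
    intro x hx s hs
    have e : (((‖y x‖ ^ 2 - ‖y s‖ ^ 2 : ℝ)) : ℂ)
        = ∫ t in s..x, (z t * starRingEnd ℂ (y t) + y t * starRingEnd ℂ (z t)) := by
      have e1 := hprim.eq x hx
      have e2 := hprim.eq s hs
      rw [← intervalIntegral.integral_interval_sub_left (hprim.integrable_left hx)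
        (hprim.integrable_left hs)]
      push_cast
      rw [← Complex.mul_conj', ← Complex.mul_conj']
      linear_combination e1 - e2
    have hle : ‖y x‖ ^ 2 - ‖y s‖ ^ 2 ≤ ∫ t in (0 : ℝ)..T,
        (1 / (Q + 1) * ‖z t‖ ^ 2 + (Q + 1) * ‖y t‖ ^ 2) := by
      refine (le_abs_self _).trans ?_
      rw [← Real.norm_eq_abs, ← Complex.norm_real, e]
      refine (intervalIntegral.norm_integral_le_integral_norm_uIoc).trans ?_
      rw [intervalIntegral.integral_of_le hT.le]
      have hsub : uIoc s x ⊆ Ioc 0 T := Ioc_subset_Ioc (le_min hs.1 hx.1) (max_le hs.2 hx.2)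
      have imaj := (iz.const_mul (1 / (Q + 1))).add (iy.const_mul (Q + 1))
      have hmaj : IntegrableOn (fun t => 1 / (Q + 1) * ‖z t‖ ^ 2 + (Q + 1) * ‖y t‖ ^ 2)
          (Ioc 0 T) := (intervalIntegrable_iff_integrableOn_Ioc_of_le hT.le).1 imaj
      refine le_trans (setIntegral_mono_on ?_ (hmaj.mono_set hsub) measurableSet_uIoc ?_)
        (setIntegral_mono_set hmaj (Eventually.of_forall fun t => by positivity)
          hsub.eventuallyLE)
      · exact (((intervalIntegrable_iff_integrableOn_Ioc_of_le hT.le).1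
          (hprim.integrable_left hTm)).mono_set hsub).norm
      · intro t _
        refine (norm_add_le _ _).trans ?_
        rw [norm_mul, norm_mul, RCLike.norm_conj, RCLike.norm_conj]
        have h2 : 0 ≤ 1 / (Q + 1) * (‖z t‖ - (Q + 1) * ‖y t‖) ^ 2 := by positivity
        have h3 : 1 / (Q + 1) * (‖z t‖ - (Q + 1) * ‖y t‖) ^ 2
            = 1 / (Q + 1) * ‖z t‖ ^ 2 + (Q + 1) * ‖y t‖ ^ 2 - 2 * (‖z t‖ * ‖y t‖) := by
          field_simp
          ring
        linarith
    rw [intervalIntegral.integral_add (iz.const_mul _) (iy.const_mul _),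
      intervalIntegral.integral_const_mul, intervalIntegral.integral_const_mul] at hle
    linarith
  -- Averaging over `s` replaces the reference value by the mean of |y|².
  have hsup : ∀ x ∈ Icc 0 T, ‖y x‖ ^ 2 ≤ 1 / T * N + (1 / (Q + 1) * Z + (Q + 1) * N) := by
    intro x hx
    have := intervalIntegral.integral_mono_on hT.le intervalIntegrable_const
      (iy.add intervalIntegrable_const) (fun s hs => hosc x hx s hs)
    rw [intervalIntegral.integral_add iy intervalIntegrable_const,
      intervalIntegral.integral_const, intervalIntegral.integral_const] at this
    simp only [sub_zero, smul_eq_mul] at this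
    rw [← mul_le_mul_iff_right₀ hT, mul_add T]
    refine this.trans (le_of_eq ?_)
    rw [← hN]
    field_simp
  rw [intervalIntegral.integral_add iz iq]
  have hlow : -(Q * (1 / T * N + (1 / (Q + 1) * Z + (Q + 1) * N)))
      ≤ ∫ x in (0 : ℝ)..T, q x * ‖y x‖ ^ 2 := by
    rw [hQ, ← intervalIntegral.integral_mul_const, ← intervalIntegral.integral_neg]
    refine intervalIntegral.integral_mono_on hT.le (hq.abs.mul_const _).neg iq fun x hx => ?_
    have h1 := mul_le_mul_of_nonneg_left (hsup x hx) (abs_nonneg (q x))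
    have h2 : -(|q x| * ‖y x‖ ^ 2) ≤ q x * ‖y x‖ ^ 2 := by
      rw [← neg_mul]
      exact mul_le_mul_of_nonneg_right (neg_abs_le _) (by positivity)
    linarith
  have hQZ : Q * (1 / (Q + 1) * Z) ≤ Z := by
    have : Q * (1 / (Q + 1) * Z) = Q / (Q + 1) * Z := by ring
    rw [this]
    exact mul_le_of_le_one_left hZ0 ((div_le_one (by positivity)).2 (by linarith))
  rw [← hZ]
  linarith

/-- A solution with `y(0) = 1` whose outgoing amplitude dominates at the right end decays. -/
theorem exists_decay_bound (hT : 0 < T) (hq : IntervalIntegrable q volume 0 T) {τ : ℝ}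
    (hτ : 0 < τ) : ∃ C ≥ 0, ∃ R, ∀ (ρ : ℂ) (y z : ℝ → ℂ), τ ≤ ρ.im → R ≤ ‖ρ‖ →
      IsSLSolution q T (ρ ^ 2) y z → y 0 = 1 →
      0 ≤ (starRingEnd ℂ ρ * (starRingEnd ℂ (y T) * z T)).im → ∀ x ∈ Icc 0 T,
        ‖y x‖ ≤ C * Real.exp (-(ρ.im * x)) ∧ ‖z x‖ ≤ C * ‖ρ‖ * Real.exp (-(ρ.im * x)) := by
  set qr : ℝ → ℝ := fun x => q (T - x) with hqr
  have hqi : IntervalIntegrable qr volume 0 T := by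
    have := (hq.comp_sub_left T).symm
    simpa using this
  set Q := ∫ x in (0 : ℝ)..T, |qr x| with hQ
  have hQ0 : 0 ≤ Q := integral_abs_nonneg hT.le
  set d : ℝ := 1 - Real.exp (-(2 * τ * T)) with hd
  have hd0 : 0 < d := by
    have : Real.exp (-(2 * τ * T)) < Real.exp 0 :=
      Real.exp_lt_exp.2 (by nlinarith [mul_pos hτ hT])
    rw [Real.exp_zero] at this
    linarith
  refine ⟨16 / d, by positivity, freqThreshold qr T + 16 * Q / d, fun ρ y z hρ hR h hy0 him => ?_⟩
  have hρ0 : 0 < ρ.im := hτ.trans_le hρ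
  have hRf : freqThreshold qr T ≤ ‖ρ‖ := by
    have : 0 ≤ 16 * Q / d := by positivity
    linarith
  have hρne := ne_zero_of_freqThreshold_le hT.le hRf
  have hρn : 0 < ‖ρ‖ := norm_pos_iff.2 hρne
  have hRQ : 16 * Q ≤ d * ‖ρ‖ := by
    have := one_le_freqThreshold (q := qr) hT.le
    have : 16 * Q / d ≤ ‖ρ‖ := by linarith
    rw [div_le_iff₀ hd0] at this
    linarith
  -- Up to a common factor, `A` is the amplitude at T of the decaying exponential exp(iρx) and `B`,
  -- up to sign, that of the growing one. The sign hypothesis says precisely `‖B‖ ≤ ‖A‖`, so `A`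
  -- controls all data at T.
  set A := z T + Complex.I * ρ * y T with hA
  set B := z T - Complex.I * ρ * y T with hB
  have hAB : ‖B‖ ≤ ‖A‖ := by
    have e : ‖A‖ ^ 2 - ‖B‖ ^ 2 = 4 * (starRingEnd ℂ ρ * (starRingEnd ℂ (y T) * z T)).im := by
      rw [Complex.sq_norm, Complex.sq_norm, Complex.normSq_apply, Complex.normSq_apply]
      simp [hA, hB]
      ring
    exact le_of_sq_le_sq (by linarith) (norm_nonneg _)
  have hzT : ‖z T‖ ≤ ‖A‖ := by
    have : z T = (A + B) / 2 := by rw [hA, hB]; ring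
    rw [this, norm_div, RCLike.norm_ofNat, div_le_iff₀ two_pos]
    linarith [norm_add_le A B]
  have hyT : ‖ρ‖ * ‖y T‖ ≤ ‖A‖ := by
    have : ρ * y T = (A - B) / (2 * Complex.I) := by
      rw [hA, hB]
      field_simp
      ring
    rw [← norm_mul, this, norm_div, norm_mul, Complex.norm_I, RCLike.norm_ofNat, mul_one,
      div_le_iff₀ two_pos]
    linarith [norm_sub_le A B]
  -- Solving from T towards 0, the general growth bound turns into `exp (ρ.im * (T - x))`, which is
  -- the desired decay once `exp (ρ.im * T) * ‖A‖` is bounded.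
  have hr := h.reflect hT.le hq
  have habs : |ρ.im| = ρ.im := abs_of_pos hρ0
  have hle := le_of_freqThreshold_le hRf
  have by1 : ∀ x ∈ Icc 0 T, ‖y (T - x)‖ ≤ 4 * (‖A‖ / ‖ρ‖) * Real.exp (ρ.im * x) := by
    intro x hx
    have := hr.bound hT.le hqi hρne hle hx
    simp only [sub_zero, norm_neg, habs] at this
    refine this.trans ?_
    gcongr ?_ * _
    rw [show 4 * (‖A‖ / ‖ρ‖) = 2 * ((‖A‖ + ‖A‖) / ‖ρ‖) by ring]
    gcongr
  have bz1 : ∀ x ∈ Icc 0 T, ‖z (T - x)‖ ≤ 4 * ‖A‖ * Real.exp (ρ.im * x) := by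
    intro x hx
    have := hr.bound_deriv hT.le hqi hρne hle hx
    simp only [sub_zero, norm_neg, habs] at this
    refine this.trans ?_
    gcongr ?_ * _
    linarith
  have hTm : T ∈ Icc 0 T := ⟨hT.le, le_rfl⟩
  set E := Real.exp (ρ.im * T) with hE
  have hE0 : 0 < E := Real.exp_pos _
  have hamp : ∀ c : ℂ, |c.re| ≤ ρ.im → c ^ 2 = -ρ ^ 2 →
      ‖(-z 0 + c * y 0) - Complex.exp (c * T) * (-z T + c * y T)‖
        ≤ Q * (4 * (‖A‖ / ‖ρ‖)) * E := by
    intro c hc hc2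
    have hr' : IsSLSolution qr T (-c ^ 2) (fun x => y (T - x)) (fun x => -z (T - x)) := by
      rw [hc2, neg_neg]; exact hr
    simpa using hr'.amplitude_bound hT.le hqi hc by1 hTm
  have a1 := hamp (-(Complex.I * ρ)) (by simp [habs]) (by rw [neg_sq, mul_pow, Complex.I_sq]; ring)
  have a2 := hamp (Complex.I * ρ) (by simp [habs]) (by rw [mul_pow, Complex.I_sq]; ring)
  have n1 : ‖Complex.exp (-(Complex.I * ρ) * T)‖ = E := by
    rw [Complex.norm_exp]; simp [hE]
  have n2 : ‖Complex.exp (Complex.I * ρ * T)‖ ≤ (1 - d) * E := by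
    rw [Complex.norm_exp, hd, hE, sub_sub_cancel, ← Real.exp_add, Real.exp_le_exp]
    simp
    nlinarith
  -- The two amplitudes transported from T to 0 differ by 2iρ y(0) = 2iρ up to an error from the
  -- potential. The `B` term is smaller by the factor `1 - d`, and for `16 * Q ≤ d * ‖ρ‖` the error
  -- takes at most `d / 2`, so `E * ‖A‖` is bounded by a multiple of `‖ρ‖`.
  have key : E * ‖A‖ ≤ 2 * ‖ρ‖ + (1 - d) * E * ‖A‖ + 2 * (Q * (4 * (‖A‖ / ‖ρ‖)) * E) := by
    have e : Complex.exp (-(Complex.I * ρ) * T) * A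
        = 2 * Complex.I * ρ + Complex.exp (Complex.I * ρ * T) * B
          + (((-z 0 + -(Complex.I * ρ) * y 0)
              - Complex.exp (-(Complex.I * ρ) * T) * (-z T + -(Complex.I * ρ) * y T))
            - ((-z 0 + Complex.I * ρ * y 0)
              - Complex.exp (Complex.I * ρ * T) * (-z T + Complex.I * ρ * y T))) := by
      rw [hA, hB, hy0]; ring
    calc E * ‖A‖ = ‖Complex.exp (-(Complex.I * ρ) * T) * A‖ := by rw [norm_mul, n1]
      _ ≤ ‖2 * Complex.I * ρ‖ + ‖Complex.exp (Complex.I * ρ * T) * B‖ +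
          (Q * (4 * (‖A‖ / ‖ρ‖)) * E + Q * (4 * (‖A‖ / ‖ρ‖)) * E) := by
        rw [e]
        refine (norm_add_le _ _).trans (add_le_add (norm_add_le _ _) ?_)
        exact (norm_sub_le _ _).trans (add_le_add a1 a2)
      _ ≤ 2 * ‖ρ‖ + (1 - d) * E * ‖A‖ + (Q * (4 * (‖A‖ / ‖ρ‖)) * E + Q * (4 * (‖A‖ / ‖ρ‖)) * E) := by
        rw [norm_mul, norm_mul, norm_mul, Complex.norm_I, RCLike.norm_ofNat, mul_one]
        gcongr
        exact (norm_nonneg _).trans n2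
      _ = _ := by ring
  have hA1 : E * ‖A‖ ≤ 4 / d * ‖ρ‖ := by
    have : 2 * (Q * (4 * (‖A‖ / ‖ρ‖)) * E) ≤ d / 2 * (E * ‖A‖) := by
      have : 2 * (Q * (4 * (‖A‖ / ‖ρ‖)) * E) = 16 * Q / ‖ρ‖ * (E * ‖A‖) / 2 := by ring
      rw [this]
      have h2 : 16 * Q / ‖ρ‖ ≤ d := (div_le_iff₀ hρn).2 hRQ
      have := mul_le_mul_of_nonneg_right h2 (mul_nonneg hE0.le (norm_nonneg A))
      linarith
    rw [div_mul_eq_mul_div, le_div_iff₀ hd0]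
    nlinarith
  intro x hx
  have hx' : T - x ∈ Icc 0 T := ⟨by linarith [hx.2], by linarith [hx.1]⟩
  have hexp : Real.exp (ρ.im * (T - x)) = E * Real.exp (-(ρ.im * x)) := by
    rw [hE, ← Real.exp_add]; ring_nf
  have h1 := by1 _ hx'
  have h2 := bz1 _ hx'
  rw [sub_sub_cancel, hexp] at h1 h2
  constructor
  · calc _ ≤ _ := h1
      _ = 4 * ((E * ‖A‖) / ‖ρ‖) * Real.exp (-(ρ.im * x)) := by ring
      _ ≤ 4 * ((4 / d * ‖ρ‖) / ‖ρ‖) * Real.exp (-(ρ.im * x)) := by gcongr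
      _ = _ := by field_simp; ring
  · calc _ ≤ _ := h2
      _ = 4 * (E * ‖A‖) * Real.exp (-(ρ.im * x)) := by ring
      _ ≤ 4 * (4 / d * ‖ρ‖) * Real.exp (-(ρ.im * x)) := by gcongr
      _ = _ := by ring

/-- A solution is controlled by its values at the end points. -/
theorem exists_dirichlet_bound (hT : 0 < T) (hq : IntervalIntegrable q volume 0 T) {τ : ℝ}
    (hτ : 0 < τ) : ∃ C ≥ 0, ∃ R, ∀ (ρ : ℂ) (y z : ℝ → ℂ) (V : ℝ), τ ≤ ρ.im → R ≤ ‖ρ‖ →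
      IsSLSolution q T (ρ ^ 2) y z → ‖y 0‖ ≤ V → ‖y T‖ ≤ V →
      (∀ x ∈ Icc 0 T, ‖y x‖ ≤ C * V) ∧ ‖z 0‖ ≤ C * V * ‖ρ‖ := by
  set qr : ℝ → ℝ := fun x => q (T - x) with hqr
  have hqi : IntervalIntegrable qr volume 0 T := by
    have := (hq.comp_sub_left T).symm
    simpa using this
  have hTm : T ∈ Icc 0 T := ⟨hT.le, le_rfl⟩
  have h0m : (0 : ℝ) ∈ Icc 0 T := ⟨le_rfl, hT.le⟩
  obtain ⟨c, hc, R, hR, hlow⟩ := exists_le_norm_slS hT.le hq hτ hTm hT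
  refine ⟨4 / c, by positivity, max R (freqThreshold qr T), fun ρ y z V hρ hRρ h hy0 hyT => ?_⟩
  have hV : 0 ≤ V := (norm_nonneg _).trans hy0
  have hRq := hR.trans ((le_max_left _ _).trans hRρ)
  have hRqr := (le_max_right _ _).trans hRρ
  have hS := hlow ρ hρ ((le_max_left _ _).trans hRρ)
  have hρne := ne_zero_of_freqThreshold_le hT.le hRq
  have hρn : 0 < ‖ρ‖ := norm_pos_iff.2 hρne
  have habs : |ρ.im| = ρ.im := abs_of_pos (hτ.trans_le hρ)
  set E := Real.exp (ρ.im * T) with hE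
  have hE1 : 1 ≤ E := Real.one_le_exp (mul_nonneg (hτ.le.trans hρ) hT.le)
  have hE0 : 0 < E := Real.exp_pos _
  set S := slS q T T (ρ ^ 2) with hSd
  set D := slC q T T (ρ ^ 2) with hDd
  have sS := isSLSolution_slS hT.le hq (ρ ^ 2)
  have sC := isSLSolution_slC hT.le hq (ρ ^ 2)
  have nS : ∀ x ∈ Icc 0 T, ‖slS q T x (ρ ^ 2)‖ ≤ 2 / ‖ρ‖ * E := fun x hx => by
    refine (norm_slS_le hT.le hq hRq hx).trans ?_
    rw [habs, hE]
    gcongr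
    exacts [hτ.le.trans hρ, hx.2]
  have hv := sC.wronskian hT.le hq sS hTm
  rw [slC_zero hT.le hq, slS_zero hT.le hq, slC'_zero hT.le hq, slS'_zero hT.le hq] at hv
  -- The solution S(T) C(x) - C(T) S(x) vanishes at T with derivative -1, so its reflection obeys
  -- the same bound as S. Together with S it interpolates `y` between its end values, and the lower
  -- bound for S(T) permits division.
  have hrefl := ((sC.const_mul hT.le hq S).add hT.le hq (sS.const_mul hT.le hq (-D))).reflect
    hT.le hq
  have nR : ∀ x ∈ Icc 0 T, ‖S * slC q T x (ρ ^ 2) + -D * slS q T x (ρ ^ 2)‖ ≤ 2 / ‖ρ‖ * E := by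
    intro x hx
    have := hrefl.bound hT.le hqi hρne (le_of_freqThreshold_le hRqr) (x := T - x)
      ⟨by linarith [hx.2], by linarith [hx.1]⟩
    rw [sub_zero, sub_sub_cancel] at this
    have e1 : -(S * slC' q T T (ρ ^ 2) + -D * slS' q T T (ρ ^ 2)) = 1 := by
      linear_combination hv
    have e2 : S * slC q T T (ρ ^ 2) + -D * slS q T T (ρ ^ 2) = 0 := by
      rw [← hSd, ← hDd]; ring
    rw [e1, e2, norm_zero, norm_one, mul_zero, add_zero, habs] at this
    refine this.trans ?_
    rw [mul_one_div, hE]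
    gcongr
    exacts [hτ.le.trans hρ, by linarith [hx.1]]
  have hSn : 0 < ‖S‖ := lt_of_lt_of_le (by positivity) hS
  have hS' : c * E ≤ ‖S‖ * ‖ρ‖ := by
    rw [div_mul_eq_mul_div, div_le_iff₀ hρn] at hS
    exact hS
  have hrep : ∀ x ∈ Icc 0 T, y x = y 0 * slC q T x (ρ ^ 2) + z 0 * slS q T x (ρ ^ 2) := by
    intro x hx
    have := IsSLSolution.ext_of_initial hq h ((sC.const_mul hT.le hq (y 0)).add hT.le hq
      (sS.const_mul hT.le hq (z 0))) (by simp [slC_zero hT.le hq, slS_zero hT.le hq])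
      (by simp [slC'_zero hT.le hq, slS'_zero hT.le hq]) x hx
    exact this.1
  have hT1 := hrep T hTm
  constructor
  · intro x hx
    have e : y x * S = y 0 * (S * slC q T x (ρ ^ 2) + -D * slS q T x (ρ ^ 2))
        + y T * slS q T x (ρ ^ 2) := by
      rw [hrep x hx, hT1]; ring
    have hb : ‖y x‖ * ‖S‖ ≤ V * (2 / ‖ρ‖ * E) + V * (2 / ‖ρ‖ * E) := by
      rw [← norm_mul, e]
      refine (norm_add_le _ _).trans ?_
      rw [norm_mul, norm_mul]
      gcongr
      exacts [nR x hx, nS x hx]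
    have hb2 : ‖y x‖ * (c * E) ≤ 4 * V * E := by
      calc _ ≤ ‖y x‖ * (‖S‖ * ‖ρ‖) := by gcongr
        _ = ‖y x‖ * ‖S‖ * ‖ρ‖ := by ring
        _ ≤ (V * (2 / ‖ρ‖ * E) + V * (2 / ‖ρ‖ * E)) * ‖ρ‖ := by gcongr
        _ = _ := by field_simp; ring
    rw [div_mul_eq_mul_div, le_div_iff₀ hc]
    exact le_of_mul_le_mul_right (by linarith) hE0
  · have e : z 0 * S = y T - y 0 * D := by rw [hT1]; ring
    have nD := norm_slC_le hT.le hq hRq hTm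
    rw [habs] at nD
    have hb : ‖z 0‖ * ‖S‖ ≤ V * E + V * (2 * E) := by
      rw [← norm_mul, e]
      refine (norm_sub_le _ _).trans ?_
      rw [norm_mul]
      gcongr
      exact hyT.trans (le_mul_of_one_le_right hV hE1)
    have hb2 : ‖z 0‖ * (c * E) ≤ 4 * V * ‖ρ‖ * E := by
      calc _ ≤ ‖z 0‖ * (‖S‖ * ‖ρ‖) := by gcongr
        _ = ‖z 0‖ * ‖S‖ * ‖ρ‖ := by ring
        _ ≤ (V * E + V * (2 * E)) * ‖ρ‖ := by gcongr
        _ ≤ _ := by nlinarith [mul_nonneg (mul_nonneg hV hE0.le) hρn.le]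
    rw [div_mul_eq_mul_div, div_mul_eq_mul_div, le_div_iff₀ hc]
    exact le_of_mul_le_mul_right (by linarith) hE0

end SingleEdge

/-! ### Integrable majorants along the line from Plancherel's theorem. -/

section LineMajorant

variable {q q' : ℝ → ℝ} {T τ : ℝ}

theorem integrable_inv_sq_norm_line (hτ : 0 < τ) :
    Integrable fun σ : ℝ => (‖(σ : ℂ) + τ * Complex.I‖ ^ 2)⁻¹ := by
  have h := (integrable_inv_one_add_sq.comp_div hτ.ne').const_mul (τ ^ 2)⁻¹
  refine h.congr (Eventually.of_forall fun σ => ?_)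
  simp only
  rw [Complex.sq_norm, Complex.normSq_add_mul_I, ← mul_inv]
  congr 1
  field_simp
  ring

theorem memLp_mul_exp {p : ℝ → ℂ} (hp : MemLp p 2 (volume.restrict (Ioc 0 T))) (c : ℝ) :
    MemLp (fun t => p t * Complex.exp ((c * t : ℝ) : ℂ)) 2 (volume.restrict (Ioc 0 T)) := by
  refine MemLp.of_le_mul (c := Real.exp (|c| * T)) hp
    (hp.aestronglyMeasurable.mul (Continuous.aestronglyMeasurable (by fun_prop))) ?_
  filter_upwards [ae_restrict_mem measurableSet_Ioc] with t ht
  rw [norm_mul, mul_comm, Complex.norm_exp, Complex.ofReal_re]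
  gcongr
  · exact ht.1.le
  · exact le_abs_self c
  · exact ht.2

/-- The leading part of a solution as a sum of two exponentials. -/
theorem exists_exp_approx (hT : 0 ≤ T) (hq : IntervalIntegrable q volume 0 T) {B : ℝ} {θ : ℂ}
    (hθi : 0 < θ.im) (hθ : freqThreshold q T ≤ ‖θ‖) {y z : ℝ → ℂ}
    (h : IsSLSolution q T (θ ^ 2) y z) (hy : ‖y 0‖ ≤ B) (hz : ‖z 0‖ ≤ B * ‖θ‖) :
    ∃ α β : ℂ, ‖α‖ ≤ B ∧ ‖β‖ ≤ B ∧ ∀ x ∈ Icc 0 T,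
      ‖y x‖ ≤ 4 * B * Real.exp (θ.im * T) ∧
      ‖α * Complex.exp (Complex.I * θ * x) + β * Complex.exp (-(Complex.I * θ * x))‖
        ≤ 2 * B * Real.exp (θ.im * T) ∧
      ‖y x - (α * Complex.exp (Complex.I * θ * x) + β * Complex.exp (-(Complex.I * θ * x)))‖
        ≤ freqThreshold q T * (2 * B) * Real.exp (θ.im * T) / ‖θ‖ := by
  have hne := ne_zero_of_freqThreshold_le hT hθ
  have hn : 0 < ‖θ‖ := norm_pos_iff.2 hne
  have habs : |θ.im| = θ.im := abs_of_pos hθi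
  have hB : 0 ≤ B := (norm_nonneg _).trans hy
  have hzθ : ‖z 0 / θ‖ ≤ B := by
    rw [norm_div, div_le_iff₀ hn]; exact hz
  have hD : (‖z 0‖ + ‖θ‖ * ‖y 0‖) / ‖θ‖ ≤ 2 * B := by
    rw [div_le_iff₀ hn]
    nlinarith
  have hexp : ∀ x ∈ Icc 0 T, Real.exp (θ.im * x) ≤ Real.exp (θ.im * T) := fun x hx =>
    Real.exp_le_exp.2 (mul_le_mul_of_nonneg_left hx.2 hθi.le)
  have hα : ‖(y 0 - Complex.I * (z 0 / θ)) / 2‖ ≤ B := by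
    rw [norm_div, RCLike.norm_ofNat, div_le_iff₀ two_pos]
    refine (norm_sub_le _ _).trans ?_
    rw [norm_mul, Complex.norm_I, one_mul]
    linarith
  have hβ : ‖(y 0 + Complex.I * (z 0 / θ)) / 2‖ ≤ B := by
    rw [norm_div, RCLike.norm_ofNat, div_le_iff₀ two_pos]
    refine (norm_add_le _ _).trans ?_
    rw [norm_mul, Complex.norm_I, one_mul]
    linarith
  refine ⟨_, _, hα, hβ, fun x hx => ⟨?_, ?_, ?_⟩⟩
  · refine (h.bound hT hq hne (le_of_freqThreshold_le hθ) hx).trans ?_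
    rw [habs, show 4 * B = 2 * (2 * B) by ring]
    gcongr
    exact hx.2
  · have e1 := IsSLSolution.norm_exp_le (c := Complex.I * θ) (ω := θ.im) (by simp [habs]) hx.1
    have e2 := IsSLSolution.norm_exp_le (c := -(Complex.I * θ)) (ω := θ.im) (by simp [habs]) hx.1
    rw [neg_mul] at e2
    refine (norm_add_le _ _).trans ?_
    rw [norm_mul, norm_mul, two_mul, add_mul]
    gcongr
    · exact e1.trans (hexp x hx)
    · exact e2.trans (hexp x hx)
  · have := (h.free_approx hT hq hne (le_of_freqThreshold_le hθ) hx).1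
    have e : (y 0 - Complex.I * (z 0 / θ)) / 2 * Complex.exp (Complex.I * θ * x)
        + (y 0 + Complex.I * (z 0 / θ)) / 2 * Complex.exp (-(Complex.I * θ * x))
        = y 0 * Complex.cos (θ * x) + z 0 * (Complex.sin (θ * x) / θ) := by
      rw [Complex.cos, Complex.sin, show θ * x * Complex.I = Complex.I * θ * x by ring,
        show -(θ * x) * Complex.I = -(Complex.I * θ * x) by ring]
      field_simp
      ring
    rw [e]
    refine this.trans ?_
    rw [habs, div_mul_eq_mul_div]
    have hF : 0 ≤ freqThreshold q T := zero_le_one.trans (one_le_freqThreshold hT)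
    gcongr
    · rw [freqThreshold]; linarith
    · exact hx.2

/-- For a zero mean square-integrable weight, the weighted integral of a product of two solutions
is majorized along the line `Im θ = τ` by an integrable function, after division by `θ`. -/
theorem exists_line_majorant (hT : 0 ≤ T) (hτ : 0 < τ) (hq : IntervalIntegrable q volume 0 T)
    (hq' : IntervalIntegrable q' volume 0 T) {p : ℝ → ℂ}
    (hp : MemLp p 2 (volume.restrict (Ioc 0 T))) (hp0 : ∫ t in (0 : ℝ)..T, p t = 0) {B : ℝ}
    (hB : 0 ≤ B) :
    ∃ g : ℝ → ℝ, Integrable g ∧ ∀ σ : ℝ,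
      freqThreshold q T ≤ ‖(σ : ℂ) + τ * Complex.I‖ →
      freqThreshold q' T ≤ ‖(σ : ℂ) + τ * Complex.I‖ → ∀ y z y' z' : ℝ → ℂ,
      IsSLSolution q T (((σ : ℂ) + τ * Complex.I) ^ 2) y z →
      IsSLSolution q' T (((σ : ℂ) + τ * Complex.I) ^ 2) y' z' →
      ‖y 0‖ ≤ B → ‖z 0‖ ≤ B * ‖(σ : ℂ) + τ * Complex.I‖ →
      ‖y' 0‖ ≤ B → ‖z' 0‖ ≤ B * ‖(σ : ℂ) + τ * Complex.I‖ →
      ‖(∫ t in (0 : ℝ)..T, p t * (y t * y' t)) / ((σ : ℂ) + τ * Complex.I)‖ ≤ g σ := by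
  have hTm : T ∈ Icc 0 T := ⟨hT, le_rfl⟩
  have hpi : IntervalIntegrable p volume 0 T :=
    (intervalIntegrable_iff_integrableOn_Ioc_of_le hT).2 (hp.integrable (by norm_num))
  -- For θ = σ + iτ one has exp(±2iθt) = exp(±2iσt) exp(∓2τt); the real factor is put into the
  -- square-integrable weight.
  have G₁ := integrable_sq_norm_integral_exp hT (memLp_mul_exp hp (-(2 * τ))) (c := 2) (by norm_num)
  have G₂ := integrable_sq_norm_integral_exp hT (memLp_mul_exp hp (2 * τ)) (c := -2) (by norm_num)
  set P := ∫ t in (0 : ℝ)..T, ‖p t‖ with hP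
  have hP0 : 0 ≤ P := intervalIntegral.integral_nonneg hT fun _ _ => norm_nonneg _
  set E := Real.exp (τ * T) with hE
  set F := freqThreshold q T * (2 * B) * E with hF
  set F' := freqThreshold q' T * (2 * B) * E with hF'
  have hF0 : 0 ≤ F := by
    have := one_le_freqThreshold (q := q) hT
    positivity
  have hF0' : 0 ≤ F' := by
    have := one_le_freqThreshold (q := q') hT
    positivity
  set C := P * (F * (4 * B * E) + 2 * B * E * F') with hC
  -- The two norms are the Fourier integrals of `G₁` and `G₂`. The constant `B ^ 2` collects the two
  -- halves left by Young's inequality, and `C` comes from the deviation from free solutions.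
  refine ⟨fun σ => B ^ 2 * ((‖_‖ ^ 2 + ‖_‖ ^ 2)) + (B ^ 2 + C) * (‖(σ : ℂ) + τ * Complex.I‖ ^ 2)⁻¹,
    ((G₁.add G₂).const_mul _).add ((integrable_inv_sq_norm_line hτ).const_mul _), ?_⟩
  intro σ hσ hσ' y z y' z' h h' hy hz hy' hz'
  have him := line_im (τ := τ) σ
  set θ := (σ : ℂ) + τ * Complex.I with hθ
  obtain ⟨α, β, hα, hβ, H⟩ := exists_exp_approx hT hq (by rw [him]; exact hτ) hσ h hy hz
  obtain ⟨α', β', hα', hβ', H'⟩ := exists_exp_approx hT hq' (by rw [him]; exact hτ) hσ' h' hy' hz'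
  rw [him] at H H'
  have hn : 0 < ‖θ‖ := norm_pos_iff.2 (line_ne_zero hτ σ)
  have e₁ : ∀ t : ℝ, p t * Complex.exp ((-(2 * τ) * t : ℝ) : ℂ)
      * Complex.exp (Complex.I * (2 : ℝ) * σ * t) = p t * Complex.exp (2 * (Complex.I * θ * t)) := by
    intro t
    rw [mul_assoc, ← Complex.exp_add, hθ]
    congr 2
    push_cast
    linear_combination (-2 * τ * t) * Complex.I_sq
  have e₂ : ∀ t : ℝ, p t * Complex.exp ((2 * τ * t : ℝ) : ℂ)
      * Complex.exp (Complex.I * (-2 : ℝ) * σ * t)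
      = p t * Complex.exp (-(2 * (Complex.I * θ * t))) := by
    intro t
    rw [mul_assoc, ← Complex.exp_add, hθ]
    congr 2
    push_cast
    linear_combination (2 * τ * t) * Complex.I_sq
  simp only [e₁, e₂]
  set I₁ := ∫ t in (0 : ℝ)..T, p t * Complex.exp (2 * (Complex.I * θ * t)) with hI₁
  set I₂ := ∫ t in (0 : ℝ)..T, p t * Complex.exp (-(2 * (Complex.I * θ * t))) with hI₂
  set u : ℝ → ℂ := fun t => α * Complex.exp (Complex.I * θ * t)
    + β * Complex.exp (-(Complex.I * θ * t)) with hu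
  set u' : ℝ → ℂ := fun t => α' * Complex.exp (Complex.I * θ * t)
    + β' * Complex.exp (-(Complex.I * θ * t)) with hu'
  -- The cross terms of the product are constant in `t`, so the zero mean of `p` removes them; this
  -- is what makes the division by `θ` sufficient for integrability.
  have hmain : ∫ t in (0 : ℝ)..T, p t * (u t * u' t) = α * α' * I₁ + β * β' * I₂ := by
    have e : ∀ t : ℝ, p t * (u t * u' t) = α * α' * (p t * Complex.exp (2 * (Complex.I * θ * t)))
        + β * β' * (p t * Complex.exp (-(2 * (Complex.I * θ * t)))) + (α * β' + β * α') * p t := by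
      intro t
      simp only [hu, hu', Complex.exp_neg, two_mul, Complex.exp_add]
      have := Complex.exp_ne_zero (Complex.I * θ * t)
      field_simp
      ring
    simp only [e]
    have i1 : IntervalIntegrable (fun t : ℝ => p t * Complex.exp (2 * (Complex.I * θ * t)))
      volume 0 T := hpi.mul_continuousOn (by fun_prop)
    have i2 : IntervalIntegrable (fun t : ℝ => p t * Complex.exp (-(2 * (Complex.I * θ * t))))
      volume 0 T := hpi.mul_continuousOn (by fun_prop)
    rw [intervalIntegral.integral_add ((i1.const_mul _).add (i2.const_mul _)) (hpi.const_mul _),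
      intervalIntegral.integral_add (i1.const_mul _) (i2.const_mul _),
      intervalIntegral.integral_const_mul, intervalIntegral.integral_const_mul,
      intervalIntegral.integral_const_mul, hp0, mul_zero, add_zero]
  have cu : ContinuousOn (fun t => u t * u' t) (uIcc 0 T) := by
    simp only [hu, hu']; fun_prop
  have cy : ContinuousOn (fun t => y t * y' t) (uIcc 0 T) := by
    rw [uIcc_of_le hT]; exact h.continuousOn_y.mul h'.continuousOn_y
  have cyu : ContinuousOn (fun t => y t * y' t - u t * u' t) (uIcc 0 T) := cy.sub cu
  have hrest : ‖∫ t in (0 : ℝ)..T, p t * (y t * y' t - u t * u' t)‖ ≤ C / ‖θ‖ := by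
    refine (norm_integral_mul_le le_rfl hT le_rfl hpi (B := (F * (4 * B * E) + 2 * B * E * F') / ‖θ‖)
      (fun t ht => ?_) (by positivity)).trans (le_of_eq (by rw [hC]; ring))
    obtain ⟨a1, a2, a3⟩ := H t ht
    obtain ⟨b1, b2, b3⟩ := H' t ht
    have e : y t * y' t - u t * u' t = (y t - u t) * y' t + u t * (y' t - u' t) := by ring
    rw [e]
    refine (norm_add_le _ _).trans ?_
    rw [norm_mul, norm_mul]
    calc _ ≤ F / ‖θ‖ * (4 * B * E) + 2 * B * E * (F' / ‖θ‖) := by gcongr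
      _ = _ := by ring
  have hsplit : ∫ t in (0 : ℝ)..T, p t * (y t * y' t)
      = (α * α' * I₁ + β * β' * I₂) + ∫ t in (0 : ℝ)..T, p t * (y t * y' t - u t * u' t) := by
    rw [← hmain, ← intervalIntegral.integral_add (hpi.mul_continuousOn cu)
      (hpi.mul_continuousOn cyu)]
    congr 1
    ext t
    ring
  rw [hsplit, norm_div]
  have hb : ‖(α * α' * I₁ + β * β' * I₂) + ∫ t in (0 : ℝ)..T, p t * (y t * y' t - u t * u' t)‖
      ≤ B * B * ‖I₁‖ + B * B * ‖I₂‖ + C / ‖θ‖ := by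
    refine (norm_add_le _ _).trans (add_le_add ((norm_add_le _ _).trans ?_) hrest)
    rw [norm_mul, norm_mul, norm_mul, norm_mul]
    gcongr
  have am : ∀ s : ℝ, s * ‖θ‖⁻¹ ≤ s ^ 2 + (‖θ‖ ^ 2)⁻¹ / 2 := fun s => by
    rw [← inv_pow]
    nlinarith [sq_nonneg (s - ‖θ‖⁻¹), sq_nonneg s]
  rw [div_eq_mul_inv]
  calc _ ≤ (B * B * ‖I₁‖ + B * B * ‖I₂‖ + C / ‖θ‖) * ‖θ‖⁻¹ := by gcongr
    _ = B ^ 2 * (‖I₁‖ * ‖θ‖⁻¹ + ‖I₂‖ * ‖θ‖⁻¹) + C * (‖θ‖ ^ 2)⁻¹ := by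
      field_simp
    _ ≤ B ^ 2 * ((‖I₁‖ ^ 2 + (‖θ‖ ^ 2)⁻¹ / 2) + (‖I₂‖ ^ 2 + (‖θ‖ ^ 2)⁻¹ / 2))
        + C * (‖θ‖ ^ 2)⁻¹ := by
      gcongr
      exacts [am _, am _]
    _ = _ := by ring

end LineMajorant

theorem IsSLSolution.energy_eq {q : ℝ → ℝ} {T : ℝ} {lam : ℂ} {y z : ℝ → ℂ} (hT : 0 ≤ T)
    (hq : IntervalIntegrable q volume 0 T) (h : IsSLSolution q T lam y z) :
    z T * starRingEnd ℂ (y T) = z 0 * starRingEnd ℂ (y 0)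
      + (((∫ x in (0 : ℝ)..T, (‖z x‖ ^ 2 + q x * ‖y x‖ ^ 2) : ℝ) : ℂ)
        - lam * ((∫ x in (0 : ℝ)..T, ‖y x‖ ^ 2 : ℝ) : ℂ)) := by
  have iy : IntervalIntegrable (fun x => ‖y x‖ ^ 2) volume 0 T :=
    ContinuousOn.intervalIntegrable (by rw [uIcc_of_le hT]; exact h.continuousOn_y.norm.pow 2)
  have iz : IntervalIntegrable (fun x => ‖z x‖ ^ 2) volume 0 T :=
    ContinuousOn.intervalIntegrable (by rw [uIcc_of_le hT]; exact h.continuousOn_z.norm.pow 2)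
  have iq : IntervalIntegrable (fun x => q x * ‖y x‖ ^ 2) volume 0 T :=
    hq.mul_continuousOn (by rw [uIcc_of_le hT]; exact h.continuousOn_y.norm.pow 2)
  have he := iz.add iq
  have hec : IntervalIntegrable (fun x => ((‖z x‖ ^ 2 + q x * ‖y x‖ ^ 2 : ℝ) : ℂ)) volume 0 T :=
    ⟨he.1.ofReal, he.2.ofReal⟩
  have hyc : IntervalIntegrable (fun x => ((‖y x‖ ^ 2 : ℝ) : ℂ)) volume 0 T :=
    ⟨iy.1.ofReal, iy.2.ofReal⟩
  rw [(h.energy hT hq).eq T ⟨hT, le_rfl⟩, intervalIntegral.integral_sub hec (hyc.const_mul _),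
    intervalIntegral.integral_const_mul, intervalIntegral.integral_ofReal,
    intervalIntegral.integral_ofReal]

/-! ### Spectrum and Weyl solutions on the graph. -/

section Graph

variable {m : ℕ} {T : Fin (m + 1) → ℝ} {a : ℝ} {q q' : Fin (m + 1) → ℝ → ℝ} {lam : ℂ}
  {y z y' z' : Fin (m + 1) → ℝ → ℂ}

namespace IsGraphSolution

/-- Continuity and Kirchhoff's condition cancel the contributions of the internal vertex. -/
theorem vertex_sum (ha : a ≠ 0) (S : IsGraphSolution T a q lam y z) {w : Fin (m + 1) → ℝ → ℂ}
    (hw : w 0 0 = a * w 0 (T 0)) (hw' : ∀ j : Fin m, a * w 0 (T 0) = w j.succ (T j.succ)) :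
    (w 0 (T 0) * z 0 (T 0) - w 0 0 * z 0 0) + ∑ j : Fin m, w j.succ (T j.succ) * z j.succ (T j.succ)
      = 0 := by
  have ha' : (a : ℂ) ≠ 0 := by exact_mod_cast ha
  simp only [← hw', ← Finset.mul_sum]
  rw [hw, S.kirchhoff]
  field_simp
  ring

theorem conj_loop (S : IsGraphSolution T a q lam y z) :
    starRingEnd ℂ (y 0 0) = a * starRingEnd ℂ (y 0 (T 0)) := by
  rw [S.loop, map_mul, Complex.conj_ofReal]

theorem conj_edge (S : IsGraphSolution T a q lam y z) (j : Fin m) :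
    a * starRingEnd ℂ (y 0 (T 0)) = starRingEnd ℂ (y j.succ (T j.succ)) := by
  rw [← S.edge, map_mul, Complex.conj_ofReal]

/-- The vertex balance involves the loop and all boundary edges. On each edge but `k` the boundary
term equals that edge's integral, so the term of edge `k` is minus the sum over the rest of the
graph. -/
theorem eq_neg_sum_of_vertex {k : Fin m} {g : Fin (m + 1) → ℂ} {b : Fin m → ℂ}
    (h : g 0 + ∑ j, b j = 0) (hb : ∀ j, j ≠ k → b j = g j.succ) :
    b k = -∑ i ∈ Finset.univ.erase k.succ, g i := by
  have e := Finset.add_sum_erase Finset.univ g (Finset.mem_univ k.succ)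
  rw [Fin.sum_univ_succ] at e
  have e1 := Finset.add_sum_erase Finset.univ b (Finset.mem_univ k)
  have e2 := Finset.add_sum_erase Finset.univ (fun j : Fin m => g j.succ) (Finset.mem_univ k)
  have e3 : ∑ j ∈ Finset.univ.erase k, b j = ∑ j ∈ Finset.univ.erase k, g j.succ :=
    Finset.sum_congr rfl fun j hj => hb j (Finset.ne_of_mem_erase hj)
  linear_combination h + e1 - e2 + e - e3

/-- The energy identity on the complement of a boundary edge. -/
theorem energy (hT : ∀ i, 0 < T i) (ha : a ≠ 0)
    (hq : ∀ i, IntervalIntegrable (q i) volume 0 (T i)) (S : IsGraphSolution T a q lam y z)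
    {k : Fin m} (h0 : ∀ j, j ≠ k → y j.succ 0 = 0) :
    starRingEnd ℂ (y k.succ (T k.succ)) * z k.succ (T k.succ) =
      -∑ i ∈ Finset.univ.erase k.succ,
        (((∫ x in (0 : ℝ)..T i, (‖z i x‖ ^ 2 + q i x * ‖y i x‖ ^ 2) : ℝ) : ℂ)
          - lam * ((∫ x in (0 : ℝ)..T i, ‖y i x‖ ^ 2 : ℝ) : ℂ)) := by
  have hv := S.vertex_sum ha (w := fun i x => starRingEnd ℂ (y i x)) S.conj_loop S.conj_edge
  have hE := fun i => (S.sol i).energy_eq (hT i).le (hq i)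
  refine eq_neg_sum_of_vertex (b := fun j => starRingEnd ℂ (y j.succ (T j.succ)) *
    z j.succ (T j.succ)) ?_ fun j hj => ?_
  · linear_combination hv - hE 0
  · have := hE j.succ
    rw [h0 j hj, map_zero, mul_zero, zero_add] at this
    rw [← this, mul_comm]

/-- Lagrange's identity on the complement of a boundary edge. -/
theorem lagrange (hT : ∀ i, 0 < T i) (ha : a ≠ 0)
    (hq : ∀ i, IntervalIntegrable (q i) volume 0 (T i))
    (hq' : ∀ i, IntervalIntegrable (q' i) volume 0 (T i)) (S : IsGraphSolution T a q lam y z)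
    (S' : IsGraphSolution T a q' lam y' z') {k : Fin m} (h0 : ∀ j, j ≠ k → y j.succ 0 = 0)
    (h0' : ∀ j, j ≠ k → y' j.succ 0 = 0) :
    y k.succ (T k.succ) * z' k.succ (T k.succ) - z k.succ (T k.succ) * y' k.succ (T k.succ) =
      -∑ i ∈ Finset.univ.erase k.succ,
        ∫ x in (0 : ℝ)..T i, ((q' i x : ℂ) - q i x) * (y i x * y' i x) := by
  have hv := S'.vertex_sum ha S.loop S.edge
  have hv' := S.vertex_sum ha S'.loop S'.edge
  have hL : ∀ i, y i (T i) * z' i (T i) - z i (T i) * y' i (T i) = (y i 0 * z' i 0 - z i 0 * y' i 0)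
      + ∫ x in (0 : ℝ)..T i, ((q' i x : ℂ) - q i x) * (y i x * y' i x) := fun i => by
    have := ((S.sol i).lagrange (hT i).le (hq i) (hq' i) (S'.sol i)).eq (T i) ⟨(hT i).le, le_rfl⟩
    simpa only [sub_sub_sub_cancel_right] using this
  refine eq_neg_sum_of_vertex (b := fun j => y j.succ (T j.succ) * z' j.succ (T j.succ)
    - z j.succ (T j.succ) * y' j.succ (T j.succ)) ?_ fun j hj => ?_
  · rw [Finset.sum_sub_distrib]
    have e : ∑ j : Fin m, z j.succ (T j.succ) * y' j.succ (T j.succ)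
        = ∑ j : Fin m, y' j.succ (T j.succ) * z j.succ (T j.succ) :=
      Finset.sum_congr rfl fun _ _ => mul_comm _ _
    rw [e]
    linear_combination hv - hv' - hL 0
  · have := hL j.succ
    rw [h0 j hj, h0' j hj, zero_mul, mul_zero, sub_zero, zero_add] at this
    exact this

end IsGraphSolution

theorem exists_graph_form_bound (hT : ∀ i, 0 < T i)
    (hq : ∀ i, IntervalIntegrable (q i) volume 0 (T i)) :
    ∃ c ≥ 0, ∀ i, ∀ (lam : ℂ) (y z : ℝ → ℂ), IsSLSolution (q i) (T i) lam y z →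
      -c * ∫ x in (0 : ℝ)..T i, ‖y x‖ ^ 2
        ≤ ∫ x in (0 : ℝ)..T i, (‖z x‖ ^ 2 + q i x * ‖y x‖ ^ 2) := by
  choose c hc h using fun i => exists_form_bound (hT i) (hq i)
  obtain ⟨C, hC⟩ := (Set.finite_range c).bddAbove
  have hC' : ∀ i, c i ≤ C := fun i => hC (mem_range_self i)
  refine ⟨C, (hc 0).le.trans (hC' 0), fun i lam y z hyz => le_trans ?_ (h i lam y z hyz)⟩
  have hN : 0 ≤ ∫ x in (0 : ℝ)..T i, ‖y x‖ ^ 2 :=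
    intervalIntegral.integral_nonneg (hT i).le fun _ _ => by positivity
  nlinarith [hC' i]

/-- The eigenvalues are real and bounded from below. -/
theorem exists_eigenvalue_lower_bound (hT : ∀ i, 0 < T i) (ha : a ≠ 0)
    (hq : ∀ i, IntervalIntegrable (q i) volume 0 (T i)) :
    ∃ c ≥ 0, ∀ lam, IsGraphEigenvalue T a q lam → ∃ r : ℝ, lam = r ∧ -c ≤ r := by
  obtain ⟨c, hc, hform⟩ := exists_graph_form_bound hT hq
  refine ⟨c, hc, fun lam ⟨y, z, hsol, h0, hloop, hedge, hk, i₀, x₀, hx₀, hne⟩ => ?_⟩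
  have S : IsGraphSolution T a q lam y z := ⟨hsol, hloop, hedge, hk⟩
  set N : Fin (m + 1) → ℝ := fun i => ∫ x in (0 : ℝ)..T i, ‖y i x‖ ^ 2 with hN
  set E : Fin (m + 1) → ℝ := fun i => ∫ x in (0 : ℝ)..T i, (‖z i x‖ ^ 2 + q i x * ‖y i x‖ ^ 2)
    with hE
  have hN0 : ∀ i, 0 ≤ N i := fun i =>
    intervalIntegral.integral_nonneg (hT i).le fun _ _ => by positivity
  have hNpos : 0 < ∑ i, N i := by
    refine Finset.sum_pos' (fun i _ => hN0 i) ⟨i₀, Finset.mem_univ _, ?_⟩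
    exact intervalIntegral.integral_pos (hT i₀) ((hsol i₀).continuousOn_y.norm.pow 2)
      (fun _ _ => by positivity) ⟨x₀, hx₀, by positivity⟩
  have hEi := fun i => (hsol i).energy_eq (hT i).le (hq i)
  have hv := S.vertex_sum ha (w := fun i x => starRingEnd ℂ (y i x)) S.conj_loop S.conj_edge
  -- Summing the energy identities over the graph cancels all boundary terms, which leaves Σ E = λ Σ
  -- N with real E, N and E ≥ -c N.
  have hsum : ∑ i, (((E i : ℝ) : ℂ) - lam * ((N i : ℝ) : ℂ)) = 0 := by
    rw [Fin.sum_univ_succ, ← hv]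
    congr 1
    · linear_combination -hEi 0
    · refine Finset.sum_congr rfl fun j _ => ?_
      have := hEi j.succ
      rw [h0 j, map_zero, mul_zero, zero_add] at this
      rw [← this, mul_comm]
  rw [Finset.sum_sub_distrib, ← Finset.mul_sum, ← Complex.ofReal_sum, ← Complex.ofReal_sum,
    sub_eq_zero] at hsum
  have hNc : ((∑ i, N i : ℝ) : ℂ) ≠ 0 := by exact_mod_cast hNpos.ne'
  refine ⟨(∑ i, E i) / ∑ i, N i, ?_, ?_⟩
  · rw [Complex.ofReal_div, eq_div_iff hNc, hsum]
  · rw [le_div_iff₀ hNpos, Finset.mul_sum]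
    exact Finset.sum_le_sum fun i _ => hform i lam _ _ (hsol i)

/-- Nonnegative eigenvalues have real square roots; a negative one `r ≥ -c` has roots with imaginary
part at most `√c` in modulus. -/
theorem exists_spectrumInside (hT : ∀ i, 0 < T i) (ha : a ≠ 0)
    (hq : ∀ i, IntervalIntegrable (q i) volume 0 (T i)) :
    ∃ τ₀ > 0, ∀ τ ≥ τ₀, SpectrumInside T a q τ := by
  obtain ⟨c, hc, h⟩ := exists_eigenvalue_lower_bound hT ha hq
  refine ⟨√c + 1, by positivity, fun τ hτ lam hlam => ?_⟩
  have hτ0 : √c < τ := by linarith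
  obtain ⟨r, rfl, hr⟩ := h lam hlam
  rcases le_total 0 r with h0 | h0
  · refine ⟨(√r : ℝ), ?_, ?_⟩
    · rw [← Complex.ofReal_pow, Real.sq_sqrt h0]
    · simpa using (Real.sqrt_nonneg c).trans_lt hτ0
  · refine ⟨(√(-r) : ℝ) * Complex.I, ?_, ?_⟩
    · rw [mul_pow, ← Complex.ofReal_pow, Real.sq_sqrt (by linarith), Complex.I_sq]
      push_cast
      ring
    · have : |((√(-r) : ℝ) * Complex.I).im| = √(-r) := by simp
      rw [this]
      exact (Real.sqrt_le_sqrt (by linarith)).trans_lt hτ0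

/-- Zeros of Δ are eigenvalues, and any square root of `θ ^ 2` is `θ` or `-θ`, so its imaginary part
is at least `τ` in modulus. -/
theorem SpectrumInside.charDelta_ne_zero {τ : ℝ} (hT : ∀ i, 0 < T i) (ha : a ≠ 0)
    (hq : ∀ i, IntervalIntegrable (q i) volume 0 (T i)) (h : SpectrumInside T a q τ) {θ : ℂ}
    (hθ : τ ≤ θ.im) : charDelta T a q (θ ^ 2) ≠ 0 := by
  intro h0
  obtain ⟨ρ, hρ, him⟩ := h _ (isGraphEigenvalue_of_charDelta_eq_zero hT ha hq h0)
  rcases sq_eq_sq_iff_eq_or_eq_neg.1 hρ with rfl | rfl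
  · exact absurd (hθ.trans (le_abs_self _)) (not_le.2 him)
  · rw [Complex.neg_im] at hθ
    exact absurd (hθ.trans (neg_le_abs _)) (not_le.2 him)

theorem differentiable_charDelta (hT : ∀ i, 0 < T i)
    (hq : ∀ i, IntervalIntegrable (q i) volume 0 (T i)) : Differentiable ℂ (charDelta T a q) := by
  have hm : ∀ i, T i ∈ Icc 0 (T i) := fun i => ⟨(hT i).le, le_rfl⟩
  have d1 := fun i => (entireFamily_slS (hT i).le (hq i)).differentiable _ (hm i)
  have d2 := fun i => (entireFamily_slS' (hT i).le (hq i)).differentiable _ (hm i)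
  have d3 := fun i => (entireFamily_slC (hT i).le (hq i)).differentiable _ (hm i)
  unfold charDelta hillD loopH endS endS'
  have p : ∀ s : Finset (Fin m), Differentiable ℂ fun lam =>
      ∏ j ∈ s, slS (q j.succ) (T j.succ) (T j.succ) lam := fun s =>
    Differentiable.fun_finsetProd fun j _ => d1 j.succ
  exact (((((d3 0).const_mul _).add ((d2 0).const_mul _)).sub_const 2).mul (p _)).add
    (((d1 0).const_mul _).mul (Differentiable.fun_sum fun r _ => (d2 _).mul (p _)))

theorem differentiable_charDeltaK (hT : ∀ i, 0 < T i)
    (hq : ∀ i, IntervalIntegrable (q i) volume 0 (T i)) (k : Fin m) :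
    Differentiable ℂ (charDeltaK T a q k) := by
  have hm : ∀ i, T i ∈ Icc 0 (T i) := fun i => ⟨(hT i).le, le_rfl⟩
  have d1 := fun i => (entireFamily_slS (hT i).le (hq i)).differentiable _ (hm i)
  have d2 := fun i => (entireFamily_slS' (hT i).le (hq i)).differentiable _ (hm i)
  have d3 := fun i => (entireFamily_slC (hT i).le (hq i)).differentiable _ (hm i)
  have d4 := fun i => (entireFamily_slC' (hT i).le (hq i)).differentiable _ (hm i)
  unfold charDeltaK hillD loopH endS endS' endC endC'
  have p : ∀ s : Finset (Fin m), Differentiable ℂ fun lam =>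
      ∏ j ∈ s, slS (q j.succ) (T j.succ) (T j.succ) lam := fun s =>
    Differentiable.fun_finsetProd fun j _ => d1 j.succ
  exact (((((d3 0).const_mul _).add ((d2 0).const_mul _)).sub_const 2).mul ((d3 _).mul (p _))).add
    (((d1 0).const_mul _).mul (((d4 _).mul (p _)).add
      ((d3 _).mul (Differentiable.fun_sum fun r _ => (d2 _).mul (p _)))))

theorem differentiableAt_weylM {τ : ℝ} (hT : ∀ i, 0 < T i) (ha : a ≠ 0)
    (hq : ∀ i, IntervalIntegrable (q i) volume 0 (T i)) (h : SpectrumInside T a q τ) (k : Fin m)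
    {θ : ℂ} (hθ : τ ≤ θ.im) : DifferentiableAt ℂ (weylM T a q k) (θ ^ 2) :=
  ((differentiable_charDeltaK hT hq k _).div (differentiable_charDelta hT hq _)
    (h.charDelta_ne_zero hT ha hq hθ)).neg

/-- The graph solution whose restriction to the `k`-th boundary edge is the Weyl solution `y₀`,
with the bounds it satisfies at high frequency. -/
structure IsWeylGraphSolution (T : Fin (m + 1) → ℝ) (a : ℝ) (q : Fin (m + 1) → ℝ → ℝ) (k : Fin m)
    (C : ℝ) (ρ : ℂ) (y z : Fin (m + 1) → ℝ → ℂ) : Prop where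
  sol : IsGraphSolution T a q (ρ ^ 2) y z
  zero : ∀ j, j ≠ k → y j.succ 0 = 0
  eq_y : ∀ x, y k.succ x = weylSol (q k.succ) (T k.succ) (weylM T a q k) x (ρ ^ 2)
  eq_z : ∀ x, z k.succ x = weylSol' (q k.succ) (T k.succ) (weylM T a q k) x (ρ ^ 2)
  decay : ∀ x ∈ Icc 0 (T k.succ), ‖y k.succ x‖ ≤ C * Real.exp (-(ρ.im * x)) ∧
    ‖z k.succ x‖ ≤ C * ‖ρ‖ * Real.exp (-(ρ.im * x))
  rest : ∀ i, i ≠ k.succ → ∀ x ∈ Icc 0 (T i), ‖y i x‖ ≤ C * Real.exp (-(ρ.im * T k.succ))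
  initial : ∀ i, ‖y i 0‖ ≤ C ∧ ‖z i 0‖ ≤ C * ‖ρ‖

/-- The rest of the graph acts on edge `k` as a dissipative load: its energy identity supplies the
sign condition of `exists_decay_bound`. The vertex value is then O(exp(-Im ρ T_k)), and
`exists_dirichlet_bound` carries this smallness to every other edge from its end values. -/
theorem exists_isWeylGraphSolution {τ : ℝ} (hτ : 0 < τ) (hT : ∀ i, 0 < T i) (ha : a ≠ 0)
    (hq : ∀ i, IntervalIntegrable (q i) volume 0 (T i)) (h : SpectrumInside T a q τ) (k : Fin m) :
    ∃ C ≥ 0, ∃ R, ∀ ρ : ℂ, τ ≤ ρ.im → R ≤ ‖ρ‖ →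
      ∃ y z, IsWeylGraphSolution T a q k C ρ y z := by
  have hm : ∀ i, T i ∈ Icc 0 (T i) := fun i => ⟨(hT i).le, le_rfl⟩
  obtain ⟨c, hc, hform⟩ := exists_graph_form_bound hT hq
  obtain ⟨C₁, hC₁, R₁, hdecay⟩ := exists_decay_bound (hT k.succ) (hq k.succ) hτ
  choose d hd r hr hlow using fun i =>
    exists_le_norm_slS (hT i).le (hq i) hτ (hm i) (hT i)
  choose D hD s hdir using fun i => exists_dirichlet_bound (hT i) (hq i) hτ
  obtain ⟨R₂, hR₂⟩ := (Set.finite_range r).bddAbove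
  obtain ⟨R₃, hR₃⟩ := (Set.finite_range s).bddAbove
  obtain ⟨C₂, hC₂⟩ := (Set.finite_range D).bddAbove
  have hDC : ∀ i, D i ≤ C₂ := fun i => hC₂ (mem_range_self i)
  have hC₂0 : 0 ≤ C₂ := (hD 0).le.trans (hDC 0)
  -- On the loop the end value y_0(T_0) is the vertex value divided by `a`; the 1 covers all other
  -- end values.
  set A := 1 + |a|⁻¹ with hA
  have hA0 : 0 ≤ A := by positivity
  refine ⟨C₁ + C₂ * (A * C₁), by positivity, max (max R₁ √c) (max R₂ R₃), fun ρ hρ hR => ?_⟩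
  have hRρ₁ : R₁ ≤ ‖ρ‖ := (le_max_left _ _).trans ((le_max_left _ _).trans hR)
  have hRc : √c ≤ ‖ρ‖ := (le_max_right _ _).trans ((le_max_left _ _).trans hR)
  have hRρ₂ : R₂ ≤ ‖ρ‖ := (le_max_left _ _).trans ((le_max_right _ _).trans hR)
  have hRρ₃ : R₃ ≤ ‖ρ‖ := (le_max_right _ _).trans ((le_max_right _ _).trans hR)
  have hρ0 : 0 < ρ.im := hτ.trans_le hρ
  have hρn : 0 < ‖ρ‖ := norm_pos_iff.2 fun h0 => by simp [h0] at hρ0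
  have hcρ : c ≤ ‖ρ‖ ^ 2 := by
    rw [← Real.sq_sqrt hc]
    gcongr
  have hne : ∀ i, slS (q i) (T i) (T i) (ρ ^ 2) ≠ 0 := fun i => by
    rw [← norm_pos_iff]
    have := hd i
    exact lt_of_lt_of_le (by positivity) (hlow i ρ hρ ((hR₂ (mem_range_self i)).trans hRρ₂))
  obtain ⟨y, z, S, h0, hy, hz⟩ := exists_isGraphSolution_weylSol hT ha hq k
    (fun j => hne j.succ) (hne 0) (h.charDelta_ne_zero hT ha hq hρ)
  have hy1 : y k.succ 0 = 1 := by
    rw [hy, weylSol, slC_zero (hT _).le (hq _), slS_zero (hT _).le (hq _)]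
    ring
  -- With total energy E and mass N of the other edges the quantity equals Im ρ (‖ρ‖² N + E), which
  -- is nonnegative because E ≥ -c N and `c ≤ ‖ρ‖ ^ 2`.
  have him : 0 ≤ (starRingEnd ℂ ρ *
      (starRingEnd ℂ (y k.succ (T k.succ)) * z k.succ (T k.succ))).im := by
    rw [S.energy hT ha hq h0, Finset.sum_sub_distrib, ← Finset.mul_sum, ← Complex.ofReal_sum,
      ← Complex.ofReal_sum]
    have hEN : -c * ∑ i ∈ Finset.univ.erase k.succ, ∫ x in (0 : ℝ)..T i, ‖y i x‖ ^ 2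
        ≤ ∑ i ∈ Finset.univ.erase k.succ,
          ∫ x in (0 : ℝ)..T i, (‖z i x‖ ^ 2 + q i x * ‖y i x‖ ^ 2) := by
      rw [Finset.mul_sum]
      exact Finset.sum_le_sum fun i _ => hform i _ _ _ (S.sol i)
    have hN0 : 0 ≤ ∑ i ∈ Finset.univ.erase k.succ, ∫ x in (0 : ℝ)..T i, ‖y i x‖ ^ 2 :=
      Finset.sum_nonneg fun i _ =>
        intervalIntegral.integral_nonneg (hT i).le fun _ _ => by positivity
    set N := ∑ i ∈ Finset.univ.erase k.succ, ∫ x in (0 : ℝ)..T i, ‖y i x‖ ^ 2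
    set E := ∑ i ∈ Finset.univ.erase k.succ,
      ∫ x in (0 : ℝ)..T i, (‖z i x‖ ^ 2 + q i x * ‖y i x‖ ^ 2)
    have e : (starRingEnd ℂ ρ * -((E : ℂ) - ρ ^ 2 * (N : ℂ))).im
        = ρ.im * (‖ρ‖ ^ 2 * N + E) := by
      rw [Complex.sq_norm, Complex.normSq_apply]
      simp [sq]
      ring
    rw [e]
    refine mul_nonneg hρ0.le ?_
    nlinarith
  have hb := hdecay ρ _ _ hρ hRρ₁ (S.sol k.succ) hy1 him
  set X := Real.exp (-(ρ.im * T k.succ)) with hX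
  have hX1 : X ≤ 1 := Real.exp_le_one_iff.2 (by nlinarith [hT k.succ])
  have hX0 : 0 < X := Real.exp_pos _
  have hv : ‖y k.succ (T k.succ)‖ ≤ C₁ * X := (hb _ (hm _)).1
  have hV : ∀ i, i ≠ k.succ → ‖y i 0‖ ≤ A * (C₁ * X) ∧ ‖y i (T i)‖ ≤ A * (C₁ * X) := by
    have h1A : C₁ * X ≤ A * (C₁ * X) := le_mul_of_one_le_left (by positivity) (by
      rw [hA]; linarith [inv_nonneg.2 (abs_nonneg a)])
    intro i
    refine Fin.cases (fun _ => ⟨?_, ?_⟩) (fun j hj => ⟨?_, ?_⟩) i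
    · rw [S.loop, S.edge k]
      exact hv.trans h1A
    · have e : y 0 (T 0) = (a : ℂ)⁻¹ * y k.succ (T k.succ) := by
        rw [← S.edge k]
        have ha' : (a : ℂ) ≠ 0 := by exact_mod_cast ha
        field_simp
      rw [e, norm_mul, norm_inv, Complex.norm_real, Real.norm_eq_abs]
      have : |a|⁻¹ ≤ A := by rw [hA]; linarith
      gcongr
    · rw [h0 j (fun h => hj (by rw [h])), norm_zero]
      positivity
    · rw [← S.edge j, S.edge k]
      exact hv.trans h1A
  have hrest : ∀ i, i ≠ k.succ → (∀ x ∈ Icc 0 (T i), ‖y i x‖ ≤ C₂ * (A * C₁) * X) ∧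
      ‖z i 0‖ ≤ C₂ * (A * C₁) * ‖ρ‖ := by
    intro i hi
    obtain ⟨b1, b2⟩ := hdir i ρ _ _ _ hρ ((hR₃ (mem_range_self i)).trans hRρ₃) (S.sol i)
      (hV i hi).1 (hV i hi).2
    have hAX : 0 ≤ A * (C₁ * X) := by positivity
    refine ⟨fun x hx => (b1 x hx).trans ?_, b2.trans ?_⟩
    · calc D i * (A * (C₁ * X)) ≤ C₂ * (A * (C₁ * X)) := by gcongr; exact hDC i
        _ = _ := by ring
    · gcongr ?_ * _
      calc D i * (A * (C₁ * X)) ≤ C₂ * (A * (C₁ * X)) := by gcongr; exact hDC i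
        _ ≤ C₂ * (A * (C₁ * 1)) := by gcongr
        _ = _ := by ring
  have hCC : 0 ≤ C₂ * (A * C₁) := by positivity
  refine ⟨y, z, S, h0, hy, hz, fun x hx => ⟨(hb x hx).1.trans ?_, (hb x hx).2.trans ?_⟩,
    fun i hi x hx => ((hrest i hi).1 x hx).trans ?_, fun i => ?_⟩
  · gcongr; linarith
  · gcongr; linarith
  · gcongr; linarith
  · have hm0 : ∀ i, (0 : ℝ) ∈ Icc 0 (T i) := fun i => ⟨le_rfl, (hT i).le⟩
    by_cases hi : i = k.succ
    · subst hi
      have := hb 0 (hm0 _)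
      rw [mul_zero, neg_zero, Real.exp_zero, mul_one, mul_one] at this
      refine ⟨this.1.trans (by linarith), this.2.trans ?_⟩
      gcongr; linarith
    · refine ⟨((hrest i hi).1 0 (hm0 i)).trans ?_, (hrest i hi).2.trans ?_⟩
      · nlinarith
      · gcongr; linarith

end Graph

/-! ### The difference of the two Weyl functions. -/

section WeylPair

variable {m : ℕ} {T : Fin (m + 1) → ℝ} {a : ℝ} {q q' : Fin (m + 1) → ℝ → ℝ} {k : Fin m}
  {τ C C' : ℝ} {ρ : ℂ} {y z y' z' : Fin (m + 1) → ℝ → ℂ}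

theorem intervalIntegrable_sub_ofReal {p p' : ℝ → ℝ} {b : ℝ} (hp : IntervalIntegrable p volume 0 b)
    (hp' : IntervalIntegrable p' volume 0 b) :
    IntervalIntegrable (fun t => (p' t : ℂ) - p t) volume 0 b :=
  IntervalIntegrable.sub (f := fun t => (p' t : ℂ)) (g := fun t => (p t : ℂ))
    ⟨hp'.1.ofReal, hp'.2.ofReal⟩ ⟨hp.1.ofReal, hp.2.ofReal⟩

namespace IsWeylGraphSolution

/-- The difference of two Weyl functions as an integral over the graph. -/
theorem weylM_sub (hT : ∀ i, 0 < T i) (ha : a ≠ 0)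
    (hq : ∀ i, IntervalIntegrable (q i) volume 0 (T i))
    (hq' : ∀ i, IntervalIntegrable (q' i) volume 0 (T i))
    (S : IsWeylGraphSolution T a q k C ρ y z) (S' : IsWeylGraphSolution T a q' k C' ρ y' z') :
    weylM T a q k (ρ ^ 2) - weylM T a q' k (ρ ^ 2)
      = ∑ i, ∫ x in (0 : ℝ)..T i, ((q' i x : ℂ) - q i x) * (y i x * y' i x) := by
  have h1 := S.sol.lagrange hT ha hq hq' S'.sol S.zero S'.zero
  -- At 0 the Wronskian of Φ and Φ̃ is M̃ - M; at the vertex it is given by the integrals over the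
  -- other edges.
  have h2 := ((S.sol.sol k.succ).lagrange (hT _).le (hq _) (hq' _) (S'.sol.sol k.succ)).eq
    (T k.succ) ⟨(hT _).le, le_rfl⟩
  simp only [sub_sub_sub_cancel_right] at h2
  rw [S.eq_y 0, S'.eq_y 0, S.eq_z 0, S'.eq_z 0, weylSol, weylSol, weylSol', weylSol',
    slC_zero (hT _).le (hq _), slS_zero (hT _).le (hq _), slC'_zero (hT _).le (hq _),
    slS'_zero (hT _).le (hq _), slC_zero (hT _).le (hq' _), slS_zero (hT _).le (hq' _),
    slC'_zero (hT _).le (hq' _), slS'_zero (hT _).le (hq' _)] at h2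
  rw [← Finset.add_sum_erase _ _ (Finset.mem_univ k.succ)]
  linear_combination h2 - h1

/-- The Wronskian at `x` is minus the integral of (q̃ - q) y ỹ over everything beyond `x`: the
remainder of edge `k` and all other edges. Both solutions are O(exp(-Im ρ x)) there. -/
theorem norm_wronskian_le (hT : ∀ i, 0 < T i) (ha : a ≠ 0)
    (hq : ∀ i, IntervalIntegrable (q i) volume 0 (T i))
    (hq' : ∀ i, IntervalIntegrable (q' i) volume 0 (T i)) (hρ : 0 ≤ ρ.im)
    (hC : 0 ≤ C) (hC' : 0 ≤ C')
    (S : IsWeylGraphSolution T a q k C ρ y z) (S' : IsWeylGraphSolution T a q' k C' ρ y' z') {x : ℝ}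
    (hx : x ∈ Icc 0 (T k.succ)) :
    ‖y k.succ x * z' k.succ x - z k.succ x * y' k.succ x‖
      ≤ (∑ i, ∫ t in (0 : ℝ)..T i, ‖(q' i t : ℂ) - q i t‖) * (C * C') *
        (Real.exp (-(ρ.im * x)) * Real.exp (-(ρ.im * x))) := by
  have hTk : T k.succ ∈ Icc 0 (T k.succ) := ⟨(hT _).le, le_rfl⟩
  have hp := fun i => intervalIntegrable_sub_ofReal (hq i) (hq' i)
  have h1 := S.sol.lagrange hT ha hq hq' S'.sol S.zero S'.zero
  have hprim := (S.sol.sol k.succ).lagrange (hT _).le (hq _) (hq' _) (S'.sol.sol k.succ)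
  simp only [sub_sub_sub_cancel_right] at hprim
  have h2 := hprim.eq _ hTk
  have h3 := hprim.eq x hx
  rw [← intervalIntegral.integral_add_adjacent_intervals (hprim.integrable_left hx)
    ((hprim.integrable_left hx).symm.trans (hprim.integrable_left hTk))] at h2
  have e : y k.succ x * z' k.succ x - z k.succ x * y' k.succ x
      = -(∫ t in x..T k.succ, ((q' k.succ t : ℂ) - q k.succ t) * (y k.succ t * y' k.succ t))
        - ∑ i ∈ Finset.univ.erase k.succ,
          ∫ t in (0 : ℝ)..T i, ((q' i t : ℂ) - q i t) * (y i t * y' i t) := by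
    linear_combination h3 - h2 + h1
  set X := Real.exp (-(ρ.im * x)) with hX
  have hX0 : 0 < X := Real.exp_pos _
  have hmono : ∀ t, x ≤ t → Real.exp (-(ρ.im * t)) ≤ X := fun t ht =>
    Real.exp_le_exp.2 (neg_le_neg (mul_le_mul_of_nonneg_left ht hρ))
  have b1 : ‖∫ t in x..T k.succ, ((q' k.succ t : ℂ) - q k.succ t) * (y k.succ t * y' k.succ t)‖
      ≤ (∫ t in (0 : ℝ)..T k.succ, ‖(q' k.succ t : ℂ) - q k.succ t‖) * (C * X * (C' * X)) :=
    norm_integral_mul_le hx.1 hx.2 le_rfl (hp _) (fun t ht => by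
      have ht' : t ∈ Icc 0 (T k.succ) := ⟨hx.1.trans ht.1, ht.2⟩
      rw [norm_mul]
      have h1 := hmono t ht.1
      have h2 := (S.decay t ht').1
      have h3 := (S'.decay t ht').1
      calc _ ≤ (C * Real.exp (-(ρ.im * t))) * (C' * Real.exp (-(ρ.im * t))) := by gcongr
        _ ≤ _ := by gcongr) (by positivity)
  have b2 : ∀ i ∈ Finset.univ.erase k.succ,
      ‖∫ t in (0 : ℝ)..T i, ((q' i t : ℂ) - q i t) * (y i t * y' i t)‖
        ≤ (∫ t in (0 : ℝ)..T i, ‖(q' i t : ℂ) - q i t‖) * (C * X * (C' * X)) := fun i hi =>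
    norm_integral_mul_le le_rfl (hT i).le le_rfl (hp i) (fun t ht => by
      rw [norm_mul]
      have h1 := hmono (T k.succ) hx.2
      have h2 := S.rest i (Finset.ne_of_mem_erase hi) t ht
      have h3 := S'.rest i (Finset.ne_of_mem_erase hi) t ht
      calc _ ≤ (C * Real.exp (-(ρ.im * T k.succ))) * (C' * Real.exp (-(ρ.im * T k.succ))) := by
            gcongr
        _ ≤ _ := by gcongr) (by positivity)
  rw [e, ← Finset.add_sum_erase _ _ (Finset.mem_univ k.succ)]
  refine (norm_sub_le _ _).trans ?_
  rw [norm_neg]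
  refine (add_le_add b1 ((norm_sum_le _ _).trans (Finset.sum_le_sum b2))).trans (le_of_eq ?_)
  rw [← Finset.sum_mul]
  ring

end IsWeylGraphSolution

theorem isDecayingWeyl_weylM (hτ : 0 < τ) (hT : ∀ i, 0 < T i) (ha : a ≠ 0)
    (hq : ∀ i, IntervalIntegrable (q i) volume 0 (T i)) (h : SpectrumInside T a q τ) (k : Fin m) :
    IsDecayingWeyl (q k.succ) (T k.succ) τ (weylM T a q k) := by
  refine ⟨fun θ hθ => differentiableAt_weylM hT ha hq h k hθ, ?_⟩
  obtain ⟨C, hC, R, H⟩ := exists_isWeylGraphSolution hτ hT ha hq h k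
  refine ⟨C, hC, R, fun θ hθ hR x hx => ?_⟩
  obtain ⟨y, z, S⟩ := H θ hθ hR
  rw [← S.eq_y, ← S.eq_z]
  exact S.decay x hx

theorem IsZeroMeanL2.memLp (h : IsZeroMeanL2 T q) (i : Fin (m + 1)) :
    MemLp (q i) 2 (volume.restrict (Ioc 0 (T i))) := by
  rw [← restrict_Ioo_eq_restrict_Ioc]
  exact (h i).1

theorem IsZeroMeanL2.intervalIntegrable (hT : ∀ i, 0 < T i) (h : IsZeroMeanL2 T q)
    (i : Fin (m + 1)) : IntervalIntegrable (q i) volume 0 (T i) :=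
  (intervalIntegrable_iff_integrableOn_Ioc_of_le (hT i).le).2
    ((h.memLp i).integrable (by norm_num))

theorem continuous_weylM_line (hT : ∀ i, 0 < T i) (ha : a ≠ 0)
    (hq : ∀ i, IntervalIntegrable (q i) volume 0 (T i)) (h : SpectrumInside T a q τ) (k : Fin m) :
    Continuous fun σ : ℝ => weylM T a q k (((σ : ℂ) + τ * Complex.I) ^ 2) := by
  rw [continuous_iff_continuousAt]
  intro σ
  exact ContinuousAt.comp (g := weylM T a q k) (f := fun σ : ℝ => ((σ : ℂ) + τ * Complex.I) ^ 2)
    (differentiableAt_weylM hT ha hq h k (line_im σ).ge).continuousAt (by fun_prop)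

/-- At high frequency `weylM_sub` and the majorants of `exists_line_majorant` apply edge by edge;
the mean of `q' i - q i` vanishes. On the remaining compact part of the line continuity is enough.
-/
theorem integrable_weylM_sub_div (hτ : 0 < τ) (hT : ∀ i, 0 < T i) (ha : a ≠ 0)
    (hq : IsZeroMeanL2 T q) (hq' : IsZeroMeanL2 T q') (h : SpectrumInside T a q τ)
    (h' : SpectrumInside T a q' τ) (k : Fin m) :
    Integrable fun σ : ℝ => (weylM T a q k (((σ : ℂ) + τ * Complex.I) ^ 2)
      - weylM T a q' k (((σ : ℂ) + τ * Complex.I) ^ 2)) / ((σ : ℂ) + τ * Complex.I) := by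
  have hqi := hq.intervalIntegrable hT
  have hqi' := hq'.intervalIntegrable hT
  obtain ⟨C, hC, R, H⟩ := exists_isWeylGraphSolution hτ hT ha hqi h k
  obtain ⟨C', hC', R', H'⟩ := exists_isWeylGraphSolution hτ hT ha hqi' h' k
  have hmean : ∀ i, ∫ t in (0 : ℝ)..T i, ((q' i t : ℂ) - q i t) = 0 := fun i => by
    have i1 : IntervalIntegrable (fun t => (q i t : ℂ)) volume 0 (T i) :=
      ⟨(hqi i).1.ofReal, (hqi i).2.ofReal⟩
    have i2 : IntervalIntegrable (fun t => (q' i t : ℂ)) volume 0 (T i) :=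
      ⟨(hqi' i).1.ofReal, (hqi' i).2.ofReal⟩
    rw [intervalIntegral.integral_sub i2 i1, intervalIntegral.integral_ofReal,
      intervalIntegral.integral_ofReal, (hq i).2, (hq' i).2, sub_self]
  choose g hg hmaj using fun i => exists_line_majorant (hT i).le hτ (hqi i) (hqi' i)
    ((hq'.memLp i).ofReal (K := ℂ) |>.sub ((hq.memLp i).ofReal (K := ℂ))) (hmean i)
    (B := max C C') (hC.le.trans (le_max_left _ _))
  obtain ⟨Q, hQ⟩ := (Set.finite_range fun i => freqThreshold (q i) (T i)).bddAbove
  obtain ⟨Q', hQ'⟩ := (Set.finite_range fun i => freqThreshold (q' i) (T i)).bddAbove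
  set L := max (max R R') (max Q Q') with hL
  set f : ℝ → ℂ := fun σ => (weylM T a q k (((σ : ℂ) + τ * Complex.I) ^ 2)
      - weylM T a q' k (((σ : ℂ) + τ * Complex.I) ^ 2)) / ((σ : ℂ) + τ * Complex.I) with hf
  have hcont : Continuous f :=
    ((continuous_weylM_line hT ha hqi h k).sub (continuous_weylM_line hT ha hqi' h' k)).div
      (by fun_prop) (line_ne_zero hτ)
  have hb : ∀ σ : ℝ, L ≤ ‖(σ : ℂ) + τ * Complex.I‖ → ‖f σ‖ ≤ ∑ i, g i σ := by
    intro σ hσ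
    have hR : R ≤ ‖(σ : ℂ) + τ * Complex.I‖ :=
      (le_max_left _ _).trans ((le_max_left _ _).trans hσ)
    have hR' : R' ≤ ‖(σ : ℂ) + τ * Complex.I‖ :=
      (le_max_right _ _).trans ((le_max_left _ _).trans hσ)
    have hQσ : Q ≤ ‖(σ : ℂ) + τ * Complex.I‖ :=
      (le_max_left _ _).trans ((le_max_right _ _).trans hσ)
    have hQσ' : Q' ≤ ‖(σ : ℂ) + τ * Complex.I‖ :=
      (le_max_right _ _).trans ((le_max_right _ _).trans hσ)
    obtain ⟨y, z, S⟩ := H _ (line_im σ).ge hR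
    obtain ⟨y', z', S'⟩ := H' _ (line_im σ).ge hR'
    simp only [hf]
    rw [S.weylM_sub hT ha hqi hqi' S', Finset.sum_div]
    refine (norm_sum_le _ _).trans (Finset.sum_le_sum fun i _ => ?_)
    exact hmaj i σ ((hQ (mem_range_self i)).trans hQσ) ((hQ' (mem_range_self i)).trans hQσ')
      _ _ _ _ (S.sol.sol i) (S'.sol.sol i) ((S.initial i).1.trans (le_max_left _ _))
      ((S.initial i).2.trans (by gcongr; exact le_max_left _ _))
      ((S'.initial i).1.trans (le_max_right _ _))
      ((S'.initial i).2.trans (by gcongr; exact le_max_right _ _))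
  have hG : Integrable fun σ => ∑ i, g i σ := integrable_finsetSum _ fun i _ => hg i
  have h1 : IntegrableOn f (Icc (-|L|) |L|) := hcont.continuousOn.integrableOn_Icc
  have h2 : IntegrableOn f (Icc (-|L|) |L|)ᶜ := by
    refine Integrable.mono' hG.integrableOn hcont.aestronglyMeasurable ?_
    filter_upwards [ae_restrict_mem measurableSet_Icc.compl] with σ hσ
    refine hb σ ?_
    have hσ' : |L| < |σ| := by
      by_contra! hle
      exact hσ (abs_le.1 hle)
    have := Complex.abs_re_le_norm ((σ : ℂ) + τ * Complex.I)
    simp only [Complex.add_re, Complex.ofReal_re, Complex.mul_re, Complex.I_re, mul_zero,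
      Complex.ofReal_im, Complex.I_im, zero_mul, sub_self, add_zero] at this
    exact (le_abs_self L).trans (hσ'.le.trans this)
  rw [← integrableOn_univ, ← union_compl_self (Icc (-|L|) |L|)]
  exact h1.union h2

/-- The Weyl functions of two problems on the graph form a Weyl pair on the corresponding edge. -/
theorem isWeylPair_weylM (hτ : 0 < τ) (hT : ∀ i, 0 < T i) (ha : a ≠ 0)
    (hq : IsZeroMeanL2 T q) (hq' : IsZeroMeanL2 T q') (h : SpectrumInside T a q τ)
    (h' : SpectrumInside T a q' τ) (k : Fin m) :
    IsWeylPair (q k.succ) (q' k.succ) (T k.succ) τ (weylM T a q k) (weylM T a q' k) := by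
  have hqi := hq.intervalIntegrable hT
  have hqi' := hq'.intervalIntegrable hT
  refine ⟨isDecayingWeyl_weylM hτ hT ha hqi h k, isDecayingWeyl_weylM hτ hT ha hqi' h' k, ?_,
    integrable_weylM_sub_div hτ hT ha hq hq' h h' k⟩
  obtain ⟨C, hC, R, H⟩ := exists_isWeylGraphSolution hτ hT ha hqi h k
  obtain ⟨C', hC', R', H'⟩ := exists_isWeylGraphSolution hτ hT ha hqi' h' k
  refine ⟨(∑ i, ∫ t in (0 : ℝ)..T i, ‖(q' i t : ℂ) - q i t‖) * (C * C'), ?_, max R R',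
    fun θ hθ hR x hx => ?_⟩
  · exact mul_nonneg (Finset.sum_nonneg fun i _ =>
      intervalIntegral.integral_nonneg (hT i).le fun _ _ => norm_nonneg _) (mul_nonneg hC hC')
  · obtain ⟨y, z, S⟩ := H θ hθ ((le_max_left _ _).trans hR)
    obtain ⟨y', z', S'⟩ := H' θ hθ ((le_max_right _ _).trans hR)
    rw [← S.eq_y, ← S.eq_z, ← S'.eq_y, ← S'.eq_z]
    exact S.norm_wronskian_le hT ha hqi hqi' (hτ.le.trans hθ) hC hC' S' hx

end WeylPair

/-! ### The theorem for the graph. -/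

theorem theorem4p1 (m : ℕ) (T : Fin (m + 1) → ℝ) (hT : ∀ i, 0 < T i) (a : ℝ) (ha : a ≠ 0)
    (q q' : Fin (m + 1) → ℝ → ℝ) (hq : IsZeroMeanL2 T q) (hq' : IsZeroMeanL2 T q') (k : Fin m) :
    -- the contour can be chosen as required
    (∃ τ₀ > 0, ∀ τ ≥ τ₀, SpectrumInside T a q τ ∧ SpectrumInside T a q' τ) ∧
    -- the transformation operator exists
    (∃ K, IsTransformationKernel (T k.succ) (q k.succ) (q' k.succ) K) ∧
    -- and its kernel satisfies the Gelfand-Levitan-type equation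
    ∀ τ > 0, SpectrumInside T a q τ → SpectrumInside T a q' τ →
      ∀ K, IsTransformationKernel (T k.succ) (q k.succ) (q' k.succ) K →
        (∀ x ∈ Set.Icc 0 (T k.succ), ∀ t ∈ Set.Icc 0 (T k.succ),
          MeasureTheory.Integrable (contourIntegrand T a q q' k τ x t)) ∧
        ∀ x ∈ Set.Icc 0 (T k.succ), ∀ t ∈ Set.Icc 0 x,
          IntervalIntegrable (fun s => K x s * contourF T a q q' k τ s t)
            MeasureTheory.volume 0 x ∧
          K x t + contourF T a q q' k τ x t
            + ∫ s in (0 : ℝ)..x, K x s * contourF T a q q' k τ s t = 0 := by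

  have hqi := hq.intervalIntegrable hT
  have hqi' := hq'.intervalIntegrable hT
  have hspec : ∃ τ₀ > 0, ∀ τ ≥ τ₀, SpectrumInside T a q τ ∧ SpectrumInside T a q' τ := by
    obtain ⟨τ₁, h1, H1⟩ := exists_spectrumInside hT ha hqi
    obtain ⟨τ₂, h2, H2⟩ := exists_spectrumInside hT ha hqi'
    exact ⟨max τ₁ τ₂, lt_max_of_lt_left h1, fun τ hτ =>
      ⟨H1 τ ((le_max_left _ _).trans hτ), H2 τ ((le_max_right _ _).trans hτ)⟩⟩
  refine ⟨hspec, ?_, fun τ hτ h h' K hK => ?_⟩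
  -- The existence statement does not mention a contour; any admissible `τ` yields a kernel.
  · obtain ⟨τ, hτ, H⟩ := hspec
    exact ⟨_, isTransformationKernel_contourKernel (hT k.succ).le hτ (hqi _) (hqi' _)
      (isWeylPair_weylM hτ hT ha hq hq' (H τ le_rfl).1 (H τ le_rfl).2 k)⟩
  · have W := isWeylPair_weylM hτ hT ha hq hq' h h' k
    have dS := isLineDecaying_slS (hT k.succ).le hτ (hqi k.succ)
    -- `contourIntegrand` unfolds to `parabolaIntegrand` with S in both slots, so the results for a
    -- single edge apply as they stand.
    refine ⟨fun x hx t ht => integrable_parabolaIntegrand hτ dS dS W hx ht, fun x hx t ht => ?_⟩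
    exact hK.gelfandLevitan (hT _) hτ (hqi _) (hqi' _) W hx ht fun x t => rfl
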